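/- Let $N\ge 0$, let $K$ be a field, and let $x_1,\dots,x_{N-1}$, $y_1,\dots,y_{N-2}\in K$. **Okada algebra.** $O_N(X,Y)$ is the unital associative $K$-algebra generated by $e_1,\dots,e_{N-1}$ with relations $e_i^2=x_ie_i$; $e_ie_j=e_je_i$ for $|i-j|\ge 2$; $e_{i+1}e_ie_{i+1}=y_ie_{i+1}$ for $1\le i\le N-2$. For $\sigma\in S_N$ put $c_i=\#\{j<i:\sigma^{-1}(j)>\sigma^{-1}(i)\}$ and $e_\sigma=\prod_{i=1}^{N}e_{i-1}e_{i-2}\cdots e_{i-c_i}$ (factors from left to right, with increasing $i$). **Diagrams.** Order the nodes $1<\dots<N<\overline N<\dots<\overline 1$, with $|a|=|\overline a|=a$. An Okada arc-diagram of rank $N$ is a non-crossing perfect matching of the $2N$ nodes with a height label $h\ge 1$ on every arc, such that the label of an arc $\{a,b\}$ is at most $\min(|a|,|b|)$ and has the same parity as it, and an arc $\{a<b\}$ nested in an arc $\{c<d\}$ (that is, $c<a<b<d$) has the larger label. An arc $\{a,\overline b\}$ is called propagating. The mirror $D^\star$ exchanges $a$ and $\overline a$ for all $a$. The identity diagram has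 the arcs $\{a,\overline a\}$ with label $a$; for $1\le i<N$ the diagram $G_i$ has the arcs $\{j,\overline j\}$ with label $j$ $(j\ne i,i+1)$ and the arcs $\{i,i+1\}$, $\{\overline i,\overline{i+1}\}$ with label $i$. The composition $C\circ D$ identifies each node $\overline a$ of $C$ with the node $a$ of $D$; every resulting arc or loop is labelled by the minimum of the labels of its constituents. $[C\circ D]$ is the diagram obtained by deleting the loops, and $\ell_k$ is the number of loops of label $k$. For a diagram $D$ let $b_i(D)$ be half the number of nodes $u$ such that the arc at $u$ has label $\le i$ and $i<|u|$. Define $m_0=0$ and $m_i=b_i(C)+b_i(D)-b_i([C\circ D])-\ell_i-m_{i-1}$. The diagram algebra $A_N(X,Y)$ is the $K$-vector space with basis the Okada arc-diagrams of rank $N$, with the bilinear product $$C\cdot D=\prod_{k=1}^{N-1}x_k^{\ell_k}\ \prod_{k=1}^{N-2}y_k^{m_k}\ [C\circ D].$$ (For $y_1=\dots=y_{N-2}=1$ only the factor recording the loops remains.) The mirror map is extended linearly. **Half diagrams.** An Okada half arc-diagram of rank $N$ is the left half $\langle D|$ of an Okada arc-diagram $D$ cut in the middle: labelled full arcs $\{a,b\}$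 and labelled half arcs (the cut propagating arcs) on $\{1,\dots,N\}$. Put $|D\rangle=\langle D^\star|$. For two half diagrams $L,R$ with the same set of half arc labels, the gluing $L\bowtie R$ is the unique Okada arc-diagram $D$ with $\langle D|=L$ and $|D\rangle=R$. The $r$-restriction of a half diagram $H$ keeps the full arcs inside $\{1,\dots,r\}$, and turns each full arc $\{a,b\}$ with $a\le r<b$ and each half arc at $a\le r$ into a half arc at $a$ with the same label. The chain of $H$ is $(C_0,\dots,C_N)$, where $C_r$ is the set of half arc labels of the $r$-restriction of $H$, regarded as a Fibonacci set of rank $r$ (a set $\{s_1<\dots<s_k\}\subseteq\{1,\dots,r\}$ with $k\equiv r$ and $s_l\equiv l$ modulo $2$; the rank is part of the data). **Fomin's correspondence.** For $\sigma\in S_N$ define Fibonacci sets $\Lambda_{i,j}$, $0\le i,j\le N$, by $\Lambda_{i,0}=\Lambda_{0,j}=\emptyset$ (of rank $0$) and the following rule for $t=\Lambda_{i-1,j-1}$, $p=\Lambda_{i-1,j}$, $q=\Lambda_{i,j-1}$, $z=\Lambda_{i,j}$: if $p=q=t$, then $z=t\cup\{\operatorname{rank}t+1\}$ (of rank $\operatorname{rank}t+1$)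 when $\sigma(i)=j$, and $z=t$ otherwise; if $p=t\ne q$, then $z=q$; if $q=t\neq p$, then $z=p$; if $p\ne t\ne q$, then $z$ is the set $t$ regarded with rank $\operatorname{rank}t+2$. Fomin's correspondence sends $\sigma$ to the pair of saturated chains $P_\sigma=(\Lambda_{N,j})_{0\le j\le N}$ and $Q_\sigma=(\Lambda_{i,N})_{0\le i\le N}$ of the Young–Fibonacci lattice. **Theorem.** There is a unique linear map $\Theta:O_N(X,Y)\to A_N(X,Y)$ that takes the unit to the identity diagram, is multiplicative and satisfies $\Theta(e_i)=G_i$ for $1\le i<N$. For every $\sigma\in S_N$ there are a unique half diagram $L_\sigma$ with chain $P_\sigma$ and a unique half diagram $R_\sigma$ with chain $Q_\sigma$; the gluings $L_\sigma\bowtie R_\sigma$ and $R_\sigma\bowtie L_\sigma$ exist and are unique; and $$\Theta(e_\sigma)=L_\sigma\bowtie R_\sigma,\qquad \Theta(e_\sigma)^\star=\Theta(e_{\sigma^{-1}})=R_\sigma\bowtie L_\sigma .$$ -/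

import Mathlib

/-! ### Okada arc-diagrams -/

/-- The `2N` boundary nodes of a rank `N` arc-diagram. The node `Sum.inl a` is the positive
(left) node `a + 1` and `Sum.inr a` is the overlined (right) node with number `a + 1`. -/
abbrev Node (N : ℕ) := Fin N ⊕ Fin N

/-- The absolute value `|a| ∈ {1, …, N}` of a node. -/
def Node.level {N : ℕ} : Node N → ℕ
  | Sum.inl a => a.val + 1
  | Sum.inr a => a.val + 1

/-- The position of a node in the total order `1 < 2 < ⋯ < N < N̄ < ⋯ < 2̄ < 1̄`. -/
def Node.pos {N : ℕ} : Node N → ℕ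
  | Sum.inl a => a.val
  | Sum.inr a => 2 * N - 1 - a.val

/-- A rank `N` Okada arc-diagram: a non-crossing perfect matching of the nodes (given by the
fixed-point free involution `partner`) with a height label on each arc (given as a function on
nodes which takes the same value on both ends of an arc). -/
@[ext]
structure OkadaDiagram (N : ℕ) where
  partner : Node N → Node N
  label : Node N → ℕ
  partner_ne : ∀ a, partner a ≠ a
  partner_partner : ∀ a, partner (partner a) = a
  noncrossing : ∀ a c, ¬ (Node.pos a < Node.pos c ∧ Node.pos c < Node.pos (partner a) ∧
    Node.pos (partner a) < Node.pos (partner c))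
  label_partner : ∀ a, label (partner a) = label a
  one_le_label : ∀ a, 1 ≤ label a
  label_le : ∀ a, label a ≤ min (Node.level a) (Node.level (partner a))
  label_parity : ∀ a, label a % 2 = min (Node.level a) (Node.level (partner a)) % 2
  label_nested : ∀ a c, Node.pos c < Node.pos a → Node.pos a < Node.pos (partner a) →
    Node.pos (partner a) < Node.pos (partner c) → label c < label a

/-- The reflection exchanging the left and the right boundary. -/
def Node.mirror {N : ℕ} : Node N → Node N
  | Sum.inl a => Sum.inr a
  | Sum.inr a => Sum.inl a

theorem Node.mirror_mirror {N : ℕ} (a : Node N) : a.mirror.mirror = a := by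
  cases a <;> rfl

theorem Node.level_mirror {N : ℕ} (a : Node N) : a.mirror.level = a.level := by
  cases a <;> rfl

theorem Node.pos_mirror {N : ℕ} (a : Node N) : a.mirror.pos + a.pos = 2 * N - 1 := by
  rcases a with a | a <;> have := a.isLt <;> simp only [Node.mirror, Node.pos] <;> omega

/-- The identity diagram, with the arcs `a — ā` labelled `a`. -/
def OkadaDiagram.id (N : ℕ) : OkadaDiagram N where
  partner := Node.mirror
  label := Node.level
  partner_ne a := by cases a <;> simp [Node.mirror]
  partner_partner := Node.mirror_mirror
  noncrossing a c := by
    have h1 := Node.pos_mirror a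
    have h2 := Node.pos_mirror c
    omega
  label_partner := Node.level_mirror
  one_le_label a := by cases a <;> simp [Node.level]
  label_le a := by simp [Node.level_mirror]
  label_parity a := by simp [Node.level_mirror]
  label_nested a c h1 h2 h3 := by
    rcases a with a | a <;> rcases c with c | c <;> have := a.isLt <;> have := c.isLt <;>
      simp only [Node.mirror, Node.pos, Node.level] at * <;> omega

/-- The mirror of an Okada arc-diagram. -/
def OkadaDiagram.mirror {N : ℕ} (D : OkadaDiagram N) : OkadaDiagram N where
  partner a := (D.partner a.mirror).mirror
  label a := D.label a.mirror
  partner_ne a h := D.partner_ne a.mirror (by rw [← Node.mirror_mirror (D.partner _), h])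
  partner_partner a := by simp [Node.mirror_mirror, D.partner_partner]
  noncrossing a c := by
    have h := D.noncrossing (D.partner c.mirror) (D.partner a.mirror)
    simp only [D.partner_partner] at h
    have h1 := Node.pos_mirror a
    have h2 := Node.pos_mirror c
    have h3 := Node.pos_mirror (D.partner a.mirror)
    have h4 := Node.pos_mirror (D.partner c.mirror)
    omega
  label_partner a := by simp [Node.mirror_mirror, D.label_partner]
  one_le_label a := D.one_le_label _
  label_le a := by simpa [Node.level_mirror] using D.label_le a.mirror
  label_parity a := by simpa [Node.level_mirror] using D.label_parity a.mirror
  label_nested a c g1 g2 g3 := by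
    have h := D.label_nested (D.partner a.mirror) (D.partner c.mirror)
    simp only [D.partner_partner, D.label_partner] at h
    have h1 := Node.pos_mirror a
    have h2 := Node.pos_mirror c
    have h3 := Node.pos_mirror (D.partner a.mirror)
    have h4 := Node.pos_mirror (D.partner c.mirror)
    apply h <;> omega

/-- The transposition of the levels `i` and `i + 1` of `{1, …, N}` (with `1 ≤ i < N`). -/
def elemSwap {N : ℕ} (i : ℕ) (hi : 1 ≤ i ∧ i < N) (a : Fin N) : Fin N :=
  if a.val + 1 = i then ⟨i, hi.2⟩ else if a.val = i then ⟨i - 1, by omega⟩ else a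

/-- The matching of the elementary diagram `G i`. -/
def elemPartner {N : ℕ} (i : ℕ) (hi : 1 ≤ i ∧ i < N) : Node N → Node N
  | Sum.inl a => if a.val + 1 = i ∨ a.val = i then Sum.inl (elemSwap i hi a) else Sum.inr a
  | Sum.inr a => if a.val + 1 = i ∨ a.val = i then Sum.inr (elemSwap i hi a) else Sum.inl a

/-- The height labels of the elementary diagram `G i`. -/
def elemLabel {N : ℕ} (i : ℕ) : Node N → ℕ
  | Sum.inl a => if a.val = i then i else a.val + 1
  | Sum.inr a => if a.val = i then i else a.val + 1

/-- The elementary Okada arc-diagram `G i`, `1 ≤ i < N`: it has the arcs `j — j̄` labelled `j` for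
`j ≠ i, i + 1`, and the two arcs `i — i+1` on the left and on the right, both labelled `i`. -/
def OkadaDiagram.elem {N : ℕ} (i : ℕ) (hi : 1 ≤ i ∧ i < N) : OkadaDiagram N where
  partner := elemPartner i hi
  label := elemLabel i
  partner_ne a h := by
    rcases a with a | a <;> simp only [elemPartner, elemSwap] at h <;> split_ifs at h <;>
      simp [Fin.ext_iff] at h <;> omega
  partner_partner a := by
    rcases a with a | a <;> simp only [elemPartner, elemSwap] <;> split_ifs <;>
      simp [elemPartner, elemSwap, Fin.ext_iff] <;> grind
  noncrossing a c := by
    rcases a with a | a <;> rcases c with c | c <;> have := a.isLt <;> have := c.isLt <;>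
      simp only [elemPartner, elemSwap] <;> split_ifs <;> simp only [Node.pos] <;> omega
  label_partner a := by
    rcases a with a | a <;> simp only [elemPartner, elemSwap, elemLabel] <;> split_ifs <;>
      simp only [Node.level, elemLabel] at * <;> (try split_ifs) <;> omega
  one_le_label a := by
    rcases a with a | a <;> simp only [elemLabel] <;> split_ifs <;> omega
  label_le a := by
    rcases a with a | a <;> simp only [elemPartner, elemSwap, elemLabel] <;> split_ifs <;>
      simp only [Node.level, elemLabel] at * <;> (try split_ifs) <;> omega
  label_parity a := by
    rcases a with a | a <;> simp only [elemPartner, elemSwap, elemLabel] <;> split_ifs <;>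
      simp only [Node.level, elemLabel] at * <;> (try split_ifs) <;> omega
  label_nested a c := by
    rcases a with a | a <;> rcases c with c | c <;> have := a.isLt <;> have := c.isLt <;>
      simp only [elemPartner, elemSwap, elemLabel] <;> split_ifs <;>
      simp only [Node.pos] at * <;> omega

/-! ### Composition of arc-diagrams -/

/-- The nodes of the concatenation of two diagrams: left, merged (middle) and right nodes. -/
abbrev Node3 (N : ℕ) := Fin N ⊕ Fin N ⊕ Fin N

/-- The nodes of the first (left) diagram inside the concatenation. -/
def inFst {N : ℕ} : Node N → Node3 N
  | Sum.inl a => Sum.inl a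
  | Sum.inr a => Sum.inr (Sum.inl a)

/-- The nodes of the second (right) diagram inside the concatenation. -/
def inSnd {N : ℕ} : Node N → Node3 N
  | Sum.inl a => Sum.inr (Sum.inl a)
  | Sum.inr a => Sum.inr (Sum.inr a)

/-- The outer boundary nodes of the concatenation. -/
def inOuter {N : ℕ} : Node N → Node3 N
  | Sum.inl a => Sum.inl a
  | Sum.inr a => Sum.inr (Sum.inr a)

/-- The graph obtained by merging the right nodes of `C` with the left nodes of `D`; its edges are
the arcs of `C` and of `D`, and its connected components are the arcs and loops of `C ∘ D`. -/
def concatGraph {N : ℕ} (C D : OkadaDiagram N) : SimpleGraph (Node3 N) :=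
  SimpleGraph.fromRel fun p q =>
    (∃ u, p = inFst u ∧ q = inFst (C.partner u)) ∨ (∃ u, p = inSnd u ∧ q = inSnd (D.partner u))

/-- The height label of an arc or loop of `C ∘ D`: the minimum of the labels of the arcs of `C`
and of `D` which comprise it. -/
noncomputable def concatHeight {N : ℕ} (C D : OkadaDiagram N)
    (γ : (concatGraph C D).ConnectedComponent) : ℕ :=
  sInf ({h | ∃ u, (concatGraph C D).connectedComponentMk (inFst u) = γ ∧ h = C.label u} ∪
    {h | ∃ u, (concatGraph C D).connectedComponentMk (inSnd u) = γ ∧ h = D.label u})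

/-- `E` is the diagram `[C ∘ D]` obtained from the concatenation by removing all loops. -/
def IsComposition {N : ℕ} (C D E : OkadaDiagram N) : Prop :=
  (∀ u v : Node N, u ≠ v →
    (E.partner u = v ↔ (concatGraph C D).Reachable (inOuter u) (inOuter v))) ∧
  ∀ u : Node N,
    E.label u = concatHeight C D ((concatGraph C D).connectedComponentMk (inOuter u))

theorem IsComposition.unique {N : ℕ} {C D E E' : OkadaDiagram N} (h : IsComposition C D E)
    (h' : IsComposition C D E') : E = E' := by
  refine OkadaDiagram.ext (funext fun u => ?_) (funext fun u => by rw [h.2, h'.2])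
  have := (h'.1 u (E'.partner u) (E'.partner_ne u).symm).1 rfl
  exact (h.1 u (E'.partner u) (E'.partner_ne u).symm).2 this

/-- The number of loops of height `k` in `C ∘ D`. -/
noncomputable def loopCount {N : ℕ} (C D : OkadaDiagram N) (k : ℕ) : ℕ :=
  {γ : (concatGraph C D).ConnectedComponent |
    (∀ u : Node N, (concatGraph C D).connectedComponentMk (inOuter u) ≠ γ) ∧
      concatHeight C D γ = k}.ncard

/-- The number of U-turn boxes in row `i` of the normal form of the fully packed loop configuration
of `D`. In this normal form an arc `a — b` of height `h` goes monotonically from level `|a|` to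
level `h` and from there to level `|b|`; a U-turn box in row `i` consists of two passages between
the levels `i` and `i + 1`. -/
def boxCount {N : ℕ} (D : OkadaDiagram N) (i : ℕ) : ℕ :=
  (Finset.univ.filter fun u : Node N => D.label u ≤ i ∧ i < u.level).card / 2

/-- The number of factors `y i` produced when the concatenation of the normal forms of `C` and `D`
is rewritten to the normal form of `E = [C ∘ D]`. A factor `y i` is produced by each removal of two
U-turn boxes, one in row `i + 1` and one in row `i` (the relation `e_{i+1} e_i e_{i+1} = y_i e_{i+1}`),
and a factor `x i` by each removal of a loop of height `i` and one U-turn box in row `i`. Hence the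
number of boxes lost in row `i` is `loopCount C D i + yCount i + yCount (i - 1)`. -/
noncomputable def yCount {N : ℕ} (C D E : OkadaDiagram N) : ℕ → ℕ
  | 0 => 0
  | i + 1 => boxCount C (i + 1) + boxCount D (i + 1) -
      (boxCount E (i + 1) + loopCount C D (i + 1) + yCount C D E i)

/-- The underlying vector space of the diagram algebra, with basis the Okada arc-diagrams. -/
abbrev OkArc (K : Type*) [Field K] (N : ℕ) := OkadaDiagram N →₀ K

open Classical in
/-- The product `C · D = X^ℓ Y^m [C ∘ D]` of two basis diagrams. (The concatenation of two Okada
arc-diagrams always determines an Okada arc-diagram, so the second branch is never used.) -/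
noncomputable def diagramMul {K : Type*} [Field K] {N : ℕ} (x y : ℕ → K) (C D : OkadaDiagram N) :
    OkArc K N :=
  if h : ∃ E, IsComposition C D E then
    Finsupp.single h.choose
      ((∏ k ∈ Finset.Icc 1 (N - 1), x k ^ loopCount C D k) *
        ∏ k ∈ Finset.Icc 1 (N - 2), y k ^ yCount C D h.choose k)
  else 0

/-- The product of the diagram algebra with parameters `x`, `y`, extended bilinearly. -/
noncomputable def OkArc.mul {K : Type*} [Field K] {N : ℕ} (x y : ℕ → K) (f g : OkArc K N) :
    OkArc K N :=
  f.sum fun C a => g.sum fun D b => (a * b) • diagramMul x y C D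

/-- The linear extension of the mirror map. -/
noncomputable def OkArc.mirror {K : Type*} [Field K] {N : ℕ} : OkArc K N →ₗ[K] OkArc K N :=
  Finsupp.lmapDomain K K OkadaDiagram.mirror

/-! ### The Okada algebra -/

/-- The indices `1 ≤ i ≤ N - 1` of the generators. -/
abbrev GenIdx (N : ℕ) := {i : ℕ // 1 ≤ i ∧ i < N}

/-- The defining relations of the Okada algebra. -/
inductive OkadaRel {K : Type*} [Field K] (N : ℕ) (x y : ℕ → K) :
    FreeAlgebra K (GenIdx N) → FreeAlgebra K (GenIdx N) → Prop
  | sq (i : GenIdx N) : OkadaRel N x y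
      (FreeAlgebra.ι K i * FreeAlgebra.ι K i) (x i.val • FreeAlgebra.ι K i)
  | comm (i j : GenIdx N) (h : i.val + 2 ≤ j.val ∨ j.val + 2 ≤ i.val) : OkadaRel N x y
      (FreeAlgebra.ι K i * FreeAlgebra.ι K j) (FreeAlgebra.ι K j * FreeAlgebra.ι K i)
  | contract (i j : GenIdx N) (h : j.val = i.val + 1) : OkadaRel N x y
      (FreeAlgebra.ι K j * FreeAlgebra.ι K i * FreeAlgebra.ι K j) (y i.val • FreeAlgebra.ι K j)

/-- The Okada algebra of rank `N` with parameters `x 1, …, x (N-1)` and `y 1, …, y (N-2)`. -/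
abbrev OkadaAlgebra {K : Type*} [Field K] (N : ℕ) (x y : ℕ → K) := RingQuot (OkadaRel N x y)

/-- The generator `e_i` (only used for `1 ≤ i < N`). -/
noncomputable def OkadaAlgebra.gen {K : Type*} [Field K] (N : ℕ) (x y : ℕ → K) (i : ℕ) :
    OkadaAlgebra N x y :=
  if h : 1 ≤ i ∧ i < N then RingQuot.mkAlgHom K (OkadaRel N x y) (FreeAlgebra.ι K ⟨i, h⟩) else 1

/-- The entry of index `i + 1` of the code of `σ`: the number of `j < i` such that
`σ⁻¹ j > σ⁻¹ i`. -/
def permCode {N : ℕ} (σ : Equiv.Perm (Fin N)) (i : Fin N) : ℕ :=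
  (Finset.univ.filter fun j : Fin N => j < i ∧ σ⁻¹ i < σ⁻¹ j).card

/-- The element `e_σ`, the product over `i = 1, …, N` (increasing from left to right) of
`e_{i-1} e_{i-2} ⋯ e_{i-c_i}`, where `(c_1, …, c_N)` is the code of `σ`. Below, `i : Fin N` stands
for the index `i + 1`. -/
noncomputable def OkadaAlgebra.permElem {K : Type*} [Field K] {N : ℕ} (x y : ℕ → K)
    (σ : Equiv.Perm (Fin N)) : OkadaAlgebra N x y :=
  ((List.finRange N).map fun i =>
    ((List.range (permCode σ i)).map fun k => OkadaAlgebra.gen N x y (i.val - k)).prod).prod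

/-- The map `Θ` from the Okada algebra to the diagram algebra: the extension of `e_i ↦ G_i` to a
linear map compatible with the units and the products. -/
def IsTheta {K : Type*} [Field K] {N : ℕ} (x y : ℕ → K)
    (Θ : OkadaAlgebra N x y →ₗ[K] OkArc K N) : Prop :=
  Θ 1 = Finsupp.single (OkadaDiagram.id N) 1 ∧
  (∀ a b, Θ (a * b) = OkArc.mul x y (Θ a) (Θ b)) ∧
  ∀ (i : ℕ) (hi : 1 ≤ i ∧ i < N),
    Θ (OkadaAlgebra.gen N x y i) = Finsupp.single (OkadaDiagram.elem i hi) 1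

/-! ### Half arc-diagrams -/

/-- A rank `N` Okada half arc-diagram on the nodes `1, …, N` (the node `a + 1` is `a : Fin N`).
A fixed point of the involution `partner` carries a half arc (a propagating arc with a free end),
the other nodes are joined by full arcs. -/
@[ext]
structure HalfDiagram (N : ℕ) where
  partner : Fin N → Fin N
  label : Fin N → ℕ
  partner_partner : ∀ a, partner (partner a) = a
  noncrossing : ∀ a c, ¬ (a < c ∧ c < partner a ∧ partner a < partner c)
  /-- A half arc does not cross a full arc. -/
  half_noncrossing : ∀ a c, partner c = c → ¬ (a < c ∧ c < partner a)
  label_partner : ∀ a, label (partner a) = label a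
  one_le_label : ∀ a, 1 ≤ label a
  label_le : ∀ a, label a ≤ min (a.val + 1) ((partner a).val + 1)
  label_parity : ∀ a, label a % 2 = min (a.val + 1) ((partner a).val + 1) % 2
  label_nested : ∀ a c, c < a → a < partner a → partner a < partner c → label c < label a
  /-- Every (full or half) arc above a half arc is nested in it. -/
  label_half : ∀ a c, partner c = c → c < a → label c < label a

theorem Node.pos_lt {N : ℕ} (a : Node N) : a.pos < 2 * N := by
  rcases a with a | a <;> have := a.isLt <;> simp only [Node.pos] <;> omega

theorem Node.pos_injective {N : ℕ} : Function.Injective (Node.pos (N := N)) := by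
  intro a b h
  rcases a with a | a <;> rcases b with b | b <;> have := a.isLt <;> have := b.isLt <;>
    simp only [Node.pos] at h <;> simp [Fin.ext_iff] <;> omega

theorem Node.exists_pos {N : ℕ} (k : ℕ) (hk : k < 2 * N) : ∃ a : Node N, a.pos = k := by
  by_cases h : k < N
  · exact ⟨Sum.inl ⟨k, h⟩, rfl⟩
  · exact ⟨Sum.inr ⟨2 * N - 1 - k, by omega⟩, by simp only [Node.pos]; omega⟩

/-- The two ends of an arc have positions of different parity. -/
theorem OkadaDiagram.pos_partner {N : ℕ} (D : OkadaDiagram N) (a : Node N)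
    (ha : a.pos < (D.partner a).pos) : (D.partner a).pos % 2 ≠ a.pos % 2 := by
  classical
  let s : Finset (Node N) := Finset.univ.filter fun u => a.pos < u.pos ∧ u.pos < (D.partner a).pos
  have hs : s.card = (Finset.Ioo a.pos (D.partner a).pos).card := by
    refine Finset.card_bij (fun u _ => u.pos) ?_ ?_ ?_
    · intro u hu
      simpa [s] using hu
    · intro u _ v _ h
      exact Node.pos_injective h
    · intro k hk
      have hk' := Finset.mem_Ioo.1 hk
      obtain ⟨u, rfl⟩ := Node.exists_pos (N := N) k (hk'.2.trans (Node.pos_lt _))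
      exact ⟨u, by simpa [s] using hk, rfl⟩
  have hz : ∑ _u ∈ s, (1 : ZMod 2) = 0 := by
    refine Finset.sum_involution (fun u _ => D.partner u) ?_ ?_ ?_ ?_
    · intro u _; decide
    · intro u _ _; exact D.partner_ne u
    · intro u hu
      have hu' : a.pos < u.pos ∧ u.pos < (D.partner a).pos := by simpa [s] using hu
      have h1 := D.noncrossing a u
      have h2 := D.noncrossing (D.partner u) a
      rw [D.partner_partner] at h2
      have n1 : (D.partner u).pos ≠ a.pos := fun h => by
        have h3 := Node.pos_injective h
        have h4 : u = D.partner a := by rw [← h3, D.partner_partner]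
        rw [h4] at hu'; omega
      have n2 : (D.partner u).pos ≠ (D.partner a).pos := fun h => by
        have h3 := Node.pos_injective h
        have h4 : u = a := by rw [← D.partner_partner u, h3, D.partner_partner]
        rw [h4] at hu'; omega
      simp only [s, Finset.mem_filter, Finset.mem_univ, true_and]
      omega
    · intro u _; exact D.partner_partner u
  rw [Finset.sum_const, nsmul_one, ZMod.natCast_eq_zero_iff, hs, Nat.card_Ioo] at hz
  omega

/-- The partner map of the left half of a diagram: the node itself if its arc is propagating. -/
def leftPartner {N : ℕ} (D : OkadaDiagram N) (a : Fin N) : Fin N :=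
  match D.partner (Sum.inl a) with
  | Sum.inl b => b
  | Sum.inr _ => a

theorem leftPartner_cases {N : ℕ} (D : OkadaDiagram N) (a : Fin N) :
    (D.partner (Sum.inl a) = Sum.inl (leftPartner D a) ∧ leftPartner D a ≠ a) ∨
    (∃ b, D.partner (Sum.inl a) = Sum.inr b ∧ leftPartner D a = a ∧
      (a.val + 1) % 2 = (b.val + 1) % 2) := by
  rcases h : D.partner (Sum.inl a) with b | b
  · left
    have : leftPartner D a = b := by simp [leftPartner, h]
    refine ⟨by rw [this], ?_⟩
    rw [this]
    rintro rfl
    exact D.partner_ne _ h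
  · right
    refine ⟨b, rfl, by simp [leftPartner, h], ?_⟩
    have := D.pos_partner (Sum.inl a)
    rw [h] at this
    have h1 := a.isLt
    have h2 := b.isLt
    simp only [Node.pos] at this
    omega

/-- The left half (bra) of an Okada arc-diagram, obtained by cutting it in the middle. -/
def OkadaDiagram.bra {N : ℕ} (D : OkadaDiagram N) : HalfDiagram N where
  partner := leftPartner D
  label a := D.label (Sum.inl a)
  partner_partner a := by
    rcases leftPartner_cases D a with ⟨h, -⟩ | ⟨b, -, h, -⟩
    · have := D.partner_partner (Sum.inl a)
      rw [h] at this
      have hb : ∀ b, D.partner (Sum.inl b) = Sum.inl a → leftPartner D b = a := fun b hb => by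
        simp [leftPartner, hb]
      exact hb _ this
    · rw [h, h]
  noncrossing a c := by
    have hx := D.noncrossing (Sum.inl a) (Sum.inl c)
    rcases leftPartner_cases D a with ⟨h, -⟩ | ⟨b, h0, h, -⟩ <;>
      rcases leftPartner_cases D c with ⟨h', -⟩ | ⟨b', h0', h', -⟩
    · rw [h, h'] at hx
      exact hx
    all_goals rintro ⟨h1, h2, h3⟩; simp only [h, h', Fin.lt_def] at *; omega
  half_noncrossing a c hc := by
    have hx := D.noncrossing (Sum.inl a) (Sum.inl c)
    rintro ⟨h1, h2⟩
    rcases leftPartner_cases D a with ⟨h, -⟩ | ⟨b, h0, h, -⟩ <;>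
      rcases leftPartner_cases D c with ⟨h', hne⟩ | ⟨b', h0', h', -⟩
    · exact hne hc
    · apply hx
      rw [h, h0']
      have := (leftPartner D a).isLt
      have := b'.isLt
      simp only [Node.pos, Fin.lt_def] at *
      omega
    all_goals rw [h] at h2; exact absurd h1 (not_lt.2 h2.le)
  label_partner a := by
    have hl := D.label_partner (Sum.inl a)
    rcases leftPartner_cases D a with ⟨h, -⟩ | ⟨b, h0, h, -⟩
    · rwa [h] at hl
    · rw [h]
  one_le_label a := D.one_le_label _
  label_le a := by
    have hl := D.label_le (Sum.inl a)
    rcases leftPartner_cases D a with ⟨h, -⟩ | ⟨b, h0, h, -⟩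
    · rw [h] at hl
      exact hl
    · rw [h0] at hl
      rw [h]
      simp only [Node.level] at hl
      omega
  label_parity a := by
    have hl := D.label_parity (Sum.inl a)
    rcases leftPartner_cases D a with ⟨h, -⟩ | ⟨b, h0, h, hp⟩
    · rw [h] at hl
      exact hl
    · rw [h0] at hl
      rw [h]
      simp only [Node.level] at hl
      omega
  label_nested a c h1 h2 h3 := by
    have hx := D.label_nested (Sum.inl a) (Sum.inl c)
    rcases leftPartner_cases D a with ⟨h, -⟩ | ⟨b, h0, h, -⟩ <;>
      rcases leftPartner_cases D c with ⟨h', -⟩ | ⟨b', h0', h', -⟩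
    · rw [h, h'] at hx
      exact hx h1 h2 h3
    all_goals simp only [h, h', Fin.lt_def] at *; omega
  label_half a c hc hca := by
    rcases leftPartner_cases D c with ⟨-, hne⟩ | ⟨d, hd, -, -⟩
    · exact absurd hc hne
    have key : ∀ a : Fin N, c < a → Node.pos (Sum.inl a) < (D.partner (Sum.inl a)).pos →
        D.label (Sum.inl c) < D.label (Sum.inl a) := by
      intro a hca ha
      have hx := D.label_nested (Sum.inl a) (Sum.inl c)
      have hy := D.noncrossing (Sum.inl c) (Sum.inl a)
      have hne : (D.partner (Sum.inl a)).pos ≠ (D.partner (Sum.inl c)).pos := fun h => by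
        have h1 := congrArg D.partner (Node.pos_injective h)
        rw [D.partner_partner, D.partner_partner] at h1
        exact hca.ne' (Sum.inl.inj h1)
      have h1 := a.isLt
      have h2 := d.isLt
      rw [hd] at hx hy hne
      have hca' : Node.pos (Sum.inl c) < Node.pos (Sum.inl a) := hca
      have : Node.pos (Sum.inl a) < Node.pos (Sum.inr d) := by
        simp only [Node.pos]; omega
      apply hx hca' ha
      omega
    rcases leftPartner_cases D a with ⟨h, hne⟩ | ⟨b, h0, h, -⟩
    · rcases lt_or_gt_of_ne hne with hlt | hlt
      · have hl := D.label_partner (Sum.inl a)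
        rw [← hl, h]
        have hpp := D.partner_partner (Sum.inl a)
        rw [h] at hpp
        apply key
        · by_contra hcon
          have hne2 : c ≠ leftPartner D a := by
            rintro rfl
            rw [hpp] at hd
            cases hd
          have hx := D.noncrossing (Sum.inl (leftPartner D a)) (Sum.inl c)
          have h1 := a.isLt
          have h2 := d.isLt
          rw [hpp, hd] at hx
          simp only [Node.pos, Fin.lt_def, Fin.ext_iff, ne_eq] at *
          omega
        · rw [hpp]
          exact hlt
      · apply key a hca
        rw [h]
        exact hlt
    · apply key a hca
      rw [h0]
      have h1 := a.isLt
      have h2 := b.isLt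
      simp only [Node.pos]
      omega

/-- The ket of `D`: the bra of its mirror. -/
def OkadaDiagram.ket {N : ℕ} (D : OkadaDiagram N) : HalfDiagram N := D.mirror.bra

/-- `D` is the gluing of the half diagrams `L` and `R`. -/
def IsGluing {N : ℕ} (L R : HalfDiagram N) (D : OkadaDiagram N) : Prop :=
  D.bra = L ∧ D.ket = R

/-- The set of the height labels of the propagating (half) arcs. -/
def HalfDiagram.propLabels {N : ℕ} (H : HalfDiagram N) : Finset ℕ :=
  (Finset.univ.filter fun a => H.partner a = a).image H.label

/-- The `r`-restriction: full arcs inside `{1, …, r}` are kept, and a half arc at `a ≤ r` or a full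
arc `a — b` with `a ≤ r < b` gives a half arc at `a` with the same label. -/
def HalfDiagram.restrict {N : ℕ} (H : HalfDiagram N) (r : ℕ) (hr : r ≤ N) : HalfDiagram r where
  partner a := if h : (H.partner (a.castLE hr)).val < r then ⟨_, h⟩ else a
  label a := H.label (a.castLE hr)
  partner_partner a := by
    have := H.partner_partner (a.castLE hr)
    by_cases h : (H.partner (a.castLE hr)).val < r
    · simp [h, this]
    · simp [h]
  noncrossing a c := by
    have := H.noncrossing (a.castLE hr) (c.castLE hr)
    split_ifs <;> simp only [Fin.lt_def, Fin.val_castLE] at * <;> omega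
  half_noncrossing a c hc := by
    have h1 := H.noncrossing (a.castLE hr) (c.castLE hr)
    have h2 := H.half_noncrossing (a.castLE hr) (c.castLE hr)
    split_ifs at * <;> simp only [Fin.lt_def, Fin.ext_iff, Fin.val_castLE] at * <;> omega
  label_partner a := by
    have h1 := H.label_partner (a.castLE hr)
    split_ifs
    · exact h1
    · rfl
  one_le_label a := H.one_le_label _
  label_le a := by
    have h1 := H.label_le (a.castLE hr)
    split_ifs <;> simp only [Fin.val_castLE] at * <;> omega
  label_parity a := by
    have h1 := H.label_parity (a.castLE hr)
    split_ifs <;> simp only [Fin.val_castLE] at * <;> omega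
  label_nested a c := by
    have h1 := H.label_nested (a.castLE hr) (c.castLE hr)
    split_ifs <;> simp only [Fin.lt_def, Fin.val_castLE] at * <;> omega
  label_half a c hc hca := by
    by_cases hcc : H.partner (c.castLE hr) = c.castLE hr
    · exact H.label_half _ _ hcc hca
    have hd : r ≤ (H.partner (c.castLE hr)).val := by
      by_contra hlt
      rw [dif_pos (not_le.1 hlt)] at hc
      exact hcc (by ext; simpa [Fin.ext_iff] using hc)
    have ha := a.isLt
    have e1 := H.partner_partner (a.castLE hr)
    have e2 := H.partner_partner (c.castLE hr)
    have e3 := H.label_partner (a.castLE hr)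
    have h1 := H.half_noncrossing (c.castLE hr) (a.castLE hr)
    have h2 := H.noncrossing (c.castLE hr) (a.castLE hr)
    have h3 := H.noncrossing (H.partner (a.castLE hr)) (c.castLE hr)
    have h4 := H.label_nested (a.castLE hr) (c.castLE hr)
    have h5 := H.label_nested (H.partner (a.castLE hr)) (c.castLE hr)
    have n1 : (H.partner (a.castLE hr)).val ≠ (H.partner (c.castLE hr)).val := fun h => by
      rw [Fin.ext h, e2] at e1
      exact hca.ne (Fin.castLE_injective hr e1)
    have n2 : (H.partner (a.castLE hr)).val ≠ c.val := fun h => by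
      have h6 : H.partner (a.castLE hr) = c.castLE hr := Fin.ext h
      have h7 : (H.partner (c.castLE hr)).val = a.val := by rw [← h6, e1]; rfl
      omega
    rw [e1] at h3 h5
    rw [e3] at h5
    simp only [Fin.lt_def, Fin.ext_iff, Fin.val_castLE] at *
    omega

/-! ### Fibonacci sets and Fomin's correspondence -/

/-- A Fibonacci set of rank `N`: a subset `{s_1 < ⋯ < s_k}` of `{1, …, N}` such that `k ≡ N` and
`s_ℓ ≡ ℓ` modulo `2`. The rank is part of the data. -/
@[ext]
structure FibSet where
  rank : ℕ
  carrier : Finset ℕ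
  subset : carrier ⊆ Finset.Icc 1 rank
  card_parity : carrier.card % 2 = rank % 2
  parity : ∀ s ∈ carrier, s % 2 = (carrier.filter (· ≤ s)).card % 2

/-- The empty Fibonacci set of rank `0`. -/
def FibSet.empty : FibSet := ⟨0, ∅, by simp, by simp, by simp⟩

/-- The Fibonacci set with Fibonacci word `1w`, where `w` is the word of `S`. -/
def FibSet.addOne (S : FibSet) : FibSet where
  rank := S.rank + 1
  carrier := insert (S.rank + 1) S.carrier
  subset := by
    have := S.subset
    intro s hs
    rcases Finset.mem_insert.1 hs with rfl | hs
    · simp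
    · have := Finset.mem_Icc.1 (this hs)
      simp; omega
  card_parity := by
    have h : S.rank + 1 ∉ S.carrier := fun h => by
      have := Finset.mem_Icc.1 (S.subset h); omega
    have := S.card_parity
    rw [Finset.card_insert_of_notMem h]; omega
  parity := by
    have h : S.rank + 1 ∉ S.carrier := fun h => by
      have := Finset.mem_Icc.1 (S.subset h); omega
    intro s hs
    rcases Finset.mem_insert.1 hs with rfl | hs
    · rw [Finset.filter_true_of_mem, Finset.card_insert_of_notMem h]
      · have := S.card_parity; omega
      · intro t ht
        rcases Finset.mem_insert.1 ht with rfl | ht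
        · exact le_rfl
        · have := Finset.mem_Icc.1 (S.subset ht); omega
    · have h2 := Finset.mem_Icc.1 (S.subset hs)
      rw [Finset.filter_insert, if_neg (by omega)]
      exact S.parity s hs

/-- The Fibonacci set with Fibonacci word `2w`, where `w` is the word of `S`. -/
def FibSet.addTwo (S : FibSet) : FibSet where
  rank := S.rank + 2
  carrier := S.carrier
  subset := S.subset.trans (Finset.Icc_subset_Icc le_rfl (by omega))
  card_parity := by have := S.card_parity; omega
  parity := S.parity

open Classical in
/-- Fomin's local rule for the Young–Fibonacci lattice: the fourth corner of a cell with lower left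
corner `t` and neighbouring corners `p`, `q`, where `mark` says that the
cell is marked. -/
noncomputable def fominRule (mark : Prop) (t p q : FibSet) : FibSet :=
  if p = t ∧ q = t then (if mark then t.addOne else t)
  else if p = t then q
  else if q = t then p
  else t.addTwo

/-- The growth diagram of `σ`: the cell in column `i` and row `j` is marked if `σ i = j`. -/
noncomputable def fominGrowth {N : ℕ} (σ : Equiv.Perm (Fin N)) : ℕ → ℕ → FibSet
  | 0, _ => FibSet.empty
  | _ + 1, 0 => FibSet.empty
  | i + 1, j + 1 => fominRule (∃ h : i < N, (σ ⟨i, h⟩).val = j)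
      (fominGrowth σ i j) (fominGrowth σ i (j + 1)) (fominGrowth σ (i + 1) j)
termination_by i j => (i, j)

/-- The first chain of the pair assigned to `σ` (the analogue of the insertion tableau): the right
boundary of the growth diagram, indexed by the values of `σ`. -/
noncomputable def fominP {N : ℕ} (σ : Equiv.Perm (Fin N)) (j : ℕ) : FibSet := fominGrowth σ N j

/-- The second chain of the pair assigned to `σ` (the analogue of the recording tableau): the upper
boundary of the growth diagram, indexed by the positions of `σ`. -/
noncomputable def fominQ {N : ℕ} (σ : Equiv.Perm (Fin N)) (i : ℕ) : FibSet := fominGrowth σ i N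

/-- The chain of the half diagram `H`, the sequence of the Fibonacci sets of rank `r` formed by the
propagating labels of the `r`-restrictions of `H` for `0 ≤ r ≤ N`, is `C`. -/
def HalfDiagram.HasChain {N : ℕ} (H : HalfDiagram N) (C : ℕ → FibSet) : Prop :=
  ∀ (r : ℕ) (hr : r ≤ N), (C r).rank = r ∧ (C r).carrier = (H.restrict r hr).propLabels

/-! ### Diagrams in terms of positions -/

/-! Number the nodes by their positions 0, …, 2N−1. A diagram becomes a pair of functions on
integers, and right multiplication by `G i` becomes local: two neighbouring right nodes are joined
by an arc of label `i`, and their former partners are joined to each other by an arc with the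
smaller of the two old labels (`IsPosData.join`, `mulElem`).

The only form of associativity needed is (C·D)·G_i = C·(D·G_i), `OkArc.mulElem_mulHom`. Its
diagrammatic part is `IsComposition.mulElem`. Its coefficient part says that loops and exponents of
y add up in the same way for both bracketings (`loopCount_mulElem`, `elemExp_add`). The exponents of
y are controlled by an exact box count: multiplying by `G i` loses one box in every row of an
interval of even length ending at row `i` (`passages_mulElem`), and neighbouring rows of it pair up
to factors of y. Granted this associativity, the relations of the Okada algebra need only be checked
on the diagrams `G i` themselves. They give a right action on the diagram algebra, and Θ(a) is the
result of letting a act on the identity diagram.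

The link with permutations is the insertion of an arc on the right side. Adding a propagating arc of
top label to a diagram of rank M and multiplying by G_M, G_{M−1}, … moves this arc outwards one step
at a time, without loops or factors of y (`mulElem_insert`, `Reduced.insert`). Deleting the largest
value of σ removes exactly such a descending run from the word of e_σ, so Θ(e_σ) is a single diagram
with coefficient 1, built by insertions. Every diagram arises by insertions (`exists_eq_insert`);
this also yields the existence of all compositions (`exists_isComposition`).

The label sets in the chains of the two halves are the sets of labels of arcs crossing a cut between
two positions. An insertion leaves the left chain unchanged up to rank M. On the right it adds one
label at the cut through the new arc, and beyond it reproduces earlier sets with rank raised by two.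
The new top row of Fomin's growth diagram behaves in the same way (`fominQ_of_lt`, `fominQ_self`,
`fominQ_of_gt`), so the two constructions agree by induction (`exists_reduced_permWord`).

Uniqueness holds because the labels of open arcs increase from left to right: a chain then
determines its half diagram (`HasChain.unique`), and two halves determine the gluing
(`IsGluing.unique`). The statement on σ⁻¹ follows from the symmetry of the growth diagram under
transposition. -/

theorem Node.level_eq {N : ℕ} (a : Node N) : a.level = min (a.pos + 1) (2 * N - a.pos) := by
  rcases a with a | a <;> have := a.isLt <;> simp only [Node.level, Node.pos] <;> omega

/-- The node with position `k`. -/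
def posNode {N : ℕ} (k : ℕ) (hk : k < 2 * N) : Node N :=
  if h : k < N then Sum.inl ⟨k, h⟩ else Sum.inr ⟨2 * N - 1 - k, by omega⟩

theorem pos_posNode {N : ℕ} (k : ℕ) (hk : k < 2 * N) : (posNode k hk).pos = k := by
  unfold posNode
  split_ifs <;> simp only [Node.pos]
  omega

theorem posNode_pos {N : ℕ} (a : Node N) : posNode a.pos a.pos_lt = a :=
  Node.pos_injective (pos_posNode _ _)

namespace OkadaDiagram

variable {N : ℕ}

/-- The partner map in terms of positions. -/
def p (D : OkadaDiagram N) (k : ℕ) : ℕ :=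
  if h : k < 2 * N then (D.partner (posNode k h)).pos else k

/-- The label map in terms of positions. -/
def l (D : OkadaDiagram N) (k : ℕ) : ℕ :=
  if h : k < 2 * N then D.label (posNode k h) else 0

theorem p_pos (D : OkadaDiagram N) (u : Node N) : D.p u.pos = (D.partner u).pos := by
  rw [p, dif_pos u.pos_lt, posNode_pos]

theorem l_pos (D : OkadaDiagram N) (u : Node N) : D.l u.pos = D.label u := by
  rw [l, dif_pos u.pos_lt, posNode_pos]

/-- The axioms of an Okada arc-diagram in terms of positions. -/
structure IsPosData (N : ℕ) (P L : ℕ → ℕ) : Prop where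
  lt : ∀ k < 2 * N, P k < 2 * N
  ne : ∀ k < 2 * N, P k ≠ k
  invol : ∀ k < 2 * N, P (P k) = k
  noncrossing : ∀ a < 2 * N, ∀ c < 2 * N, ¬ (a < c ∧ c < P a ∧ P a < P c)
  label_partner : ∀ k < 2 * N, L (P k) = L k
  one_le : ∀ k < 2 * N, 1 ≤ L k
  le : ∀ k < 2 * N, L k ≤ k + 1 ∧ L k ≤ 2 * N - k
  parity : ∀ k < 2 * N, L k % 2 = min (min (k + 1) (2 * N - k)) (min (P k + 1) (2 * N - P k)) % 2
  nested : ∀ a < 2 * N, ∀ c < 2 * N, c < a → a < P a → P a < P c → L c < L a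

theorem isPosData (D : OkadaDiagram N) : IsPosData N D.p D.l := by
  have key : ∀ {Q : ℕ → Prop}, (∀ u : Node N, Q u.pos) → ∀ k < 2 * N, Q k := by
    intro Q h k hk
    have := h (posNode k hk)
    rwa [pos_posNode] at this
  constructor
  · exact key fun u => by rw [p_pos]; exact Node.pos_lt _
  · exact key fun u h => D.partner_ne u (Node.pos_injective (by rwa [p_pos] at h))
  · exact key fun u => by rw [p_pos, p_pos, D.partner_partner]
  · exact key fun u => key fun v => by rw [p_pos, p_pos]; exact D.noncrossing u v
  · exact key fun u => by rw [p_pos, l_pos, l_pos, D.label_partner]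
  · exact key fun u => by rw [l_pos]; exact D.one_le_label u
  · refine key fun u => ?_
    have := D.label_le u
    rw [Node.level_eq] at this
    rw [l_pos]; omega
  · refine key fun u => ?_
    have := D.label_parity u
    rw [Node.level_eq, Node.level_eq] at this
    rw [l_pos, p_pos, this]
  · exact key fun u => key fun v => by
      rw [p_pos, p_pos, l_pos, l_pos]; exact D.label_nested u v

/-- The diagram with prescribed partner and label maps in terms of positions. -/
def ofPos {P L : ℕ → ℕ} (h : IsPosData N P L) : OkadaDiagram N where
  partner u := posNode (P u.pos) (h.lt _ u.pos_lt)
  label u := L u.pos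
  partner_ne u e := h.ne _ u.pos_lt (by rw [← pos_posNode (P u.pos) (h.lt _ u.pos_lt), e])
  partner_partner u := Node.pos_injective (by rw [pos_posNode, pos_posNode, h.invol _ u.pos_lt])
  noncrossing a c := by
    simpa only [pos_posNode] using h.noncrossing _ a.pos_lt _ c.pos_lt
  label_partner u := by rw [pos_posNode, h.label_partner _ u.pos_lt]
  one_le_label u := h.one_le _ u.pos_lt
  label_le u := by
    have h1 := h.le _ u.pos_lt
    have h2 := h.le _ (h.lt _ u.pos_lt)
    rw [h.label_partner _ u.pos_lt] at h2
    rw [Node.level_eq, Node.level_eq, pos_posNode]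
    omega
  label_parity u := by
    rw [Node.level_eq, Node.level_eq, pos_posNode, h.parity _ u.pos_lt]
  label_nested a c := by
    simpa only [pos_posNode] using h.nested _ a.pos_lt _ c.pos_lt

theorem p_ofPos {P L : ℕ → ℕ} (h : IsPosData N P L) {k : ℕ} (hk : k < 2 * N) :
    (ofPos h).p k = P k := by
  rw [p, dif_pos hk]
  simp only [ofPos, pos_posNode]

theorem l_ofPos {P L : ℕ → ℕ} (h : IsPosData N P L) {k : ℕ} (hk : k < 2 * N) :
    (ofPos h).l k = L k := by
  rw [l, dif_pos hk]
  simp only [ofPos, pos_posNode]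

theorem ext_pos {D E : OkadaDiagram N} (hp : ∀ k < 2 * N, D.p k = E.p k)
    (hl : ∀ k < 2 * N, D.l k = E.l k) : D = E := by
  refine OkadaDiagram.ext (funext fun u => Node.pos_injective ?_) (funext fun u => ?_)
  · rw [← p_pos, ← p_pos, hp _ u.pos_lt]
  · rw [← l_pos, ← l_pos, hl _ u.pos_lt]

namespace IsPosData

variable {P L : ℕ → ℕ}

theorem inj (h : IsPosData N P L) {x y : ℕ} (hx : x < 2 * N) (hy : y < 2 * N) (e : P x = P y) :
    x = y := by
  rw [← h.invol x hx, e, h.invol y hy]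

/-- Two different arcs do not cross, in a form symmetric in the ends of the arcs. -/
theorem between (h : IsPosData N P L) {x y : ℕ} (hx : x < 2 * N) (hy : y < 2 * N) (n1 : y ≠ x)
    (n2 : y ≠ P x) :
    ((x < y ∧ y < P x) ∨ (P x < y ∧ y < x)) ↔ ((x < P y ∧ P y < P x) ∨ (P x < P y ∧ P y < x)) := by
  have px := h.lt x hx
  have py := h.lt y hy
  have ix := h.invol x hx
  have iy := h.invol y hy
  have n3 : P y ≠ P x := fun e => n1 (h.inj hy hx e)
  have n4 : P y ≠ x := fun e => n2 (by rw [← e, iy])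
  have c1 := h.noncrossing x hx y hy
  have c2 := h.noncrossing y hy x hx
  have c3 := h.noncrossing _ px y hy
  have c4 := h.noncrossing y hy _ px
  have c5 := h.noncrossing x hx _ py
  have c6 := h.noncrossing _ py x hx
  have c7 := h.noncrossing _ px _ py
  have c8 := h.noncrossing _ py _ px
  rw [ix] at *
  rw [iy] at *
  omega

/-- A node under an arc belongs to an arc nested in it, since the two cannot cross. Hence the
nesting condition can be tested on a single end of the inner arc, with no regard to orientation. -/
theorem nested' (h : IsPosData N P L) {x y : ℕ} (hx : x < 2 * N) (hy : y < 2 * N)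
    (hxy : (x < y ∧ y < P x) ∨ (P x < y ∧ y < x)) : L x < L y := by
  have px := h.lt x hx
  have py := h.lt y hy
  have hb := (h.between hx hy (by omega) (by omega)).1 hxy
  have n := h.ne y hy
  have c1 := h.nested y hy x hx
  have c2 := h.nested _ py x hx
  have c3 := h.nested y hy _ px
  have c4 := h.nested _ py _ px
  rw [h.invol x hx, h.label_partner x hx] at *
  rw [h.invol y hy, h.label_partner y hy] at *
  omega

end IsPosData

theorem p_parity (D : OkadaDiagram N) {k : ℕ} (hk : k < 2 * N) : D.p k % 2 ≠ k % 2 := by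
  have h := D.isPosData
  have h1 := D.pos_partner (posNode k hk)
  have h2 := D.pos_partner (D.partner (posNode k hk))
  rw [D.partner_partner] at h2
  simp only [← p_pos, pos_posNode] at h1 h2
  have := h.ne k hk
  omega

end OkadaDiagram

/-! ### Joining two neighbouring ends by a cap and a cup -/

namespace OkadaDiagram

variable {N : ℕ}

/-- Joining the ends `a` and `b` of two arcs by a cap and a cup: the matching. -/
def joinPartner (P : ℕ → ℕ) (a b k : ℕ) : ℕ :=
  if k = a then b else if k = b then a else if k = P a then P b else if k = P b then P a else P k

/-- Joining the ends `a` and `b` of two arcs by a cap and a cup of label `i`: the labels. -/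
def joinLabel (P L : ℕ → ℕ) (a b i k : ℕ) : ℕ :=
  if k = a ∨ k = b then i else if k = P a ∨ k = P b then min (L a) (L b) else L k

/-- The number `y` lies strictly between `u` and `v`. -/
def Btw (u v y : ℕ) : Prop := (u < y ∧ y < v) ∨ (v < y ∧ y < u)

theorem Btw.comm {u v y : ℕ} : Btw u v y ↔ Btw v u y := by unfold Btw; omega

theorem not_btw_succ {a y : ℕ} : ¬ Btw a (a + 1) y := by unfold Btw; omega

theorem not_btw_left {u v : ℕ} : ¬ Btw u v u := by unfold Btw; omega

theorem not_btw_right {u v : ℕ} : ¬ Btw u v v := by unfold Btw; omega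

theorem btw_succ_iff {u v a : ℕ} (h1 : u ≠ a) (h2 : u ≠ a + 1) (h3 : v ≠ a) (h4 : v ≠ a + 1) :
    Btw u v a ↔ Btw u v (a + 1) := by unfold Btw; omega

/-- No integer lies between `a` and `a + 1`, so away from the end points the interval from `u` to
`v` is the symmetric difference of those from `a` to `u` and from `a + 1` to `v`. This reduces
crossing questions about a merged arc to the two arcs of which it is made. -/
theorem btw_iff_xor {a u v y : ℕ} (h1 : y ≠ a) (h2 : y ≠ a + 1) (h3 : y ≠ u) (h4 : y ≠ v) :
    Btw u v y ↔ ¬ (Btw a u y ↔ Btw (a + 1) v y) := by unfold Btw; omega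

namespace IsPosData

variable {P L : ℕ → ℕ}

theorem eq_of_partner_eq (h : IsPosData N P L) {k a : ℕ} (hk : k < 2 * N) (e : P k = a) :
    k = P a := by rw [← e, h.invol k hk]

/-- With the symmetric relation `Btw` the left and right ends of an arc need not be distinguished.
One implication in `between` suffices: in a crossing, one end of the second arc is under the first
arc and the other end is not. -/
theorem mk' (lt : ∀ k < 2 * N, P k < 2 * N) (ne : ∀ k < 2 * N, P k ≠ k)
    (invol : ∀ k < 2 * N, P (P k) = k)
    (between : ∀ x < 2 * N, ∀ y < 2 * N, y ≠ x → y ≠ P x → Btw x (P x) y → Btw x (P x) (P y))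
    (label_partner : ∀ k < 2 * N, L (P k) = L k) (one_le : ∀ k < 2 * N, 1 ≤ L k)
    (le : ∀ k < 2 * N, L k ≤ k + 1 ∧ L k ≤ 2 * N - k)
    (parity : ∀ k < 2 * N,
      L k % 2 = min (min (k + 1) (2 * N - k)) (min (P k + 1) (2 * N - P k)) % 2)
    (nested : ∀ x < 2 * N, ∀ y < 2 * N, Btw x (P x) y → L x < L y) : IsPosData N P L where
  lt := lt
  ne := ne
  invol := invol
  noncrossing a ha c hc := by
    rintro ⟨h1, h2, h3⟩
    have := between a ha c hc (by omega) (by omega) (Or.inl ⟨h1, h2⟩)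
    unfold Btw at this; omega
  label_partner := label_partner
  one_le := one_le
  le := le
  parity := parity
  nested a ha c hc h1 h2 h3 := nested c hc a ha (Or.inl ⟨h1, by omega⟩)

theorem btw (h : IsPosData N P L) {x y : ℕ} (hx : x < 2 * N) (hy : y < 2 * N) (n1 : y ≠ x)
    (n2 : y ≠ P x) : Btw x (P x) y ↔ Btw x (P x) (P y) := h.between hx hy n1 n2

theorem btw_label (h : IsPosData N P L) {x y : ℕ} (hx : x < 2 * N) (hy : y < 2 * N)
    (hxy : Btw x (P x) y) : L x < L y := h.nested' hx hy hxy

theorem min_level_parity {j B : ℕ} (hB : B < 2 * N) (hBj : j + B < 2 * N)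
    (hp : (B + 1) % 2 = j % 2) : min j (min (B + 1) (2 * N - B)) % 2 = j % 2 := by
  rcases lt_or_ge B N with h | h
  · rw [min_eq_left (a := B + 1) (by omega)]
    rcases le_total j (B + 1) with g | g
    · rw [min_eq_left g]
    · rw [min_eq_right g, hp]
  · rw [min_eq_right (a := B + 1) (by omega), min_eq_left (by omega)]

/-- For an arc with one end at the right node of level `j`, that is at position `2 * N - j`: if the
other end lies to the left, the label has the parity of `j`; if it lies to the right, that end has
the smaller level, of opposite parity. So the parity of a label records the direction of the arc. -/
theorem label_parity_of_lt {i j A m : ℕ} (hA : A < 2 * N) (hj : j ≤ N)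
    (hp : (A + 1) % 2 = j % 2) (hm : m % 2 = min j (min (A + 1) (2 * N - A)) % 2)
    (hi : (i + j) % 2 = 1) :
    (j + A < 2 * N → m % 2 = j % 2) ∧ (2 * N ≤ j + A → m % 2 = i % 2) := by
  refine ⟨fun g => by rw [hm]; exact min_level_parity hA g hp, fun g => ?_⟩
  rw [hm, min_eq_right (by omega), min_eq_right (by omega)]
  omega

/-- Here `A`, `B` are the partners of `a`, `a + 1`, with labels `u`, `v`. If both lie to the left,
the arc at `a` is nested in the one at `a + 1`; if both lie to the right, the nesting is reversed;
if they lie on opposite outer sides, the arcs are side by side and both parities are known. The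
remaining case is a crossing. -/
theorem join_label_parity_aux {i a A B u v : ℕ} (na : A ≠ a) (hba : B ≠ a)
    (nb : B ≠ a + 1) (hN : N ≤ a)
    (eA : A < N ∧ min (A + 1) (2 * N - A) = A + 1 ∧ (A + 1) % 2 = (i + 1) % 2 ∨
      N ≤ A ∧ min (A + 1) (2 * N - A) = 2 * N - A ∧ (2 * N - A) % 2 = i % 2)
    (eB : B < N ∧ min (B + 1) (2 * N - B) = B + 1 ∧ (B + 1) % 2 = i % 2 ∨
      N ≤ B ∧ min (B + 1) (2 * N - B) = 2 * N - B ∧ (2 * N - B) % 2 = (i + 1) % 2)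
    (u1 : A < a → u % 2 = (i + 1) % 2) (u2 : a < A → u % 2 = i % 2)
    (v1 : B < a → v % 2 = i % 2) (v2 : a + 1 < B → v % 2 = (i + 1) % 2)
    (h1 : B < a → A < a → B < A ∧ v < u) (h2 : a + 1 < B → a < A → B < A ∧ u < v)
    (h3 : B < a → a < A → False) :
    min u v % 2 = min (min (A + 1) (2 * N - A)) (min (B + 1) (2 * N - B)) % 2 ∧
    max u v % 2 = (i + 1) % 2 := by
  rcases Nat.lt_or_gt_of_ne na with c1 | c1 <;> rcases Nat.lt_or_gt_of_ne hba with c2 | c2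
  · obtain ⟨hBA, hl⟩ := h1 c2 c1
    rw [min_eq_right hl.le, max_eq_left hl.le]
    have u1 := u1 c1
    have v1 := v1 c2
    clear u2 v2 h1 h2 h3
    rcases eA with ⟨eA, fA, gA⟩ | ⟨eA, fA, gA⟩ <;> rcases eB with ⟨eB, fB, gB⟩ | ⟨eB, fB, gB⟩ <;>
      rw [fA, fB] <;> omega
  · have c2 : a + 1 < B := by clear u1 v1 u2 v2 h1 h2 h3; omega
    have u1 := u1 c1
    have v2 := v2 c2
    clear u2 v1 h1 h2 h3
    rcases eB with ⟨eB, -, -⟩ | ⟨eB, fB, gB⟩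
    · omega
    have : min (min (A + 1) (2 * N - A)) (min (B + 1) (2 * N - B)) % 2 = (i + 1) % 2 := by
      rcases eA with ⟨eA, fA, gA⟩ | ⟨eA, fA, gA⟩ <;> rw [fA, fB] <;> omega
    rw [this]
    rcases le_total u v with g | g
    · rw [min_eq_left g, max_eq_right g]
      exact ⟨u1, v2⟩
    · rw [min_eq_right g, max_eq_left g]
      exact ⟨v2, u1⟩
  · exact (h3 c2 c1).elim
  · have c2 : a + 1 < B := by clear u1 v1 u2 v2 h1 h2 h3; omega
    obtain ⟨hBA, hl⟩ := h2 c2 c1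
    rw [min_eq_left hl.le, max_eq_right hl.le]
    have u2 := u2 c1
    have v2 := v2 c2
    clear u1 v1 h1 h2 h3
    rcases eA with ⟨eA, fA, gA⟩ | ⟨eA, fA, gA⟩ <;> rcases eB with ⟨eB, fB, gB⟩ | ⟨eB, fB, gB⟩ <;>
      rw [fA, fB] <;> omega

theorem level_parity {A m : ℕ} (lA : A < 2 * N) (hp : (A + 1) % 2 = m % 2) :
    A < N ∧ min (A + 1) (2 * N - A) = A + 1 ∧ (A + 1) % 2 = m % 2 ∨
      N ≤ A ∧ min (A + 1) (2 * N - A) = 2 * N - A ∧ (2 * N - A) % 2 = (m + 1) % 2 := by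
  rcases lt_or_ge A N with g | g
  · left; refine ⟨g, min_eq_left (by omega), hp⟩
  · right; refine ⟨g, min_eq_right (by omega), by omega⟩

/-- The statement on the minimum is the parity axiom for the merged arc. The one on the maximum
gives the parity of the lowest row in which boxes are lost (`dropRow_spec`). -/
theorem join_label_parity (h : IsPosData N P L) (hp : ∀ k < 2 * N, P k % 2 ≠ k % 2) {i a : ℕ}
    (hi : 1 ≤ i) (hiN : i < N) (ha : a + i + 1 = 2 * N) (hab : P a ≠ a + 1) :
    min (L a) (L (a + 1)) % 2 =
      min (min (P a + 1) (2 * N - P a)) (min (P (a + 1) + 1) (2 * N - P (a + 1))) % 2 ∧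
    max (L a) (L (a + 1)) % 2 = (i + 1) % 2 := by
  have la : a < 2 * N := by omega
  have lb : a + 1 < 2 * N := by omega
  have lPa := h.lt a la
  have lPb := h.lt _ lb
  have na := h.ne a la
  have nb := h.ne _ lb
  have pa := hp a la
  have pb := hp _ lb
  have hba : P (a + 1) ≠ a := fun e => hab (h.eq_of_partner_eq lb e).symm
  have e1 : min (a + 1) (2 * N - a) = i + 1 := by omega
  have e2 : min (a + 1 + 1) (2 * N - (a + 1)) = i := by omega
  have qa : (P a + 1) % 2 = (i + 1) % 2 := by omega
  have qb : (P (a + 1) + 1) % 2 = i % 2 := by omega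
  have eA := level_parity lPa qa
  have eB := level_parity lPb qb
  clear pa pb hp
  have w : P (a + 1) < a → Btw (a + 1) (P (a + 1)) a := fun g => Or.inr ⟨g, by omega⟩
  have w' : a < P a → Btw a (P a) (a + 1) := fun g => Or.inl ⟨by omega, by omega⟩
  have u' := label_parity_of_lt (i := i) lPa (by omega) qa (by rw [h.parity a la, e1]) (by omega)
  have v' := label_parity_of_lt (i := i + 1) lPb (by omega) qb (by rw [h.parity _ lb, e2]) (by omega)
  rw [show (i + 1 + 1) % 2 = i % 2 by omega] at eA
  refine join_label_parity_aux na hba nb (by omega) eA eB ?_ ?_ ?_ ?_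
    (fun g g' => ⟨?_, h.btw_label lb la (w g)⟩) (fun g g' => ⟨?_, h.btw_label la lb (w' g')⟩)
    (fun g g' => ?_)
  · exact fun g => u'.1 (by clear u' v' eA eB; omega)
  · exact fun g => u'.2 (by clear u' v' eA eB; omega)
  · exact fun g => v'.1 (by clear u' v' eA eB; omega)
  · exact fun g => v'.2 (by clear u' v' eA eB; omega)
  all_goals clear u' v' eA eB
  · rcases (h.btw lb la (by omega) hba.symm).1 (w g) with q | q <;> omega
  · rcases (h.btw la lb (by omega) (Ne.symm hab)).1 (w' g') with q | q <;> omega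
  · rcases (h.btw la lb (by omega) (Ne.symm hab)).1 (w' g') with q | q <;> omega

/-- The cap lies under the merged arc only if the partner of `a + 1` is further to the right. That
partner then has level less than `i`, which bounds its label. -/
theorem join_label_lt (h : IsPosData N P L) {i a : ℕ} (hi : 1 ≤ i)
    (ha : a + i + 1 = 2 * N) (hab : P a ≠ a + 1) (hb : Btw (P a) (P (a + 1)) a) :
    min (L a) (L (a + 1)) < i := by
  have la : a < 2 * N := by omega
  have lb : a + 1 < 2 * N := by omega
  have wab := h.between la lb (by omega) (Ne.symm hab)
  have lePa := h.le _ (h.lt a la)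
  have lePb := h.le _ (h.lt _ lb)
  have na := h.ne a la
  have nb := h.ne _ lb
  rw [h.label_partner a la] at lePa
  rw [h.label_partner _ lb] at lePb
  clear h
  rcases hb with hb | hb
  · clear wab
    omega
  · exfalso
    omega

theorem join_cases (h : IsPosData N P L) {a : ℕ} (i k : ℕ) (lb : a + 1 < 2 * N)
    (hab : P a ≠ a + 1) :
    (k = a ∧ joinPartner P a (a + 1) k = a + 1 ∧ joinLabel P L a (a + 1) i k = i) ∨
    (k = a + 1 ∧ joinPartner P a (a + 1) k = a ∧ joinLabel P L a (a + 1) i k = i) ∨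
    (k = P a ∧ joinPartner P a (a + 1) k = P (a + 1) ∧
      joinLabel P L a (a + 1) i k = min (L a) (L (a + 1))) ∨
    (k = P (a + 1) ∧ joinPartner P a (a + 1) k = P a ∧
      joinLabel P L a (a + 1) i k = min (L a) (L (a + 1))) ∨
    (k ≠ a ∧ k ≠ a + 1 ∧ k ≠ P a ∧ k ≠ P (a + 1) ∧ joinPartner P a (a + 1) k = P k ∧
      joinLabel P L a (a + 1) i k = L k) := by
  have la : a < 2 * N := by omega
  have hba : P (a + 1) ≠ a := fun e => hab (h.eq_of_partner_eq lb e).symm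
  have na := h.ne a la
  have nb := h.ne _ lb
  have npp : P a ≠ P (a + 1) := fun e => by have := h.inj la lb e; omega
  unfold joinPartner joinLabel
  by_cases k1 : k = a
  · left; simp [k1]
  by_cases k2 : k = a + 1
  · right; left; simp [k2]
  by_cases k3 : k = P a
  · right; right; left; subst k3; simp [k1, k2]
  by_cases k4 : k = P (a + 1)
  · right; right; right; left; subst k4; simp [k1, k2, k3]
  · right; right; right; right; simp [k1, k2, k3, k4]

/-- The matching does not change; only the label of the arc rises to `i`, the largest value allowed.
Nothing is nested in an arc between neighbours, so raising its label breaks no nesting condition. -/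
theorem join_of_loop (h : IsPosData N P L) {i a : ℕ} (hi : 1 ≤ i) (hiN : i < N)
    (ha : a + i + 1 = 2 * N) (hab : P a = a + 1) :
    IsPosData N (joinPartner P a (a + 1)) (joinLabel P L a (a + 1) i) := by
  have la : a < 2 * N := by omega
  have lb : a + 1 < 2 * N := by omega
  have hba : P (a + 1) = a := by rw [← hab, h.invol a la]
  have hP : joinPartner P a (a + 1) = P := funext fun k => by
    unfold joinPartner; split_ifs with h1 h2 <;> simp_all
  have hL : ∀ k, joinLabel P L a (a + 1) i k = if k = a ∨ k = a + 1 then i else L k := by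
    intro k
    unfold joinLabel
    rw [hab, hba]
    split_ifs <;> first | rfl | omega
  have hk (k) (hk : k < 2 * N) : (P k = a ↔ k = a + 1) ∧ (P k = a + 1 ↔ k = a) := by
    refine ⟨⟨fun e => ?_, fun e => by rw [e, hba]⟩, ⟨fun e => ?_, fun e => by rw [e, hab]⟩⟩
    · rw [h.eq_of_partner_eq hk e, hab]
    · rw [h.eq_of_partner_eq hk e, hba]
  have leb := h.le _ lb
  rw [hP]
  refine mk' h.lt h.ne h.invol (fun x hx y hy n1 n2 => (h.btw hx hy n1 n2).1) ?_ ?_ ?_ ?_ ?_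
  · intro k hk'
    have := hk k hk'
    rw [hL, hL, h.label_partner k hk']
    split_ifs <;> first | rfl | omega
  · intro k hk'
    have := h.one_le k hk'
    rw [hL]; split_ifs <;> omega
  · intro k hk'
    have := h.le k hk'
    rw [hL]; split_ifs <;> omega
  · intro k hk'
    have := h.parity k hk'
    rw [hL]
    split_ifs with e
    · rcases e with rfl | rfl
      · rw [hab]; omega
      · rw [hba]; omega
    · exact this
  · intro x hx y hy hxy
    have hn := h.btw_label hx hy hxy
    rw [hL, hL]
    split_ifs with e1 e2 e2
    · exfalso
      rcases e1 with rfl | rfl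
      · rw [hab] at hxy; exact not_btw_succ hxy
      · rw [hba] at hxy; exact not_btw_succ (Btw.comm.1 hxy)
    · exfalso
      rcases e1 with rfl | rfl
      · rw [hab] at hxy; exact not_btw_succ hxy
      · rw [hba] at hxy; exact not_btw_succ (Btw.comm.1 hxy)
    · have hl := h.label_partner _ la
      rw [hab] at hl
      rcases e2 with rfl | rfl <;> omega
    · exact hn

set_option maxHeartbeats 800000 in
-- There are five kinds of nodes: the two ends of the cap, the two ends of the merged arc, and the
-- rest. The minimum is a correct label for the merged arc because what is under it is under one of
-- the old arcs, while an untouched arc over it is over both.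
theorem join (h : IsPosData N P L) (hp : ∀ k < 2 * N, P k % 2 ≠ k % 2) {i a : ℕ}
    (hi : 1 ≤ i) (hiN : i < N) (ha : a + i + 1 = 2 * N) :
    IsPosData N (joinPartner P a (a + 1)) (joinLabel P L a (a + 1) i) := by
  by_cases hab : P a = a + 1
  · exact h.join_of_loop hi hiN ha hab
  have la : a < 2 * N := by omega
  have lb : a + 1 < 2 * N := by omega
  have hba : P (a + 1) ≠ a := fun e => hab (h.eq_of_partner_eq lb e).symm
  have lPa := h.lt a la
  have lPb := h.lt _ lb
  have na := h.ne a la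
  have nb := h.ne _ lb
  have npp : P a ≠ P (a + 1) := fun e => by have := h.inj la lb e; omega
  have ia := h.invol a la
  have ib := h.invol _ lb
  have lePa := h.le _ lPa
  have lePb := h.le _ lPb
  rw [h.label_partner a la] at lePa
  rw [h.label_partner _ lb] at lePb
  have hc := fun k => h.join_cases i k lb hab
  have hP : ∀ k < 2 * N, k ≠ a → k ≠ a + 1 → k ≠ P a → k ≠ P (a + 1) →
      P k ≠ a ∧ P k ≠ a + 1 ∧ P k ≠ P a ∧ P k ≠ P (a + 1) := by
    intro k hk k1 k2 k3 k4
    exact ⟨fun e => k3 (h.eq_of_partner_eq hk e), fun e => k4 (h.eq_of_partner_eq hk e),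
      fun e => k1 (h.inj hk la e), fun e => k2 (h.inj hk lb e)⟩
  -- An untouched arc has all four nodes `a`, `a + 1`, `P a`, `P (a + 1)` under it, or none of them.
  have hold : ∀ x < 2 * N, x ≠ a → x ≠ a + 1 → x ≠ P a → x ≠ P (a + 1) →
      (Btw x (P x) a ↔ Btw x (P x) (P a)) ∧ (Btw x (P x) a ↔ Btw x (P x) (a + 1)) ∧
      (Btw x (P x) (a + 1) ↔ Btw x (P x) (P (a + 1))) := by
    intro x hx k1 k2 k3 k4
    have := hP x hx k1 k2 k3 k4
    exact ⟨h.btw hx la k1.symm this.1.symm, btw_succ_iff k1 k2 this.1 this.2.1,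
      h.btw hx lb k2.symm this.2.1.symm⟩
  have hnew : ∀ y < 2 * N, y ≠ a → y ≠ a + 1 → y ≠ P a → y ≠ P (a + 1) →
      (Btw (P a) (P (a + 1)) y ↔ Btw (P a) (P (a + 1)) (P y)) := by
    intro y hy k1 k2 k3 k4
    have := hP y hy k1 k2 k3 k4
    rw [btw_iff_xor k1 k2 k3 k4, btw_iff_xor this.1 this.2.1 this.2.2.1 this.2.2.2,
      h.btw la hy k1 k3, h.btw lb hy k2 k4]
  have hcap := btw_succ_iff na hab hba nb
  refine mk' ?_ ?_ ?_ ?_ ?_ ?_ ?_ ?_ ?_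
  · intro k hk
    have := h.lt k hk
    have := hc k
    omega
  · intro k hk
    have := h.ne k hk
    have := hc k
    omega
  · intro k hk
    rcases hc k with ⟨e, e1, -⟩ | ⟨e, e1, -⟩ | ⟨e, e1, -⟩ | ⟨e, e1, -⟩ | ⟨k1, k2, k3, k4, e1, -⟩
    · rw [e1]; have := hc (a + 1); omega
    · rw [e1]; have := hc a; omega
    · rw [e1]; have := hc (P (a + 1)); omega
    · rw [e1]; have := hc (P a); omega
    · rw [e1]
      have := hP k hk k1 k2 k3 k4
      have h2 := hc (P k)
      rw [h.invol k hk] at h2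
      omega
  · intro x hx y hy n1 n2
    rcases hc x with ⟨e, e1, -⟩ | ⟨e, e1, -⟩ | ⟨e, e1, -⟩ | ⟨e, e1, -⟩ | ⟨k1, k2, k3, k4, e1, -⟩
    · rw [e1, e]; exact fun h => absurd h not_btw_succ
    · rw [e1, e]; exact fun h => absurd (Btw.comm.1 h) not_btw_succ
    · rw [e1] at n2 ⊢
      rw [e] at n1 ⊢
      rcases hc y with ⟨f, f1, -⟩ | ⟨f, f1, -⟩ | ⟨f, f1, -⟩ | ⟨f, f1, -⟩ | ⟨l1, l2, l3, l4, f1, -⟩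
      · rw [f1, f]; exact hcap.1
      · rw [f1, f]; exact hcap.2
      · exact absurd f n1
      · exact absurd f n2
      · rw [f1]; exact (hnew y hy l1 l2 l3 l4).1
    · rw [e1] at n2 ⊢
      rw [e] at n1 ⊢
      rw [Btw.comm, Btw.comm (u := P (a + 1))]
      rcases hc y with ⟨f, f1, -⟩ | ⟨f, f1, -⟩ | ⟨f, f1, -⟩ | ⟨f, f1, -⟩ | ⟨l1, l2, l3, l4, f1, -⟩
      · rw [f1, f]; exact hcap.1
      · rw [f1, f]; exact hcap.2
      · exact absurd f n2
      · exact absurd f n1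
      · rw [f1]; exact (hnew y hy l1 l2 l3 l4).1
    · rw [e1] at n2 ⊢
      have ho := hold x hx k1 k2 k3 k4
      rcases hc y with ⟨f, f1, -⟩ | ⟨f, f1, -⟩ | ⟨f, f1, -⟩ | ⟨f, f1, -⟩ | ⟨l1, l2, l3, l4, f1, -⟩
      · rw [f1, f]; exact ho.2.1.1
      · rw [f1, f]; exact ho.2.1.2
      · rw [f1, f, ← ho.1, ← ho.2.2]; exact ho.2.1.1
      · rw [f1, f, ← ho.1, ← ho.2.2]; exact ho.2.1.2
      · rw [f1]; exact (h.btw hx hy n1 n2).1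
  · intro k hk
    rcases hc k with ⟨e, e1, e2⟩ | ⟨e, e1, e2⟩ | ⟨e, e1, e2⟩ | ⟨e, e1, e2⟩ |
      ⟨k1, k2, k3, k4, e1, e2⟩
    · rw [e1, e2]; have := hc (a + 1); omega
    · rw [e1, e2]; have := hc a; omega
    · rw [e1, e2]; have := hc (P (a + 1)); omega
    · rw [e1, e2]; have := hc (P a); omega
    · rw [e1, e2]
      have := hP k hk k1 k2 k3 k4
      have h2 := hc (P k)
      rw [h.label_partner k hk] at h2
      omega
  · intro k hk
    have := h.one_le k hk
    have := h.one_le a la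
    have := h.one_le _ lb
    have := hc k
    omega
  · intro k hk
    have := h.le k hk
    have := hc k
    omega
  · intro k hk
    have hm := h.join_label_parity hp hi hiN ha hab
    rcases hc k with ⟨e, e1, e2⟩ | ⟨e, e1, e2⟩ | ⟨e, e1, e2⟩ | ⟨e, e1, e2⟩ |
      ⟨k1, k2, k3, k4, e1, e2⟩
    · rw [e1, e2]; omega
    · rw [e1, e2]; omega
    · rw [e1, e2, e]; exact hm.1
    · rw [e1, e2, e, min_comm (min (P (a + 1) + 1) _)]; exact hm.1
    · rw [e1, e2]; exact h.parity k hk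
  · intro x hx y hy
    have hlb : L (a + 1) ≤ i := by have := h.le _ lb; omega
    have caplab : Btw (P a) (P (a + 1)) a → min (L a) (L (a + 1)) < i := by
      exact h.join_label_lt hi ha hab
    -- A node under the merged arc is under exactly one of the two old arcs, so its label exceeds
    -- that arc's label and hence the minimum.
    have newlab : y ≠ a → y ≠ a + 1 → y ≠ P a → y ≠ P (a + 1) → Btw (P a) (P (a + 1)) y →
        min (L a) (L (a + 1)) < L y := by
      intro l1 l2 l3 l4 hy'
      rw [btw_iff_xor l1 l2 l3 l4] at hy'
      by_cases g : Btw a (P a) y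
      · exact (min_le_left _ _).trans_lt (h.btw_label la hy g)
      · exact (min_le_right _ _).trans_lt
          (h.btw_label lb hy (by_contra fun g' => hy' (iff_of_false g g')))
    rcases hc x with ⟨e, e1, e2⟩ | ⟨e, e1, e2⟩ | ⟨e, e1, e2⟩ | ⟨e, e1, e2⟩ |
      ⟨k1, k2, k3, k4, e1, e2⟩
    · rw [e1, e]; exact fun h => absurd h not_btw_succ
    · rw [e1, e]; exact fun h => absurd (Btw.comm.1 h) not_btw_succ
    · rw [e1, e2, e]
      rcases hc y with ⟨f, f1, f2⟩ | ⟨f, f1, f2⟩ | ⟨f, f1, f2⟩ | ⟨f, f1, f2⟩ |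
        ⟨l1, l2, l3, l4, f1, f2⟩
      · rw [f2, f]; exact caplab
      · rw [f2, f, ← hcap]; exact caplab
      · rw [f]; exact fun g => absurd g not_btw_left
      · rw [f]; exact fun g => absurd g not_btw_right
      · rw [f2]; exact newlab l1 l2 l3 l4
    · rw [e1, e2, e, Btw.comm]
      rcases hc y with ⟨f, f1, f2⟩ | ⟨f, f1, f2⟩ | ⟨f, f1, f2⟩ | ⟨f, f1, f2⟩ |
        ⟨l1, l2, l3, l4, f1, f2⟩
      · rw [f2, f]; exact caplab
      · rw [f2, f, ← hcap]; exact caplab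
      · rw [f]; exact fun g => absurd g not_btw_left
      · rw [f]; exact fun g => absurd g not_btw_right
      · rw [f2]; exact newlab l1 l2 l3 l4
    · rw [e1, e2]
      have ho := hold x hx k1 k2 k3 k4
      have hxa := h.btw_label hx la
      have hxb := h.btw_label hx lb
      rcases hc y with ⟨f, f1, f2⟩ | ⟨f, f1, f2⟩ | ⟨f, f1, f2⟩ | ⟨f, f1, f2⟩ |
        ⟨l1, l2, l3, l4, f1, f2⟩
      · rw [f2, f]; exact fun g => (hxb (ho.2.1.1 g)).trans_le hlb
      · rw [f2, f]; exact fun g => (hxb g).trans_le hlb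
      · rw [f2, f]
        exact fun g => lt_min (hxa (ho.1.2 g)) (hxb (ho.2.1.1 (ho.1.2 g)))
      · rw [f2, f]
        exact fun g => lt_min (hxa (ho.2.1.2 (ho.2.2.2 g))) (hxb (ho.2.2.2 g))
      · rw [f2]; exact h.btw_label hx hy

end IsPosData

end OkadaDiagram

/-! ### Right multiplication of a diagram by an elementary diagram -/

namespace OkadaDiagram

variable {N : ℕ}

/-- The right node of level `i + 1`. -/
def hiNode (i : ℕ) (hi : 1 ≤ i ∧ i < N) : Node N := Sum.inr ⟨i, hi.2⟩

/-- The right node of level `i`. -/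
def loNode (i : ℕ) (hi : 1 ≤ i ∧ i < N) : Node N := Sum.inr ⟨i - 1, by omega⟩

theorem hiNode_ne_loNode {i : ℕ} (hi : 1 ≤ i ∧ i < N) : hiNode i hi ≠ loNode i hi := by
  simp only [hiNode, loNode, ne_eq, Sum.inr.injEq, Fin.mk.injEq]; omega

theorem pos_hiNode {i : ℕ} (hi : 1 ≤ i ∧ i < N) : (hiNode i hi).pos = 2 * N - 1 - i := rfl

theorem pos_loNode {i : ℕ} (hi : 1 ≤ i ∧ i < N) : (loNode i hi).pos = 2 * N - 1 - i + 1 := by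
  simp only [loNode, Node.pos]; omega

/-- The composition of `D` with the elementary diagram `G i` on the right. -/
def mulElem (D : OkadaDiagram N) (i : ℕ) (hi : 1 ≤ i ∧ i < N) : OkadaDiagram N :=
  ofPos (D.isPosData.join (fun _ hk => D.p_parity hk) hi.1 hi.2
    (show 2 * N - 1 - i + i + 1 = 2 * N by omega))

theorem mulElem_p (D : OkadaDiagram N) {i : ℕ} (hi : 1 ≤ i ∧ i < N) {k : ℕ} (hk : k < 2 * N) :
    (D.mulElem i hi).p k = joinPartner D.p (2 * N - 1 - i) (2 * N - 1 - i + 1) k := p_ofPos _ hk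

theorem mulElem_l (D : OkadaDiagram N) {i : ℕ} (hi : 1 ≤ i ∧ i < N) {k : ℕ} (hk : k < 2 * N) :
    (D.mulElem i hi).l k = joinLabel D.p D.l (2 * N - 1 - i) (2 * N - 1 - i + 1) i k := l_ofPos _ hk

theorem mulElem_partner (D : OkadaDiagram N) {i : ℕ} (hi : 1 ≤ i ∧ i < N) (u : Node N) :
    (D.mulElem i hi).partner u =
      if u = hiNode i hi then loNode i hi else if u = loNode i hi then hiNode i hi
      else if u = D.partner (hiNode i hi) then D.partner (loNode i hi)
      else if u = D.partner (loNode i hi) then D.partner (hiNode i hi) else D.partner u := by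
  apply Node.pos_injective
  rw [← p_pos, mulElem_p D hi u.pos_lt, ← pos_loNode hi, ← pos_hiNode hi]
  unfold joinPartner
  simp only [p_pos, Node.pos_injective.eq_iff]
  split_ifs <;> rfl

theorem mulElem_label (D : OkadaDiagram N) {i : ℕ} (hi : 1 ≤ i ∧ i < N) (u : Node N) :
    (D.mulElem i hi).label u =
      if u = hiNode i hi ∨ u = loNode i hi then i
      else if u = D.partner (hiNode i hi) ∨ u = D.partner (loNode i hi) then
        min (D.label (hiNode i hi)) (D.label (loNode i hi)) else D.label u := by
  rw [← l_pos, mulElem_l D hi u.pos_lt, ← pos_loNode hi, ← pos_hiNode hi]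
  unfold joinLabel
  simp only [p_pos, l_pos, Node.pos_injective.eq_iff]

/-- Presenting `G i` as a product with the identity diagram lets the statements on compositions with
`G i` be deduced from those on compositions with the identity. -/
theorem mulElem_id {i : ℕ} (hi : 1 ≤ i ∧ i < N) : (OkadaDiagram.id N).mulElem i hi = elem i hi := by
  apply OkadaDiagram.ext <;> funext u
  · rw [mulElem_partner]
    rcases u with ⟨u, hu⟩ | ⟨u, hu⟩ <;>
      simp only [hiNode, loNode, OkadaDiagram.id, elem, Node.mirror, elemPartner, elemSwap,
        reduceCtorEq, if_false, Sum.inl.injEq, Sum.inr.injEq, Fin.mk.injEq] <;>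
      split_ifs <;> first | rfl | omega
  · rw [mulElem_label]
    rcases u with ⟨u, hu⟩ | ⟨u, hu⟩ <;>
      simp only [hiNode, loNode, OkadaDiagram.id, elem, Node.mirror, elemLabel, Node.level,
        reduceCtorEq, if_false, Sum.inl.injEq, Sum.inr.injEq, Fin.mk.injEq, false_or] <;>
      split_ifs <;> omega

theorem partner_eq_comm (D : OkadaDiagram N) {u v : Node N} : D.partner u = v ↔ D.partner v = u :=
  ⟨fun h => by rw [← h, D.partner_partner], fun h => by rw [← h, D.partner_partner]⟩

theorem partner_inj (D : OkadaDiagram N) {u v : Node N} : D.partner u = D.partner v ↔ u = v :=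
  ⟨fun h => by rw [← D.partner_partner u, h, D.partner_partner], fun h => by rw [h]⟩

theorem label_le_level (D : OkadaDiagram N) (u : Node N) : D.label u ≤ u.level :=
  (D.label_le u).trans (min_le_left _ _)

/-- The number of loops of label `k` in the composition of `D` with `G i`. -/
def loopAt (D : OkadaDiagram N) (i : ℕ) (hi : 1 ≤ i ∧ i < N) (k : ℕ) : ℕ :=
  if D.partner (hiNode i hi) = loNode i hi ∧ D.label (hiNode i hi) = k then 1 else 0

end OkadaDiagram

/-! ### Connectivity in the concatenation of two diagrams -/

section Concat

open OkadaDiagram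

variable {N : ℕ} {C D E F : OkadaDiagram N}

theorem reachable_inFst (C D : OkadaDiagram N) (u : Node N) :
    (concatGraph C D).Reachable (inFst u) (inFst (C.partner u)) := by
  by_cases h : inFst u = inFst (C.partner u)
  · rw [← h]
  · exact SimpleGraph.Adj.reachable (by
      rw [concatGraph, SimpleGraph.fromRel_adj]
      exact ⟨h, Or.inl (Or.inl ⟨u, rfl, rfl⟩)⟩)

theorem reachable_inSnd (C D : OkadaDiagram N) (u : Node N) :
    (concatGraph C D).Reachable (inSnd u) (inSnd (D.partner u)) := by
  by_cases h : inSnd u = inSnd (D.partner u)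
  · rw [← h]
  · exact SimpleGraph.Adj.reachable (by
      rw [concatGraph, SimpleGraph.fromRel_adj]
      exact ⟨h, Or.inl (Or.inr ⟨u, rfl, rfl⟩)⟩)

/-- Connectivity is the smallest equivalence relation which contains the arcs. -/
theorem reachable_le {R : Node3 N → Node3 N → Prop} (hR : Equivalence R)
    (h1 : ∀ u, R (inFst u) (inFst (C.partner u))) (h2 : ∀ u, R (inSnd u) (inSnd (D.partner u)))
    {p q : Node3 N} (h : (concatGraph C D).Reachable p q) : R p q := by
  obtain ⟨w⟩ := h
  induction w with
  | nil => exact hR.refl _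
  | cons hadj _ ih =>
    refine hR.trans ?_ ih
    rw [concatGraph, SimpleGraph.fromRel_adj] at hadj
    rcases hadj.2 with (⟨u, rfl, rfl⟩ | ⟨u, rfl, rfl⟩) | (⟨u, rfl, rfl⟩ | ⟨u, rfl, rfl⟩)
    · exact h1 u
    · exact h2 u
    · exact hR.symm (h1 u)
    · exact hR.symm (h2 u)

/-- The height of the component of `v`. -/
noncomputable def heightAt (C D : OkadaDiagram N) (v : Node3 N) : ℕ :=
  concatHeight C D ((concatGraph C D).connectedComponentMk v)

/-- Describing the height by its lower bounds allows heights to be compared without choosing an arc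
of minimal label. -/
theorem le_heightAt {v : Node3 N} {t : ℕ} : t ≤ heightAt C D v ↔
    (∀ u, (concatGraph C D).Reachable (inFst u) v → t ≤ C.label u) ∧
    (∀ u, (concatGraph C D).Reachable (inSnd u) v → t ≤ D.label u) := by
  -- Every vertex lies on some arc. Nonemptiness matters because the infimum of the empty set of
  -- naturals is 0.
  have hne : ({h | ∃ u, (concatGraph C D).connectedComponentMk (inFst u) =
      (concatGraph C D).connectedComponentMk v ∧ h = C.label u} ∪
    {h | ∃ u, (concatGraph C D).connectedComponentMk (inSnd u) =
      (concatGraph C D).connectedComponentMk v ∧ h = D.label u}).Nonempty := by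
    rcases v with v | v | v
    · exact ⟨_, Or.inl ⟨Sum.inl v, rfl, rfl⟩⟩
    · exact ⟨_, Or.inl ⟨Sum.inr v, rfl, rfl⟩⟩
    · exact ⟨_, Or.inr ⟨Sum.inr v, rfl, rfl⟩⟩
  unfold heightAt concatHeight
  rw [le_csInf_iff ⟨0, fun _ _ => Nat.zero_le _⟩ hne]
  constructor
  · intro h
    exact ⟨fun u hu => h _ (Or.inl ⟨u, SimpleGraph.ConnectedComponent.eq.2 hu, rfl⟩),
      fun u hu => h _ (Or.inr ⟨u, SimpleGraph.ConnectedComponent.eq.2 hu, rfl⟩)⟩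
  · rintro ⟨h1, h2⟩ b (⟨u, hu, rfl⟩ | ⟨u, hu, rfl⟩)
    · exact h1 u (SimpleGraph.ConnectedComponent.eq.1 hu)
    · exact h2 u (SimpleGraph.ConnectedComponent.eq.1 hu)

theorem heightAt_congr {v w : Node3 N} (h : (concatGraph C D).Reachable v w) :
    heightAt C D v = heightAt C D w := by
  unfold heightAt; rw [SimpleGraph.ConnectedComponent.eq.2 h]

/-- The vertex sets of the loops of label `k`. -/
def loopSets (C D : OkadaDiagram N) (k : ℕ) : Set (Set (Node3 N)) :=
  {S | ∃ v, S = {w | (concatGraph C D).Reachable w v} ∧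
    (∀ u, ¬ (concatGraph C D).Reachable (inOuter u) v) ∧ heightAt C D v = k}

/-- Loops are counted by their vertex sets, so that the loops of different concatenation graphs on
the same vertices can be compared. -/
theorem loopCount_eq (C D : OkadaDiagram N) (k : ℕ) : loopCount C D k = (loopSets C D k).ncard := by
  rw [loopCount, ← Set.ncard_image_of_injective _
    (SimpleGraph.ConnectedComponent.supp_injective (G := concatGraph C D))]
  congr 1
  ext S
  constructor
  · rintro ⟨γ, ⟨h1, h2⟩, rfl⟩
    induction γ using SimpleGraph.ConnectedComponent.ind with
    | h v =>
      refine ⟨v, ?_, fun u hu => h1 u (SimpleGraph.ConnectedComponent.eq.2 hu), h2⟩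
      ext w
      simp
  · rintro ⟨v, rfl, h1, h2⟩
    refine ⟨(concatGraph C D).connectedComponentMk v,
      ⟨fun u hu => h1 u (SimpleGraph.ConnectedComponent.eq.1 hu), h2⟩, ?_⟩
    ext w
    simp

theorem IsComposition.reachable_iff (h : IsComposition C D F) {u v : Node N} :
    (concatGraph C D).Reachable (inOuter u) (inOuter v) ↔ u = v ∨ F.partner u = v := by
  by_cases huv : u = v
  · simp [huv]
  · rw [h.1 u v huv]; simp [huv]

end Concat

/-! ### Merging of components by a cap -/

section Concat

open OkadaDiagram

variable {N : ℕ} {C D E F : OkadaDiagram N}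

theorem inSnd_injective : Function.Injective (inSnd (N := N)) := by
  rintro (a | a) (b | b) h <;> simp_all [inSnd]

theorem inOuter_injective : Function.Injective (inOuter (N := N)) := by
  rintro (a | a) (b | b) h <;> simp_all [inOuter]

theorem inFst_ne_inSnd_inr (u : Node N) (a : Fin N) : inFst u ≠ inSnd (Sum.inr a) := by
  rcases u with u | u <;> simp [inFst, inSnd]

theorem mulElem_partner_of_loop {i : ℕ} (hi : 1 ≤ i ∧ i < N)
    (hl : D.partner (hiNode i hi) = loNode i hi) : (D.mulElem i hi).partner = D.partner := by
  funext u
  have hl' := D.partner_eq_comm.1 hl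
  rw [mulElem_partner, hl, hl']
  split_ifs <;> simp_all

variable {i : ℕ} (hi : 1 ≤ i ∧ i < N)

/-- The vertex lies on the cap attached on the right by `G i`. -/
def OnCap (v : Node3 N) : Prop := v = inSnd (hiNode i hi) ∨ v = inSnd (loNode i hi)

theorem not_onCap_inFst (u : Node N) : ¬ OnCap hi (inFst u) := by
  rintro (h | h) <;> exact inFst_ne_inSnd_inr _ _ h

theorem onCap_inSnd {u : Node N} : OnCap hi (inSnd u) ↔ u = hiNode i hi ∨ u = loNode i hi := by
  simp only [OnCap, inSnd_injective.eq_iff]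

theorem onCap_inOuter {u : Node N} : OnCap hi (inOuter u) ↔ u = hiNode i hi ∨ u = loNode i hi := by
  have h1 : inSnd (hiNode i hi) = inOuter (hiNode i hi) := rfl
  have h2 : inSnd (loNode i hi) = inOuter (loNode i hi) := rfl
  simp only [OnCap, h1, h2, inOuter_injective.eq_iff]

/-- Connectivity after two components are merged at `a` and `b`. -/
def MergeRel (r : Node3 N → Node3 N → Prop) (a b u v : Node3 N) : Prop :=
  r u v ∨ (r u a ∧ r v b) ∨ (r u b ∧ r v a)

theorem MergeRel.equivalence {r : Node3 N → Node3 N → Prop} (h : Equivalence r) (a b : Node3 N) :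
    Equivalence (MergeRel r a b) := by
  refine ⟨fun x => Or.inl (h.refl x), ?_, ?_⟩
  · rintro x y (g | ⟨g1, g2⟩ | ⟨g1, g2⟩)
    · exact Or.inl (h.symm g)
    · exact Or.inr (Or.inr ⟨g2, g1⟩)
    · exact Or.inr (Or.inl ⟨g2, g1⟩)
  · rintro x y z (g | ⟨g1, g2⟩ | ⟨g1, g2⟩) (k | ⟨k1, k2⟩ | ⟨k1, k2⟩)
    · exact Or.inl (h.trans g k)
    · exact Or.inr (Or.inl ⟨h.trans g k1, k2⟩)
    · exact Or.inr (Or.inr ⟨h.trans g k1, k2⟩)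
    · exact Or.inr (Or.inl ⟨g1, h.trans (h.symm k) g2⟩)
    · exact Or.inl (h.trans g1 (h.trans (h.symm k1) (h.trans g2 (h.symm k2))))
    · exact Or.inl (h.trans g1 (h.symm k2))
    · exact Or.inr (Or.inr ⟨g1, h.trans (h.symm k) g2⟩)
    · exact Or.inl (h.trans g1 (h.symm k2))
    · exact Or.inl (h.trans g1 (h.trans (h.symm k1) (h.trans g2 (h.symm k2))))

theorem reachable_equivalence (C D : OkadaDiagram N) : Equivalence (concatGraph C D).Reachable :=
  (concatGraph C D).reachable_is_equivalence

theorem reachable_mulElem_cap : (concatGraph C (D.mulElem i hi)).Reachable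
    (inSnd (hiNode i hi)) (inSnd (loNode i hi)) := by
  have h := reachable_inSnd C (D.mulElem i hi) (hiNode i hi)
  rwa [mulElem_partner, if_pos rfl] at h

/-- Send each cap node to its partner in `D` and fix all other vertices. Arcs of the old
concatenation go to connected pairs of the new one, so paths off the cap survive. -/
theorem reachable_mulElem_of_reachable (hl : D.partner (hiNode i hi) ≠ loNode i hi)
    {u v : Node3 N} (hu : ¬ OnCap hi u) (hv : ¬ OnCap hi v)
    (h : (concatGraph C D).Reachable u v) : (concatGraph C (D.mulElem i hi)).Reachable u v := by
  classical
  have hl' : D.partner (loNode i hi) ≠ hiNode i hi := fun e => hl (D.partner_eq_comm.1 e)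
  let f : Node3 N → Node3 N := fun w => if w = inSnd (hiNode i hi) then
    inSnd (D.partner (hiNode i hi)) else if w = inSnd (loNode i hi) then
    inSnd (D.partner (loNode i hi)) else w
  have hf : ∀ w, ¬ OnCap hi w → f w = w := fun w hw => by
    simp only [OnCap, not_or] at hw
    simp [f, hw]
  have hE := reachable_equivalence C (D.mulElem i hi)
  have key : ∀ {u v}, (concatGraph C D).Reachable u v →
      (concatGraph C (D.mulElem i hi)).Reachable (f u) (f v) := by
    intro u v h
    refine reachable_le (R := fun u v => (concatGraph C (D.mulElem i hi)).Reachable (f u) (f v))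
      ⟨fun _ => hE.refl _, fun h => hE.symm h, fun h h' => hE.trans h h'⟩ ?_ ?_ h
    · intro u
      rw [hf _ (not_onCap_inFst hi _), hf _ (not_onCap_inFst hi _)]
      exact reachable_inFst _ _ _
    · intro u
      have fA : f (inSnd (hiNode i hi)) = inSnd (D.partner (hiNode i hi)) := by simp [f]
      have fB : f (inSnd (loNode i hi)) = inSnd (D.partner (loNode i hi)) := by
        simp [f, inSnd_injective.eq_iff, (hiNode_ne_loNode hi).symm]
      have fP : f (inSnd (D.partner (hiNode i hi))) = inSnd (D.partner (hiNode i hi)) :=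
        hf _ (by rw [onCap_inSnd]; exact not_or.2 ⟨D.partner_ne _, hl⟩)
      have fQ : f (inSnd (D.partner (loNode i hi))) = inSnd (D.partner (loNode i hi)) :=
        hf _ (by rw [onCap_inSnd]; exact not_or.2 ⟨hl', D.partner_ne _⟩)
      by_cases h1 : u = hiNode i hi
      · rw [h1, fA, fP]
      by_cases h2 : u = loNode i hi
      · rw [h2, fB, fQ]
      by_cases h3 : u = D.partner (hiNode i hi)
      · rw [h3, D.partner_partner, fA, fP]
      by_cases h4 : u = D.partner (loNode i hi)
      · rw [h4, D.partner_partner, fB, fQ]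
      have h5 := reachable_inSnd C (D.mulElem i hi) u
      rw [mulElem_partner, if_neg h1, if_neg h2, if_neg h3, if_neg h4] at h5
      rw [hf, hf]
      · exact h5
      · rw [onCap_inSnd]
        rintro (e | e)
        · exact h3 (D.partner_eq_comm.1 e).symm
        · exact h4 (D.partner_eq_comm.1 e).symm
      · rw [onCap_inSnd]
        exact not_or.2 ⟨h1, h2⟩
  have := key h
  rwa [hf u hu, hf v hv] at this

/-- The two cap nodes form a component of their own, and outside the cap the new arc merges two old
components. The alternative described here is an equivalence relation that contains all new arcs, so
`reachable_le` applies. -/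
theorem reachable_mulElem_cases (hl : D.partner (hiNode i hi) ≠ loNode i hi) {u v : Node3 N}
    (h : (concatGraph C (D.mulElem i hi)).Reachable u v) :
    (OnCap hi u ∧ OnCap hi v) ∨ (¬ OnCap hi u ∧ ¬ OnCap hi v ∧
      MergeRel (concatGraph C D).Reachable (inSnd (hiNode i hi)) (inSnd (loNode i hi)) u v) := by
  have hl' : D.partner (loNode i hi) ≠ hiNode i hi := fun e => hl (D.partner_eq_comm.1 e)
  have hE := reachable_equivalence C D
  have hM := MergeRel.equivalence hE (inSnd (hiNode i hi)) (inSnd (loNode i hi))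
  refine reachable_le (R := fun u v => (OnCap hi u ∧ OnCap hi v) ∨ (¬ OnCap hi u ∧ ¬ OnCap hi v ∧
      MergeRel (concatGraph C D).Reachable (inSnd (hiNode i hi)) (inSnd (loNode i hi)) u v))
    ⟨fun u => ?_, ?_, ?_⟩ ?_ ?_ h
  · by_cases hu : OnCap hi u
    · exact Or.inl ⟨hu, hu⟩
    · exact Or.inr ⟨hu, hu, hM.refl _⟩
  · rintro u v (⟨h1, h2⟩ | ⟨h1, h2, h3⟩)
    · exact Or.inl ⟨h2, h1⟩
    · exact Or.inr ⟨h2, h1, hM.symm h3⟩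
  · rintro u v w (⟨h1, h2⟩ | ⟨h1, h2, h3⟩) (⟨g1, g2⟩ | ⟨g1, g2, g3⟩)
    · exact Or.inl ⟨h1, g2⟩
    · exact absurd h2 g1
    · exact absurd g1 h2
    · exact Or.inr ⟨h1, g2, hM.trans h3 g3⟩
  · intro u
    exact Or.inr ⟨not_onCap_inFst hi _, not_onCap_inFst hi _, Or.inl (reachable_inFst _ _ _)⟩
  · intro u
    have rA := hE.symm (reachable_inSnd C D (hiNode i hi))
    have rB := hE.symm (reachable_inSnd C D (loNode i hi))
    have cP : ¬ OnCap hi (inSnd (D.partner (hiNode i hi))) := by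
      rw [onCap_inSnd]; exact not_or.2 ⟨D.partner_ne _, hl⟩
    have cQ : ¬ OnCap hi (inSnd (D.partner (loNode i hi))) := by
      rw [onCap_inSnd]; exact not_or.2 ⟨hl', D.partner_ne _⟩
    rw [mulElem_partner]
    split_ifs with h1 h2 h3 h4
    · exact Or.inl ⟨Or.inl (by rw [h1]), Or.inr rfl⟩
    · exact Or.inl ⟨Or.inr (by rw [h2]), Or.inl rfl⟩
    · rw [h3]; exact Or.inr ⟨cP, cQ, Or.inr (Or.inl ⟨rA, rB⟩)⟩
    · rw [h4]; exact Or.inr ⟨cQ, cP, Or.inr (Or.inr ⟨rB, rA⟩)⟩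
    · refine Or.inr ⟨?_, ?_, Or.inl (reachable_inSnd _ _ _)⟩
      · rw [onCap_inSnd]; exact not_or.2 ⟨h1, h2⟩
      · rw [onCap_inSnd]
        rintro (e | e)
        · exact h3 (D.partner_eq_comm.1 e).symm
        · exact h4 (D.partner_eq_comm.1 e).symm

theorem reachable_mulElem_iff (hl : D.partner (hiNode i hi) ≠ loNode i hi)
    {u v : Node3 N} (hu : ¬ OnCap hi u) (hv : ¬ OnCap hi v) :
    (concatGraph C (D.mulElem i hi)).Reachable u v ↔
      MergeRel (concatGraph C D).Reachable (inSnd (hiNode i hi)) (inSnd (loNode i hi)) u v := by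
  have hl' : D.partner (loNode i hi) ≠ hiNode i hi := fun e => hl (D.partner_eq_comm.1 e)
  constructor
  · intro h
    rcases reachable_mulElem_cases hi hl h with h | h
    · exact absurd h.1 hu
    · exact h.2.2
  · have hE := reachable_equivalence C D
    have hE' := reachable_equivalence C (D.mulElem i hi)
    have rA := reachable_inSnd C D (hiNode i hi)
    have rB := reachable_inSnd C D (loNode i hi)
    have cP : ¬ OnCap hi (inSnd (D.partner (hiNode i hi))) := by
      rw [onCap_inSnd]; exact not_or.2 ⟨D.partner_ne _, hl⟩
    have cQ : ¬ OnCap hi (inSnd (D.partner (loNode i hi))) := by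
      rw [onCap_inSnd]; exact not_or.2 ⟨hl', D.partner_ne _⟩
    have hPQ := reachable_inSnd C (D.mulElem i hi) (D.partner (hiNode i hi))
    rw [mulElem_partner, if_neg (D.partner_ne _), if_neg hl, if_pos rfl] at hPQ
    have key := fun {u v} => reachable_mulElem_of_reachable (C := C) hi hl (u := u) (v := v)
    rintro (h | ⟨h1, h2⟩ | ⟨h1, h2⟩)
    · exact key hu hv h
    · exact hE'.trans (key hu cP (hE.trans h1 rA))
        (hE'.trans hPQ (hE'.symm (key hv cQ (hE.trans h2 rB))))
    · exact hE'.trans (key hu cQ (hE.trans h1 rB))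
        (hE'.trans (hE'.symm hPQ) (hE'.symm (key hv cP (hE.trans h2 rA))))

theorem concatGraph_mulElem_of_loop (hl : D.partner (hiNode i hi) = loNode i hi) :
    concatGraph C (D.mulElem i hi) = concatGraph C D := by
  unfold concatGraph; rw [mulElem_partner_of_loop hi hl]

end Concat

/-! ### Heights, compositions and loops after right multiplication by `G i` -/

section Concat

open OkadaDiagram

variable {N : ℕ} {C D E F : OkadaDiagram N} {i : ℕ} (hi : 1 ≤ i ∧ i < N)

/-- If `D` already joins the two cap nodes, they form a whole component, since the arcs of `C` do
not reach the right boundary. -/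
theorem onCap_congr (hl : D.partner (hiNode i hi) = loNode i hi) {u v : Node3 N}
    (h : (concatGraph C D).Reachable u v) : OnCap hi u ↔ OnCap hi v := by
  have hl' := D.partner_eq_comm.1 hl
  refine reachable_le (R := fun u v => OnCap hi u ↔ OnCap hi v)
    ⟨fun _ => Iff.rfl, fun h => h.symm, fun h h' => h.trans h'⟩ ?_ ?_ h
  · intro u
    exact iff_of_false (not_onCap_inFst hi _) (not_onCap_inFst hi _)
  · intro u
    rw [onCap_inSnd, onCap_inSnd, D.partner_eq_comm, hl, D.partner_eq_comm, hl']
    exact ⟨fun h => (h.imp Eq.symm Eq.symm).symm, fun h => (h.imp Eq.symm Eq.symm).symm⟩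

theorem heightAt_cap (hl : D.partner (hiNode i hi) = loNode i hi) {v : Node3 N}
    (hv : OnCap hi v) : heightAt C D v = D.label (hiNode i hi) := by
  have hlab : D.label (loNode i hi) = D.label (hiNode i hi) := by rw [← hl, D.label_partner]
  have hE := reachable_equivalence C D
  have hr : (concatGraph C D).Reachable (inSnd (hiNode i hi)) v := by
    have h := reachable_inSnd C D (hiNode i hi)
    rw [hl] at h
    rcases hv with rfl | rfl
    · exact hE.refl _
    · exact h
  refine eq_of_forall_le_iff fun t => ?_
  rw [le_heightAt]
  constructor
  · exact fun h => h.2 _ hr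
  · intro h
    refine ⟨fun u hu => ?_, fun u hu => ?_⟩
    · exact absurd ((onCap_congr hi hl hu).2 hv) (not_onCap_inFst hi _)
    · rcases (onCap_inSnd hi).1 ((onCap_congr hi hl hu).2 hv) with rfl | rfl
      · exact h
      · rwa [hlab]

theorem reachable_mulElem_iff_of_not {v : Node3 N} (hv : ¬ OnCap hi v)
    (hA : ¬ (concatGraph C D).Reachable v (inSnd (hiNode i hi)))
    (hB : ¬ (concatGraph C D).Reachable v (inSnd (loNode i hi))) (u : Node3 N) :
    (concatGraph C (D.mulElem i hi)).Reachable u v ↔ (concatGraph C D).Reachable u v := by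
  have hE := reachable_equivalence C D
  by_cases hl : D.partner (hiNode i hi) = loNode i hi
  · rw [concatGraph_mulElem_of_loop hi hl]
  by_cases hu : OnCap hi u
  · refine iff_of_false (fun h => ?_) (fun h => ?_)
    · rcases reachable_mulElem_cases hi hl h with h | h
      · exact hv h.2
      · exact h.1 hu
    · rcases hu with rfl | rfl
      · exact hA (hE.symm h)
      · exact hB (hE.symm h)
  · rw [reachable_mulElem_iff hi hl hu hv]
    exact ⟨fun h => by rcases h with h | h | h; exacts [h, absurd h.2 hB, absurd h.2 hA], Or.inl⟩

theorem heightAt_mulElem_of_not {v : Node3 N} (hv : ¬ OnCap hi v)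
    (hA : ¬ (concatGraph C D).Reachable v (inSnd (hiNode i hi)))
    (hB : ¬ (concatGraph C D).Reachable v (inSnd (loNode i hi))) :
    heightAt C (D.mulElem i hi) v = heightAt C D v := by
  have hE := reachable_equivalence C D
  have hr := reachable_mulElem_iff_of_not hi hv hA hB
  refine eq_of_forall_le_iff fun t => ?_
  simp only [le_heightAt, hr]
  refine and_congr_right fun _ => forall_congr' fun u => imp_congr_right fun hu => ?_
  have h1 : u ≠ hiNode i hi := by rintro rfl; exact hA (hE.symm hu)
  have h2 : u ≠ loNode i hi := by rintro rfl; exact hB (hE.symm hu)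
  have h3 : u ≠ D.partner (hiNode i hi) := by
    rintro rfl; exact hA (hE.symm (hE.trans (reachable_inSnd C D _) hu))
  have h4 : u ≠ D.partner (loNode i hi) := by
    rintro rfl; exact hB (hE.symm (hE.trans (reachable_inSnd C D _) hu))
  rw [mulElem_label, if_neg (not_or.2 ⟨h1, h2⟩), if_neg (not_or.2 ⟨h3, h4⟩)]

/-- The new component consists of both old ones without the cap nodes. The labels at the cap nodes
are not lost: the new arc between their partners carries their minimum. -/
theorem heightAt_mulElem_of_merge (hl : D.partner (hiNode i hi) ≠ loNode i hi) {v : Node3 N}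
    (hv : ¬ OnCap hi v)
    (hAB : (concatGraph C D).Reachable v (inSnd (hiNode i hi)) ∨
      (concatGraph C D).Reachable v (inSnd (loNode i hi))) :
    heightAt C (D.mulElem i hi) v =
      min (heightAt C D (inSnd (hiNode i hi))) (heightAt C D (inSnd (loNode i hi))) := by
  have hE := reachable_equivalence C D
  have hl' : D.partner (loNode i hi) ≠ hiNode i hi := fun e => hl (D.partner_eq_comm.1 e)
  have rA := reachable_inSnd C D (hiNode i hi)
  have rB := reachable_inSnd C D (loNode i hi)
  have hr : ∀ u, ¬ OnCap hi u → ((concatGraph C (D.mulElem i hi)).Reachable u v ↔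
      (concatGraph C D).Reachable u (inSnd (hiNode i hi)) ∨
      (concatGraph C D).Reachable u (inSnd (loNode i hi))) := by
    intro u hu
    rw [reachable_mulElem_iff hi hl hu hv]
    constructor
    · rintro (h | h | h)
      · exact hAB.imp (hE.trans h) (hE.trans h)
      · exact Or.inl h.1
      · exact Or.inr h.1
    · rintro (h | h) <;> rcases hAB with g | g
      · exact Or.inl (hE.trans h (hE.symm g))
      · exact Or.inr (Or.inl ⟨h, g⟩)
      · exact Or.inr (Or.inr ⟨h, g⟩)
      · exact Or.inl (hE.trans h (hE.symm g))
  have hcap : ∀ u, OnCap hi u → ¬ (concatGraph C (D.mulElem i hi)).Reachable u v := by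
    intro u hu h
    rcases reachable_mulElem_cases hi hl h with h | h
    · exact hv h.2
    · exact h.1 hu
  refine eq_of_forall_le_iff fun t => ?_
  simp only [le_min_iff, le_heightAt]
  constructor
  · rintro ⟨h1, h2⟩
    have hP := h2 (D.partner (hiNode i hi)) ((hr _ (by
      rw [onCap_inSnd]; exact not_or.2 ⟨D.partner_ne _, hl⟩)).2 (Or.inl (hE.symm rA)))
    rw [mulElem_label, if_neg (not_or.2 ⟨D.partner_ne _, hl⟩), if_pos (Or.inl rfl), le_min_iff] at hP
    have key : ∀ u, ((concatGraph C D).Reachable (inSnd u) (inSnd (hiNode i hi)) ∨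
        (concatGraph C D).Reachable (inSnd u) (inSnd (loNode i hi))) → t ≤ D.label u := by
      intro u hu
      by_cases c1 : u = hiNode i hi
      · rw [c1]; exact hP.1
      by_cases c2 : u = loNode i hi
      · rw [c2]; exact hP.2
      have h3 := h2 u ((hr _ (by rw [onCap_inSnd]; exact not_or.2 ⟨c1, c2⟩)).2 hu)
      rw [mulElem_label, if_neg (not_or.2 ⟨c1, c2⟩)] at h3
      split_ifs at h3 with c3
      · rcases c3 with rfl | rfl
        · rw [D.label_partner]; exact hP.1
        · rw [D.label_partner]; exact hP.2
      · exact h3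
    exact ⟨⟨fun u hu => h1 u ((hr _ (not_onCap_inFst hi _)).2 (Or.inl hu)),
      fun u hu => key u (Or.inl hu)⟩,
      ⟨fun u hu => h1 u ((hr _ (not_onCap_inFst hi _)).2 (Or.inr hu)),
      fun u hu => key u (Or.inr hu)⟩⟩
  · rintro ⟨⟨h1, h2⟩, h3, h4⟩
    refine ⟨fun u hu => ?_, fun u hu => ?_⟩
    · exact ((hr _ (not_onCap_inFst hi _)).1 hu).elim (h1 u) (h3 u)
    · have hc : ¬ OnCap hi (inSnd u) := fun h => hcap _ h hu
      have hc' := hc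
      rw [onCap_inSnd] at hc'
      rw [mulElem_label, if_neg hc']
      split_ifs with c3
      · exact le_min (h2 _ (hE.refl _)) (h4 _ (hE.refl _))
      · exact ((hr _ hc).1 hu).elim (h2 u) (h4 u)

theorem inSnd_hiNode : inSnd (hiNode i hi) = inOuter (hiNode i hi) := rfl

theorem inSnd_loNode : inSnd (loNode i hi) = inOuter (loNode i hi) := rfl

theorem IsComposition.label_eq (h : IsComposition C D F) (u : Node N) :
    F.label u = heightAt C D (inOuter u) := h.2 u

/-- If the component of `hiNode` in the concatenation with `D` is an arc of `D`, it is one of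
the composition. -/
theorem IsComposition.loop (h : IsComposition C D F) (hl : D.partner (hiNode i hi) = loNode i hi) :
    F.partner (hiNode i hi) = loNode i hi ∧ F.label (hiNode i hi) = D.label (hiNode i hi) := by
  have h1 := reachable_inSnd C D (hiNode i hi)
  rw [hl, inSnd_hiNode, inSnd_loNode, h.reachable_iff] at h1
  refine ⟨h1.resolve_left (hiNode_ne_loNode hi), ?_⟩
  rw [h.label_eq]
  exact heightAt_cap hi hl (Or.inl rfl)

theorem mulElem_partner_hiNode : (D.mulElem i hi).partner (hiNode i hi) = loNode i hi := by
  rw [mulElem_partner, if_pos rfl]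

theorem mulElem_label_hiNode : (D.mulElem i hi).label (hiNode i hi) = i := by
  rw [mulElem_label, if_pos (Or.inl rfl)]

theorem IsComposition.not_reachable_of_ne (h : IsComposition C D F) {u : Node N}
    (hu : ¬ (u = hiNode i hi ∨ u = loNode i hi))
    (hu' : ¬ (u = F.partner (hiNode i hi) ∨ u = F.partner (loNode i hi))) :
    ¬ (concatGraph C D).Reachable (inOuter u) (inSnd (hiNode i hi)) ∧
    ¬ (concatGraph C D).Reachable (inOuter u) (inSnd (loNode i hi)) := by
  rw [inSnd_hiNode, inSnd_loNode, h.reachable_iff, h.reachable_iff, F.partner_eq_comm,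
    F.partner_eq_comm (v := loNode i hi), @eq_comm _ _ u, @eq_comm _ _ u]
  tauto

/-- This is associativity of loop-free composition when the last factor is `G i`. Both bracketings
isolate the cap and merge the components of its two ends. If `D` already has an arc along the cap,
so does `F`, and only its label changes. -/
theorem IsComposition.mulElem (h : IsComposition C D F) :
    IsComposition C (D.mulElem i hi) (F.mulElem i hi) := by
  have hE := reachable_equivalence C D
  have hc : ∀ {u}, OnCap hi (inOuter u) ↔ _ := onCap_inOuter hi
  constructor
  · intro u v huv
    by_cases hl : D.partner (hiNode i hi) = loNode i hi
    · rw [concatGraph_mulElem_of_loop hi hl, mulElem_partner_of_loop hi (h.loop hi hl).1]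
      exact h.1 u v huv
    have hcap : OnCap hi (inOuter u) → OnCap hi (inOuter v) →
        (concatGraph C (D.mulElem i hi)).Reachable (inOuter u) (inOuter v) := by
      have := reachable_mulElem_cap (C := C) (D := D) hi
      rintro (h1 | h1) (h2 | h2)
      · rw [h1, h2]
      · rw [h1, h2]; exact this
      · rw [h1, h2]; exact this.symm
      · rw [h1, h2]
    by_cases hu : OnCap hi (inOuter u)
    · have h1 : (concatGraph C (D.mulElem i hi)).Reachable (inOuter u) (inOuter v) ↔
          OnCap hi (inOuter v) := by
        refine ⟨fun g => ?_, hcap hu⟩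
        rcases reachable_mulElem_cases hi hl g with g | g
        · exact g.2
        · exact absurd hu g.1
      rw [h1, hc, mulElem_partner]
      rcases hc.1 hu with rfl | rfl
      · rw [if_pos rfl]
        exact ⟨fun e => Or.inr e.symm, fun e => (e.resolve_left huv.symm).symm⟩
      · rw [if_neg (hiNode_ne_loNode hi).symm, if_pos rfl]
        exact ⟨fun e => Or.inl e.symm, fun e => (e.resolve_right huv.symm).symm⟩
    by_cases hv : OnCap hi (inOuter v)
    · refine iff_of_false (fun e => ?_) (fun g => ?_)
      · rw [OkadaDiagram.partner_eq_comm, mulElem_partner] at e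
        rw [hc] at hu
        rcases hc.1 hv with rfl | rfl
        · rw [if_pos rfl] at e; exact hu (Or.inr e.symm)
        · rw [if_neg (hiNode_ne_loNode hi).symm, if_pos rfl] at e; exact hu (Or.inl e.symm)
      · rcases reachable_mulElem_cases hi hl g with g | g
        · exact hu g.1
        · exact g.2.1 hv
    rw [reachable_mulElem_iff hi hl hu hv, mulElem_partner]
    rw [hc, not_or] at hu hv
    simp only [MergeRel, inSnd_hiNode, inSnd_loNode, h.reachable_iff, hu.1, hu.2, hv.1, hv.2,
      if_false, false_or, huv]
    have e1 := F.partner_eq_comm (u := u) (v := hiNode i hi)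
    have e2 := F.partner_eq_comm (u := u) (v := loNode i hi)
    have e3 := F.partner_eq_comm (u := v) (v := hiNode i hi)
    have e4 := F.partner_eq_comm (u := v) (v := loNode i hi)
    rw [e1, e2, e3, e4]
    by_cases c1 : u = F.partner (hiNode i hi)
    · rw [if_pos c1]
      have hn : F.partner (loNode i hi) ≠ u := by
        rw [c1, ne_eq, F.partner_inj]; exact (hiNode_ne_loNode hi).symm
      have hn' : F.partner u ≠ v := by
        rw [c1, F.partner_partner]; exact fun e => hv.1 e.symm
      simp only [c1.symm, hn, hn', true_and, false_and, or_false, false_or]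
    by_cases c2 : u = F.partner (loNode i hi)
    · rw [if_neg c1, if_pos c2]
      have hn' : F.partner u ≠ v := by
        rw [c2, F.partner_partner]; exact fun e => hv.2 e.symm
      have c1' : F.partner (hiNode i hi) ≠ u := fun e => c1 e.symm
      simp only [c2.symm, c1', hn', true_and, false_and, false_or]
    · rw [if_neg c1, if_neg c2]
      have c1' : F.partner (hiNode i hi) ≠ u := fun e => c1 e.symm
      have c2' : F.partner (loNode i hi) ≠ u := fun e => c2 e.symm
      simp only [c1', c2', false_and, or_false]
  · intro u
    change _ = heightAt C (D.mulElem i hi) (inOuter u)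
    rw [mulElem_label]
    by_cases hu : u = hiNode i hi ∨ u = loNode i hi
    · rw [if_pos hu, heightAt_cap hi (mulElem_partner_hiNode hi) (hc.2 hu), mulElem_label_hiNode]
    rw [if_neg hu]
    have hu0 : ¬ OnCap hi (inOuter u) := by rwa [hc]
    split_ifs with c
    · by_cases hl : D.partner (hiNode i hi) = loNode i hi
      · exfalso
        have hF := (h.loop hi hl).1
        rw [hF, F.partner_eq_comm.1 hF] at c
        exact hu c.symm
      have hr : (concatGraph C D).Reachable (inOuter u) (inSnd (hiNode i hi)) ∨
          (concatGraph C D).Reachable (inOuter u) (inSnd (loNode i hi)) := by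
        rw [inSnd_hiNode, inSnd_loNode, h.reachable_iff, h.reachable_iff, F.partner_eq_comm,
          F.partner_eq_comm (v := loNode i hi)]
        exact c.imp (fun e => Or.inr e.symm) (fun e => Or.inr e.symm)
      rw [heightAt_mulElem_of_merge hi hl hu0 hr, h.label_eq, h.label_eq]
      rfl
    · have hr := h.not_reachable_of_ne hi hu c
      rw [heightAt_mulElem_of_not hi hu0 hr.1 hr.2, h.label_eq]

theorem IsComposition.reachable_cap (h : IsComposition C D F)
    (hF : F.partner (hiNode i hi) = loNode i hi) :
    (concatGraph C D).Reachable (inSnd (hiNode i hi)) (inSnd (loNode i hi)) := by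
  rw [inSnd_hiNode, inSnd_loNode, h.reachable_iff]
  exact Or.inr hF

/-- A loop contains no outer node, so its component is disjoint from those that the cap touches. -/
theorem loopSets_mulElem_subset {k : ℕ} :
    loopSets C D k ⊆ loopSets C (D.mulElem i hi) k := by
  rintro S ⟨v, rfl, h1, h2⟩
  have hE := reachable_equivalence C D
  have hA : ¬ (concatGraph C D).Reachable v (inSnd (hiNode i hi)) :=
    fun g => h1 (hiNode i hi) (hE.symm g)
  have hB : ¬ (concatGraph C D).Reachable v (inSnd (loNode i hi)) :=
    fun g => h1 (loNode i hi) (hE.symm g)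
  have hv : ¬ OnCap hi v := by
    rintro (rfl | rfl)
    · exact hA (hE.refl _)
    · exact hB (hE.refl _)
  have hr := reachable_mulElem_iff_of_not hi hv hA hB
  refine ⟨v, by simp only [hr], fun u hu => h1 u ((hr _).1 hu), ?_⟩
  rw [heightAt_mulElem_of_not hi hv hA hB, h2]

theorem loopSets_mulElem_of_not {k : ℕ} {S : Set (Node3 N)} {v : Node3 N}
    (hS : S = {w | (concatGraph C (D.mulElem i hi)).Reachable w v})
    (h1 : ∀ u, ¬ (concatGraph C (D.mulElem i hi)).Reachable (inOuter u) v)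
    (h2 : heightAt C (D.mulElem i hi) v = k)
    (hA : ¬ (concatGraph C D).Reachable v (inSnd (hiNode i hi)))
    (hB : ¬ (concatGraph C D).Reachable v (inSnd (loNode i hi))) : S ∈ loopSets C D k := by
  have hE := reachable_equivalence C D
  have hv : ¬ OnCap hi v := by
    rintro (rfl | rfl)
    · exact hA (hE.refl _)
    · exact hB (hE.refl _)
  have hr := reachable_mulElem_iff_of_not hi hv hA hB
  refine ⟨v, by simp only [hS, hr], fun u hu => h1 u ((hr _).2 hu), ?_⟩
  rw [← heightAt_mulElem_of_not hi hv hA hB, h2]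

/-- Both sides count the loops of label `k` in the triple concatenation of `C`, `D` and `G i`,
bracketed in two ways. A loop closed by the cap is either already present in the product of `D` and
`G i`, or uses arcs of `C` and appears when `G i` is attached to `F`. -/
theorem loopCount_mulElem (h : IsComposition C D F) (k : ℕ) :
    loopCount C (D.mulElem i hi) k + D.loopAt i hi k = loopCount C D k + F.loopAt i hi k := by
  have hE := reachable_equivalence C D
  rw [loopCount_eq, loopCount_eq]
  by_cases hl : D.partner (hiNode i hi) = loNode i hi
  · have hF := h.loop hi hl
    have : loopSets C (D.mulElem i hi) k = loopSets C D k := by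
      refine Set.Subset.antisymm ?_ (loopSets_mulElem_subset hi)
      rintro S ⟨v, hS, h1, h2⟩
      have h1' := h1
      rw [concatGraph_mulElem_of_loop hi hl] at h1'
      exact loopSets_mulElem_of_not hi hS h1 h2 (fun g => h1' (hiNode i hi) (hE.symm g))
        (fun g => h1' (loNode i hi) (hE.symm g))
    rw [this, loopAt, loopAt, hF.2]
    simp only [hl, hF.1]
  have hD0 : D.loopAt i hi k = 0 := if_neg fun g => hl g.1
  rw [hD0, add_zero]
  have hv : ∀ v, (∀ u, ¬ (concatGraph C (D.mulElem i hi)).Reachable (inOuter u) v) →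
      ¬ OnCap hi v := by
    rintro v h1 (rfl | rfl)
    · exact h1 (hiNode i hi) (SimpleGraph.Reachable.refl _)
    · exact h1 (loNode i hi) (SimpleGraph.Reachable.refl _)
  by_cases hF : F.partner (hiNode i hi) = loNode i hi
  · have hF' := F.partner_eq_comm.1 hF
    have hAB := h.reachable_cap hi hF
    -- The loop closed by the cap: the old component through both cap nodes, with these two removed.
    let S₀ : Set (Node3 N) := {w | ¬ OnCap hi w ∧
      (concatGraph C D).Reachable w (inSnd (hiNode i hi))}
    have hP : ¬ OnCap hi (inSnd (D.partner (hiNode i hi))) := by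
      rw [onCap_inSnd]; exact not_or.2 ⟨D.partner_ne _, hl⟩
    have hrP := hE.symm (reachable_inSnd C D (hiNode i hi))
    have hclass : ∀ v, ¬ OnCap hi v → (concatGraph C D).Reachable v (inSnd (hiNode i hi)) →
        {w | (concatGraph C (D.mulElem i hi)).Reachable w v} = S₀ := by
      intro v hv hr
      ext w
      by_cases hw : OnCap hi w
      · refine iff_of_false (fun g => ?_) (fun g => g.1 hw)
        rcases reachable_mulElem_cases hi hl g with g | g
        · exact hv g.2
        · exact g.1 hw
      · simp only [Set.mem_ofPred_eq, S₀, hw, not_false_iff, true_and,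
          reachable_mulElem_iff hi hl hw hv, MergeRel]
        constructor
        · rintro (g | g | g)
          · exact hE.trans g hr
          · exact g.1
          · exact hE.trans g.1 (hE.symm hAB)
        · exact fun g => Or.inl (hE.trans g (hE.symm hr))
    have hheight : ∀ v, ¬ OnCap hi v → (concatGraph C D).Reachable v (inSnd (hiNode i hi)) →
        heightAt C (D.mulElem i hi) v = F.label (hiNode i hi) := by
      intro v hv hr
      rw [heightAt_mulElem_of_merge hi hl hv (Or.inl hr), ← heightAt_congr hAB, min_self, h.label_eq]
      rfl
    have hout : ∀ u, inOuter u ∉ S₀ := by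
      rintro u ⟨g1, g2⟩
      rw [inSnd_hiNode, h.reachable_iff, F.partner_eq_comm, hF] at g2
      exact g1 ((onCap_inOuter hi).2 (g2.imp id Eq.symm))
    have hset : loopSets C (D.mulElem i hi) k =
        if F.label (hiNode i hi) = k then insert S₀ (loopSets C D k) else loopSets C D k := by
      refine Set.Subset.antisymm ?_ ?_
      · rintro S ⟨v, hS, h1, h2⟩
        by_cases hA : (concatGraph C D).Reachable v (inSnd (hiNode i hi))
        · rw [← h2, hheight v (hv v h1) hA, if_pos rfl, hS, hclass v (hv v h1) hA]
          exact Set.mem_insert _ _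
        · have := loopSets_mulElem_of_not hi hS h1 h2 hA (fun g => hA (hE.trans g (hE.symm hAB)))
          split_ifs
          · exact Set.mem_insert_of_mem _ this
          · exact this
      · split_ifs with hk
        · refine Set.insert_subset ⟨inSnd (D.partner (hiNode i hi)), (hclass _ hP hrP).symm, ?_, ?_⟩
            (loopSets_mulElem_subset hi)
          · intro u hu
            apply hout u
            rw [← hclass _ hP hrP]
            exact hu
          · rw [hheight _ hP hrP, hk]
        · exact loopSets_mulElem_subset hi
    have hS₀ : S₀ ∉ loopSets C D k := by
      rintro ⟨v, hS, h1, -⟩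
      have : inSnd (D.partner (hiNode i hi)) ∈ S₀ := ⟨hP, hrP⟩
      rw [hS] at this
      exact h1 (hiNode i hi) (hE.trans (hE.symm hrP) this)
    rw [hset, loopAt]
    by_cases hk : F.label (hiNode i hi) = k
    · rw [if_pos hk, if_pos ⟨hF, hk⟩, Set.ncard_insert_of_notMem hS₀ (Set.toFinite _)]
    · rw [if_neg hk, if_neg (fun g => hk g.2), add_zero]
  · have hF0 : F.loopAt i hi k = 0 := if_neg fun g => hF g.1
    rw [hF0, add_zero]
    congr 1
    refine Set.Subset.antisymm ?_ (loopSets_mulElem_subset hi)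
    rintro S ⟨v, hS, h1, h2⟩
    have hF' : F.partner (loNode i hi) ≠ hiNode i hi := fun e => hF (F.partner_eq_comm.1 e)
    refine loopSets_mulElem_of_not hi hS h1 h2 (fun g => ?_) (fun g => ?_)
    -- A component attached to one end of the cap contains the partner of that end in `F`, an outer
    -- node off the cap, so it cannot become a loop.
    · refine h1 (F.partner (hiNode i hi)) ((reachable_mulElem_iff hi hl ?_ (hv v h1)).2 (Or.inl ?_))
      · rw [onCap_inOuter]; exact not_or.2 ⟨F.partner_ne _, hF⟩
      · refine hE.trans ?_ (hE.symm g)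
        rw [inSnd_hiNode, h.reachable_iff]
        exact Or.inr (F.partner_partner _)
    · refine h1 (F.partner (loNode i hi)) ((reachable_mulElem_iff hi hl ?_ (hv v h1)).2 (Or.inl ?_))
      · rw [onCap_inOuter]; exact not_or.2 ⟨hF', F.partner_ne _⟩
      · refine hE.trans ?_ (hE.symm g)
        rw [inSnd_loNode, h.reachable_iff]
        exact Or.inr (F.partner_partner _)

end Concat

/-! ### Composition with the identity diagram -/

section Identity

open OkadaDiagram

variable {N : ℕ}

/-- Retraction of the concatenation with an identity diagram to the nodes of the first diagram. -/
def retract : Node3 N → Node N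
  | Sum.inl a => Sum.inl a
  | Sum.inr (Sum.inl a) => Sum.inr a
  | Sum.inr (Sum.inr a) => Sum.inr a

theorem retract_inFst (u : Node N) : retract (inFst u) = u := by rcases u with u | u <;> rfl

theorem retract_inOuter (u : Node N) : retract (inOuter u) = u := by rcases u with u | u <;> rfl

/-- The arcs of the identity diagram join exactly the middle and right vertices that `retract`
identifies, so only the arcs of `C` remain. -/
theorem reachable_id_iff (C : OkadaDiagram N) {p q : Node3 N} :
    (concatGraph C (OkadaDiagram.id N)).Reachable p q ↔
      retract p = retract q ∨ C.partner (retract p) = retract q := by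
  have hE := reachable_equivalence C (OkadaDiagram.id N)
  constructor
  · refine reachable_le (R := fun p q => retract p = retract q ∨ C.partner (retract p) = retract q)
      ⟨fun _ => Or.inl rfl, ?_, ?_⟩ ?_ ?_
    · rintro p q (h | h)
      · exact Or.inl h.symm
      · exact Or.inr (C.partner_eq_comm.1 h)
    · rintro p q r (h | h) (g | g)
      · exact Or.inl (h.trans g)
      · exact Or.inr (by rw [h, g])
      · exact Or.inr (h.trans g)
      · exact Or.inl (by rw [← g, ← h, C.partner_partner])
    · intro u
      exact Or.inr (by rw [retract_inFst, retract_inFst])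
    · rintro (u | u) <;> exact Or.inl rfl
  · have key : ∀ p : Node3 N,
        (concatGraph C (OkadaDiagram.id N)).Reachable p (inFst (retract p)) := by
      rintro (a | a | a)
      · exact hE.refl _
      · exact hE.refl _
      · exact reachable_inSnd C (OkadaDiagram.id N) (Sum.inr a)
    rintro (h | h)
    · exact hE.trans (key p) (by rw [h]; exact hE.symm (key q))
    · exact hE.trans (key p) (hE.trans (reachable_inFst _ _ _) (by rw [h]; exact hE.symm (key q)))

theorem isComposition_id (C : OkadaDiagram N) : IsComposition C (OkadaDiagram.id N) C := by
  constructor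
  · intro u v huv
    rw [reachable_id_iff, retract_inOuter, retract_inOuter]
    simp [huv]
  · intro u
    change _ = heightAt C (OkadaDiagram.id N) _
    refine eq_of_forall_le_iff fun t => ?_
    simp only [le_heightAt, reachable_id_iff, retract_inFst, retract_inOuter]
    constructor
    · intro h
      have key : ∀ v, v = u ∨ C.partner v = u → t ≤ C.label v := by
        rintro v (rfl | rfl)
        · exact h
        · rwa [C.label_partner] at h
      refine ⟨key, fun v hv => ?_⟩
      -- An identity arc is labelled by its level, which is at least the label of `C` there, so it
      -- never lowers the minimum.
      have hl : (OkadaDiagram.id N).label v = (retract (inSnd v)).level := by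
        rcases v with v | v <;> rfl
      rw [hl]
      exact (key _ hv).trans (C.label_le_level _)
    · exact fun h => h.1 u (Or.inl rfl)

theorem loopCount_id (C : OkadaDiagram N) (k : ℕ) : loopCount C (OkadaDiagram.id N) k = 0 := by
  have : loopSets C (OkadaDiagram.id N) k = ∅ := by
    rw [Set.eq_empty_iff_forall_notMem]
    rintro S ⟨v, -, h, -⟩
    exact h (retract v) (by rw [reachable_id_iff, retract_inOuter]; exact Or.inl rfl)
  rw [loopCount_eq, this, Set.ncard_empty]

theorem loopAt_id {i : ℕ} (hi : 1 ≤ i ∧ i < N) (k : ℕ) : (OkadaDiagram.id N).loopAt i hi k = 0 := by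
  refine if_neg fun h => ?_
  simp [OkadaDiagram.id, hiNode, loNode, Node.mirror] at h

theorem isComposition_elem (C : OkadaDiagram N) {i : ℕ} (hi : 1 ≤ i ∧ i < N) :
    IsComposition C (elem i hi) (C.mulElem i hi) := by
  rw [← mulElem_id]; exact (isComposition_id C).mulElem hi

theorem loopCount_elem (C : OkadaDiagram N) {i : ℕ} (hi : 1 ≤ i ∧ i < N) (k : ℕ) :
    loopCount C (elem i hi) k = C.loopAt i hi k := by
  have := loopCount_mulElem hi (isComposition_id C) k
  rwa [mulElem_id, loopAt_id, loopCount_id, zero_add, add_zero] at this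

end Identity

/-! ### Box counts and the exponents of the parameters y -/

section Boxes

open OkadaDiagram

variable {N : ℕ}

theorem even_card_of_involution {α : Type*} [DecidableEq α] (s : Finset α) (f : α → α)
    (h1 : ∀ a, f (f a) = a) (h2 : ∀ a, f a ≠ a) (h3 : ∀ a ∈ s, f a ∈ s) : s.card % 2 = 0 := by
  have hz : ∑ _u ∈ s, (1 : ZMod 2) = 0 :=
    Finset.sum_involution (fun u _ => f u) (fun _ _ => by decide) (fun u _ _ => h2 u)
      (fun u hu => h3 u hu) (fun u _ => h1 u)
  rw [Finset.sum_const, nsmul_one, ZMod.natCast_eq_zero_iff] at hz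
  omega

/-- Twice the number of boxes of `D` in row `k`. -/
def passages (D : OkadaDiagram N) (k : ℕ) : ℕ :=
  (Finset.univ.filter fun u : Node N => D.label u ≤ k ∧ k < u.level).card

/-- Labels never exceed levels, so `passages` counts the nodes of level above `k` minus the nodes of
label above `k`. The mirror map and the matching are fixed-point free involutions of these two sets;
hence the halving in `boxCount` is exact. -/
theorem two_mul_boxCount (D : OkadaDiagram N) (k : ℕ) : 2 * boxCount D k = passages D k := by
  have h1 := even_card_of_involution (Finset.univ.filter fun u : Node N => k < u.level)
    Node.mirror Node.mirror_mirror (OkadaDiagram.id N).partner_ne (fun u hu => by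
      simpa [Node.level_mirror] using hu)
  have h2 := even_card_of_involution (Finset.univ.filter fun u : Node N => k < D.label u)
    D.partner D.partner_partner D.partner_ne (fun u hu => by simpa [D.label_partner] using hu)
  have h3 : passages D k + (Finset.univ.filter fun u : Node N => k < D.label u).card =
      (Finset.univ.filter fun u : Node N => k < u.level).card := by
    unfold passages
    rw [← Finset.card_union_of_disjoint]
    · congr 1
      ext u
      have := D.label_le_level u
      simp only [Finset.mem_union, Finset.mem_filter, Finset.mem_univ, true_and]
      omega
    · rw [Finset.disjoint_filter]
      intro u _ h
      omega
  have h4 : boxCount D k = passages D k / 2 := rfl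
  omega

theorem passages_eq_sum (D : OkadaDiagram N) (k : ℕ) :
    passages D k = ∑ u : Node N, if D.label u ≤ k ∧ k < u.level then 1 else 0 := by
  unfold passages; rw [Finset.card_filter]

theorem passages_id (k : ℕ) : passages (OkadaDiagram.id N) k = 0 := by
  unfold passages
  rw [Finset.card_eq_zero, Finset.filter_eq_empty_iff]
  intro u _ h
  simp only [OkadaDiagram.id] at h
  omega

theorem sum_add_sum_eq {α : Type*} [Fintype α] [DecidableEq α] (s : Finset α) (f g : α → ℕ)
    (h : ∀ a, a ∉ s → f a = g a) : ∑ a, f a + ∑ a ∈ s, g a = ∑ a, g a + ∑ a ∈ s, f a := by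
  rw [← Finset.sum_sdiff (Finset.subset_univ s), ← Finset.sum_sdiff (f := g) (Finset.subset_univ s),
    Finset.sum_congr rfl fun a ha => h a (Finset.mem_sdiff.1 ha).2]
  ring

variable {i : ℕ} (hi : 1 ≤ i ∧ i < N)

/-- The lowest row in which the rewriting of the composition of `D` and `G i` loses a box, other
than the one lost with a loop. -/
def dropRow (D : OkadaDiagram N) : ℕ :=
  if D.partner (hiNode i hi) = loNode i hi then D.label (hiNode i hi) + 1
  else max (D.label (hiNode i hi)) (D.label (loNode i hi))

theorem level_hiNode : (hiNode i hi).level = i + 1 := rfl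

theorem level_loNode : (loNode i hi).level = i := by
  simp only [loNode, Node.level]; omega

theorem label_hiNode_le (D : OkadaDiagram N) : D.label (hiNode i hi) ≤ i + 1 := D.label_le_level _

theorem label_loNode_le (D : OkadaDiagram N) : D.label (loNode i hi) ≤ i :=
  (D.label_le_level _).trans (level_loNode hi).le

theorem label_hiNode_of_loop {D : OkadaDiagram N} (hl : D.partner (hiNode i hi) = loNode i hi) :
    D.label (hiNode i hi) ≤ i ∧ D.label (hiNode i hi) % 2 = i % 2 := by
  have h1 := D.label_le (hiNode i hi)
  have h2 := D.label_parity (hiNode i hi)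
  rw [hl, level_hiNode, level_loNode] at h1 h2
  rw [h2]
  omega

/-- The parity says that the interval of rows from `dropRow` to `i` has even length, so that the
boxes lost in it can be paired. -/
theorem dropRow_spec (D : OkadaDiagram N) :
    1 ≤ dropRow hi D ∧ dropRow hi D ≤ i + 1 ∧ dropRow hi D % 2 = (i + 1) % 2 := by
  unfold dropRow
  split_ifs with hl
  · have := label_hiNode_of_loop hi hl
    omega
  · have h1 := label_hiNode_le hi D
    have h2 := label_loNode_le hi D
    have h3 := D.one_le_label (hiNode i hi)
    have h4 := D.isPosData.join_label_parity (fun _ hk => D.p_parity hk) hi.1 hi.2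
      (show 2 * N - 1 - i + i + 1 = 2 * N by omega)
      (by rw [← pos_loNode hi, ← pos_hiNode hi, p_pos]
          exact fun e => hl (Node.pos_injective e))
    rw [← pos_loNode hi, ← pos_hiNode hi, l_pos, l_pos] at h4
    omega

/-- The indicator of the rows from `a` to `b - 1`. -/
def rows (k a b : ℕ) : ℕ := if a ≤ k ∧ k < b then 1 else 0

theorem rows_add {k a b c : ℕ} (h1 : a ≤ b) (h2 : b ≤ c) : rows k a b + rows k b c = rows k a c := by
  unfold rows; split_ifs <;> omega

theorem rows_self (k a : ℕ) : rows k a a = 0 := by unfold rows; split_ifs <;> omega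

/-- Here `x`, `y` are the labels at the cap nodes of levels `i + 1`, `i`, and `p`, `q` are the
levels of their partners. Each arc descends from one end to its label and climbs to the other end.
Telescoping shows that merging removes the part between the larger label and level `i + 1`,
traversed twice, while `G i` contributes its own box in row `i`. -/
theorem rows_merge {X Y k i x y p q : ℕ} (hx : x ≤ i + 1) (hy : y ≤ i) (hp : x ≤ p) (hq : y ≤ q)
    (h : X + (rows k i (i + 1) + (rows k i i + (rows k (min x y) p + rows k (min x y) q))) =
      Y + (rows k x (i + 1) + (rows k y i + (rows k x p + rows k y q)))) :
    X + 2 * rows k i (i + 1) = Y + 2 * rows k (max x y) (i + 1) := by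
  have h0 := rows_self k i
  have h1 := rows_add (k := k) hy (Nat.le_add_right i 1)
  rcases le_total x y with g | g
  · rw [min_eq_left g] at h
    rw [max_eq_right g]
    have h2 := rows_add (k := k) g hq
    have h3 := rows_add (k := k) g (hy.trans (Nat.le_add_right i 1))
    omega
  · rw [min_eq_right g] at h
    rw [max_eq_left g]
    have h2 := rows_add (k := k) g hp
    have h3 := rows_add (k := k) g hx
    omega

/-- The factor `G i` brings one box, in row `i`. One box disappears in the row of the loop, if there
is one, and one in each row from `dropRow` to `i`. Only the cap nodes and their partners change
their contribution. -/
theorem passages_mulElem (D : OkadaDiagram N) (k : ℕ) :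
    passages D k + (if k = i then 2 else 0) = passages (D.mulElem i hi) k + 2 * D.loopAt i hi k +
      (if dropRow hi D ≤ k ∧ k ≤ i then 2 else 0) := by
  classical
  have hne := hiNode_ne_loNode hi
  have hA := label_hiNode_le hi D
  have hB := label_loNode_le hi D
  have lA := level_hiNode hi
  have lB := level_loNode hi
  rw [passages_eq_sum, passages_eq_sum]
  by_cases hl : D.partner (hiNode i hi) = loNode i hi
  · have h := sum_add_sum_eq {hiNode i hi, loNode i hi}
      (fun u => if D.label u ≤ k ∧ k < u.level then 1 else 0)
      (fun u => if (D.mulElem i hi).label u ≤ k ∧ k < u.level then 1 else 0) (fun u hu => by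
        simp only [Finset.mem_insert, Finset.mem_singleton] at hu
        have hu' : ¬ (u = D.partner (hiNode i hi) ∨ u = D.partner (loNode i hi)) := by
          rw [hl, D.partner_eq_comm.1 hl]
          exact fun g => hu g.symm
        rw [mulElem_label, if_neg hu, if_neg hu'])
    have hlab : D.label (loNode i hi) = D.label (hiNode i hi) := by rw [← hl, D.label_partner]
    have hle := (label_hiNode_of_loop hi hl).1
    rw [Finset.sum_pair hne, Finset.sum_pair hne] at h
    have e3 := D.mulElem_label hi (hiNode i hi)
    rw [if_pos (Or.inl rfl)] at e3
    have e4 := D.mulElem_label hi (loNode i hi)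
    rw [if_pos (Or.inr rfl)] at e4
    simp only [e3, e4, lA, lB, hlab] at h
    have e6 : dropRow hi D = D.label (hiNode i hi) + 1 := if_pos hl
    have e7 : D.loopAt i hi k = if D.label (hiNode i hi) = k then 1 else 0 := by
      simp only [loopAt, hl, true_and]
    rw [e6, e7]
    clear e3 e4 hlab
    generalize (∑ u, if D.label u ≤ k ∧ k < u.level then 1 else 0) = X at *
    generalize (∑ u, if (D.mulElem i hi).label u ≤ k ∧ k < u.level then 1 else 0) = Y at *
    generalize D.label (hiNode i hi) = x at *
    clear hl
    split_ifs at * <;> omega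
  · have hl' : D.partner (loNode i hi) ≠ hiNode i hi := fun e => hl (D.partner_eq_comm.1 e)
    have hpq : D.partner (hiNode i hi) ≠ D.partner (loNode i hi) := fun e =>
      hne (D.partner_inj.1 e)
    have hP := (D.label_partner (hiNode i hi)).symm.le.trans (D.label_le_level _)
    have hQ := (D.label_partner (loNode i hi)).symm.le.trans (D.label_le_level _)
    have h := sum_add_sum_eq {hiNode i hi, loNode i hi, D.partner (hiNode i hi),
        D.partner (loNode i hi)}
      (fun u => if D.label u ≤ k ∧ k < u.level then 1 else 0)
      (fun u => if (D.mulElem i hi).label u ≤ k ∧ k < u.level then 1 else 0) (fun u hu => by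
        simp only [Finset.mem_insert, Finset.mem_singleton, not_or] at hu
        rw [mulElem_label, if_neg (not_or.2 ⟨hu.1, hu.2.1⟩), if_neg (not_or.2 hu.2.2)])
    have n1 : hiNode i hi ∉ ({loNode i hi, D.partner (hiNode i hi), D.partner (loNode i hi)} :
        Finset (Node N)) := by
      simp only [Finset.mem_insert, Finset.mem_singleton, not_or]
      exact ⟨hne, (D.partner_ne _).symm, hl'.symm⟩
    have n2 : loNode i hi ∉ ({D.partner (hiNode i hi), D.partner (loNode i hi)} :
        Finset (Node N)) := by
      simp only [Finset.mem_insert, Finset.mem_singleton, not_or]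
      exact ⟨fun e => hl e.symm, (D.partner_ne _).symm⟩
    rw [Finset.sum_insert n1, Finset.sum_insert n2, Finset.sum_pair hpq,
      Finset.sum_insert n1, Finset.sum_insert n2, Finset.sum_pair hpq] at h
    have e1 := D.mulElem_label hi (D.partner (hiNode i hi))
    rw [if_neg (not_or.2 ⟨D.partner_ne _, hl⟩), if_pos (Or.inl rfl)] at e1
    have e2 := D.mulElem_label hi (D.partner (loNode i hi))
    rw [if_neg (not_or.2 ⟨hl', D.partner_ne _⟩), if_pos (Or.inr rfl)] at e2
    have e3 := D.mulElem_label hi (hiNode i hi)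
    rw [if_pos (Or.inl rfl)] at e3
    have e4 := D.mulElem_label hi (loNode i hi)
    rw [if_pos (Or.inr rfl)] at e4
    have e5 := (dropRow_spec hi D).2.1
    have e6 : dropRow hi D = max (D.label (hiNode i hi)) (D.label (loNode i hi)) := if_neg hl
    have e7 : D.loopAt i hi k = 0 := if_neg fun g => hl g.1
    simp only [e1, e2, e3, e4, lA, lB, D.label_partner] at h
    have h7 := rows_merge hA hB hP hQ h.symm.symm
    rw [e6, e7]
    rw [e6] at e5
    generalize max (D.label (hiNode i hi)) (D.label (loNode i hi)) = m at *
    clear h e1 e2 e3 e4 hl hl' hpq hne e6 e7 n1 n2 hA hB hP hQ lA lB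
    unfold rows at h7
    split_ifs at * <;> omega

/-- The exponents of the parameters `y k` in the product of `D` and `G i`. -/
def elemExp (D : OkadaDiagram N) (k : ℕ) : ℕ :=
  if dropRow hi D ≤ k ∧ k < i ∧ (k + dropRow hi D) % 2 = 0 then 1 else 0

theorem elemExp_zero (D : OkadaDiagram N) : elemExp hi D 0 = 0 := by
  have := dropRow_spec hi D
  refine if_neg fun h => ?_
  omega

/-- The rows from `dropRow` to `i` are paired from the bottom as (d, d+1), (d+2, d+3), …; a pair
gives the factor y of its lower row and costs one box in each of its rows. -/
theorem elemExp_succ (D : OkadaDiagram N) (k : ℕ) : elemExp hi D (k + 1) + elemExp hi D k =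
    if dropRow hi D ≤ k + 1 ∧ k + 1 ≤ i then 1 else 0 := by
  have := dropRow_spec hi D
  unfold elemExp
  split_ifs <;> omega

/-- `M k` is the exponent of `y k` in the product of `C` and `D`, whose composition is `F`. -/
def IsYExp (C D F : OkadaDiagram N) (M : ℕ → ℕ) : Prop :=
  M 0 = 0 ∧ ∀ k, passages C (k + 1) + passages D (k + 1) = passages F (k + 1) +
    2 * loopCount C D (k + 1) + 2 * M (k + 1) + 2 * M k

/-- The defining recursion uses truncated subtraction. A solution of the additive equations shows
that nothing is truncated, and these equations determine the exponents from the bottom row upwards.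
-/
theorem IsYExp.yCount_eq {C D F : OkadaDiagram N} {M : ℕ → ℕ} (h : IsYExp C D F M) (k : ℕ) :
    yCount C D F k = M k := by
  induction k with
  | zero => rw [h.1]; rfl
  | succ k ih =>
    have h1 := h.2 k
    simp only [← two_mul_boxCount] at h1
    rw [yCount, ih]
    omega

theorem isYExp_id (C : OkadaDiagram N) : IsYExp C (OkadaDiagram.id N) C fun _ => 0 :=
  ⟨rfl, fun k => by simp [passages_id, loopCount_id]⟩

theorem passages_elem (k : ℕ) : passages (elem i hi) k = if k = i then 2 else 0 := by
  have h := passages_mulElem hi (OkadaDiagram.id N) k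
  rw [passages_id, loopAt_id, mulElem_id] at h
  have hd : dropRow hi (OkadaDiagram.id N) = i + 1 := by
    have h1 : ¬ (OkadaDiagram.id N).partner (hiNode i hi) = loNode i hi := by
      simp [OkadaDiagram.id, hiNode, loNode, Node.mirror]
    rw [dropRow, if_neg h1]
    have h2 : (OkadaDiagram.id N).label (hiNode i hi) = i + 1 := rfl
    have h3 := label_loNode_le hi (OkadaDiagram.id N)
    omega
  rw [hd, if_neg (c := i + 1 ≤ k ∧ k ≤ i) (by omega)] at h
  omega

theorem isYExp_elem (C : OkadaDiagram N) :
    IsYExp C (elem i hi) (C.mulElem i hi) (elemExp hi C) := by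
  refine ⟨elemExp_zero hi C, fun k => ?_⟩
  have h1 := passages_mulElem hi C (k + 1)
  have h2 := elemExp_succ hi C k
  rw [passages_elem, loopCount_elem]
  split_ifs at * <;> omega

/-- The additivity of the exponents of the parameters `y k`. -/
theorem IsYExp.mulElem {C D F : OkadaDiagram N} {M M' : ℕ → ℕ} (hF : IsComposition C D F)
    (h : IsYExp C D F M) (h0 : M' 0 = 0) (hM : ∀ k, M' k + elemExp hi D k = M k + elemExp hi F k) :
    IsYExp C (D.mulElem i hi) (F.mulElem i hi) M' := by
  refine ⟨h0, fun k => ?_⟩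
  have h1 := passages_mulElem hi D (k + 1)
  have h2 := passages_mulElem hi F (k + 1)
  have h3 := elemExp_succ hi D k
  have h4 := elemExp_succ hi F k
  have h5 := loopCount_mulElem hi hF (k + 1)
  have h6 := h.2 k
  have h7 := hM (k + 1)
  have h8 := hM k
  split_ifs at * <;> omega

/-- This is the cocycle identity that makes the y-factors associative. With both families of
exponents given, the box counts force it row by row, beginning with row 0, where all exponents
vanish. -/
theorem elemExp_add {C D F : OkadaDiagram N} {M M' : ℕ → ℕ} (hF : IsComposition C D F)
    (h : IsYExp C D F M) (h' : IsYExp C (D.mulElem i hi) (F.mulElem i hi) M') (k : ℕ) :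
    M' k + elemExp hi D k = M k + elemExp hi F k := by
  induction k with
  | zero => rw [h.1, h'.1, elemExp_zero, elemExp_zero]
  | succ k ih =>
    have h1 := passages_mulElem hi D (k + 1)
    have h2 := passages_mulElem hi F (k + 1)
    have h3 := elemExp_succ hi D k
    have h4 := elemExp_succ hi F k
    have h5 := loopCount_mulElem hi hF (k + 1)
    have h6 := h.2 k
    have h7 := h'.2 k
    split_ifs at * <;> omega

end Boxes

/-! ### Insertion of an arc on the right side -/

namespace OkadaDiagram

variable {M : ℕ}

/-- The embedding of positions which skips `a` and `a + 1`. -/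
def skip (a k : ℕ) : ℕ := if k < a then k else k + 2

/-- The left inverse of `skip a`. -/
def unskip (a k : ℕ) : ℕ := if k < a then k else k - 2

theorem unskip_skip (a k : ℕ) : unskip a (skip a k) = k := by
  unfold skip unskip; split_ifs <;> omega

theorem skip_unskip {a k : ℕ} (h1 : k ≠ a) (h2 : k ≠ a + 1) : skip a (unskip a k) = k := by
  unfold skip unskip; split_ifs <;> omega

theorem skip_ne (a k : ℕ) : skip a k ≠ a ∧ skip a k ≠ a + 1 := by
  unfold skip; split_ifs <;> omega

theorem skip_lt_skip {a k m : ℕ} : skip a k < skip a m ↔ k < m := by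
  unfold skip; split_ifs <;> omega

theorem skip_inj {a k m : ℕ} : skip a k = skip a m ↔ k = m := by
  unfold skip; split_ifs <;> omega

theorem skip_mod (a k : ℕ) : skip a k % 2 = k % 2 := by
  unfold skip; split_ifs <;> omega

theorem skip_lt {a k : ℕ} (ha : a ≤ 2 * M) : skip a k < 2 * (M + 1) ↔ k < 2 * M := by
  unfold skip; split_ifs <;> omega

theorem unskip_lt {a k : ℕ} (h1 : k ≠ a) (h2 : k ≠ a + 1) (ha : a ≤ 2 * M)
    (hk : k < 2 * (M + 1)) : unskip a k < 2 * M := by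
  rw [← skip_lt ha, skip_unskip h1 h2]; exact hk

theorem btw_skip {a u v y : ℕ} : Btw (skip a u) (skip a v) (skip a y) ↔ Btw u v y := by
  unfold Btw; simp only [skip_lt_skip]

/-- The parity of the labels of the arc with ends at the positions `k` and `m`. -/
theorem min_level_mod {k m : ℕ} (hm : m < 2 * M) (hkm : k < m) (h : k % 2 ≠ m % 2) :
    min (min (k + 1) (2 * M - k)) (min (m + 1) (2 * M - m)) % 2 =
      if k < M then (k + 1) % 2 else m % 2 := by
  split_ifs with hk
  · rcases lt_or_ge m M with g | g
    · rw [min_eq_left (b := 2 * M - k) (by omega), min_eq_left (b := 2 * M - m) (by omega),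
        min_eq_left (by omega)]
    · rw [min_eq_left (b := 2 * M - k) (by omega), min_eq_right (a := m + 1) (by omega)]
      omega
  · rw [min_eq_right (a := k + 1) (by omega), min_eq_right (a := m + 1) (by omega),
      min_eq_right (by omega)]
    omega

theorem min_level_skip_aux {a k m : ℕ} (hM : M ≤ a) (ha : a ≤ 2 * M)
    (hm : m < 2 * M) (hkm : k < m) (h : k % 2 ≠ m % 2) :
    min (min (skip a k + 1) (2 * (M + 1) - skip a k))
      (min (skip a m + 1) (2 * (M + 1) - skip a m)) % 2 =
    min (min (k + 1) (2 * M - k)) (min (m + 1) (2 * M - m)) % 2 := by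
  rw [min_level_mod hm hkm h, min_level_mod ((skip_lt ha).2 hm) (skip_lt_skip.2 hkm)
    (by rwa [skip_mod, skip_mod]), skip_mod, Nat.add_mod, skip_mod, ← Nat.add_mod]
  unfold skip
  split_ifs <;> omega

/-- If `M < a`, position `M` passes from the right side to the left side and its level changes
parity. The parity required of labels is nevertheless preserved, because the two ends of an arc have
positions of opposite parity. -/
theorem min_level_skip {a k m : ℕ} (hM : M ≤ a) (ha : a ≤ 2 * M) (hk : k < 2 * M)
    (hm : m < 2 * M) (h : k % 2 ≠ m % 2) :
    min (min (skip a k + 1) (2 * (M + 1) - skip a k))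
      (min (skip a m + 1) (2 * (M + 1) - skip a m)) % 2 =
    min (min (k + 1) (2 * M - k)) (min (m + 1) (2 * M - m)) % 2 := by
  rcases lt_trichotomy k m with g | g | g
  · exact min_level_skip_aux hM ha hm g h
  · exact absurd (by rw [g]) h
  · rw [min_comm, min_level_skip_aux hM ha hk g h.symm, min_comm]

/-- The matching with an additional arc joining `a` and `a + 1`. -/
def insPartner (P : ℕ → ℕ) (a k : ℕ) : ℕ :=
  if k = a then a + 1 else if k = a + 1 then a else skip a (P (unskip a k))

/-- The labels after the insertion of an arc of label `s` joining `a` and `a + 1`. -/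
def insLabel (L : ℕ → ℕ) (a s k : ℕ) : ℕ := if k = a ∨ k = a + 1 then s else L (unskip a k)

theorem insPartner_left (P : ℕ → ℕ) (a : ℕ) : insPartner P a a = a + 1 := if_pos rfl

theorem insPartner_right (P : ℕ → ℕ) (a : ℕ) : insPartner P a (a + 1) = a := by
  simp [insPartner]

theorem insPartner_skip (P : ℕ → ℕ) (a k : ℕ) : insPartner P a (skip a k) = skip a (P k) := by
  simp [insPartner, skip_ne, unskip_skip]

theorem insLabel_left (L : ℕ → ℕ) (a s : ℕ) : insLabel L a s a = s := if_pos (Or.inl rfl)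

theorem insLabel_right (L : ℕ → ℕ) (a s : ℕ) : insLabel L a s (a + 1) = s := if_pos (Or.inr rfl)

theorem insLabel_skip (L : ℕ → ℕ) (a s k : ℕ) : insLabel L a s (skip a k) = L k := by
  simp [insLabel, skip_ne, unskip_skip]

/-- A position is one of the inserted ones or comes from one before the insertion. -/
theorem ins_cases {a : ℕ} (ha : a ≤ 2 * M) {Q : ℕ → Prop} (h1 : Q a) (h2 : Q (a + 1))
    (h3 : ∀ k < 2 * M, Q (skip a k)) : ∀ k < 2 * (M + 1), Q k := by
  intro k hk
  by_cases e1 : k = a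
  · rwa [e1]
  by_cases e2 : k = a + 1
  · rwa [e2]
  have := h3 _ (unskip_lt e1 e2 ha hk)
  rwa [skip_unskip e1 e2] at this

/-- As `M ≤ a`, the new arc lies on the right, or across the middle if `s = M + 1`. No old node
loses level, so the label bounds persist. -/
theorem IsPosData.insert {P L : ℕ → ℕ} (h : IsPosData M P L) (hp : ∀ k < 2 * M, P k % 2 ≠ k % 2)
    {a s : ℕ} (hs : 1 ≤ s) (hsM : s ≤ M + 1) (ha : a + s = 2 * M + 1) :
    IsPosData (M + 1) (insPartner P a) (insLabel L a s) := by
  have hM : M ≤ a := by omega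
  have ha2 : a ≤ 2 * M := by omega
  refine IsPosData.mk' (ins_cases ha2 ?_ ?_ ?_) (ins_cases ha2 ?_ ?_ ?_) (ins_cases ha2 ?_ ?_ ?_)
    (ins_cases ha2 ?_ ?_ fun x hx => ins_cases ha2 ?_ ?_ fun y hy => ?_) (ins_cases ha2 ?_ ?_ ?_)
    (ins_cases ha2 ?_ ?_ ?_) (ins_cases ha2 ?_ ?_ ?_) (ins_cases ha2 ?_ ?_ ?_)
    (ins_cases ha2 ?_ ?_ fun x hx => ins_cases ha2 ?_ ?_ fun y hy => ?_)
  · rw [insPartner_left]; omega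
  · rw [insPartner_right]; omega
  · intro k hk; rw [insPartner_skip, skip_lt ha2]; exact h.lt k hk
  · rw [insPartner_left]; omega
  · rw [insPartner_right]; omega
  · intro k hk; rw [insPartner_skip, ne_eq, skip_inj]; exact h.ne k hk
  · rw [insPartner_left, insPartner_right]
  · rw [insPartner_right, insPartner_left]
  · intro k hk; rw [insPartner_skip, insPartner_skip, h.invol k hk]
  · intro y _ _ _ hy
    rw [insPartner_left] at hy
    exact absurd hy not_btw_succ
  · intro y _ _ _ hy
    rw [insPartner_right] at hy
    exact absurd (Btw.comm.1 hy) not_btw_succ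
  · intro _ _
    rw [insPartner_left, insPartner_skip]
    exact (btw_succ_iff (skip_ne _ _).1 (skip_ne _ _).2 (skip_ne _ _).1 (skip_ne _ _).2).1
  · intro _ _
    rw [insPartner_right, insPartner_skip]
    exact (btw_succ_iff (skip_ne _ _).1 (skip_ne _ _).2 (skip_ne _ _).1 (skip_ne _ _).2).2
  · rw [insPartner_skip, insPartner_skip, btw_skip, btw_skip, ne_eq, skip_inj, ne_eq, skip_inj]
    exact fun h1 h2 => (h.btw hx hy h1 h2).1
  · rw [insPartner_left, insLabel_left, insLabel_right]
  · rw [insPartner_right, insLabel_left, insLabel_right]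
  · intro k hk; rw [insPartner_skip, insLabel_skip, insLabel_skip, h.label_partner k hk]
  · rwa [insLabel_left]
  · rwa [insLabel_right]
  · intro k hk; rw [insLabel_skip]; exact h.one_le k hk
  · rw [insLabel_left]; omega
  · rw [insLabel_right]; omega
  · intro k hk
    rw [insLabel_skip]
    have := h.le k hk
    unfold skip; split_ifs <;> omega
  · rw [insLabel_left, insPartner_left]; omega
  · rw [insLabel_right, insPartner_right]; omega
  · intro k hk
    rw [insLabel_skip, insPartner_skip, min_level_skip hM ha2 hk (h.lt k hk) (hp k hk).symm,
      h.parity k hk]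
  · intro y _ hy
    rw [insPartner_left] at hy
    exact absurd hy not_btw_succ
  · intro y _ hy
    rw [insPartner_right] at hy
    exact absurd (Btw.comm.1 hy) not_btw_succ
  -- An arc over the new one has an end to the right of `a + 1`, hence of level less than `s`, which
  -- forces its label below `s`.
  · have h1 := h.le x hx
    have h2 := h.le _ (h.lt x hx)
    rw [h.label_partner x hx] at h2
    rw [insPartner_skip, insLabel_skip, insLabel_left]
    unfold Btw skip
    split_ifs <;> omega
  · have h1 := h.le x hx
    have h2 := h.le _ (h.lt x hx)
    rw [h.label_partner x hx] at h2
    rw [insPartner_skip, insLabel_skip, insLabel_right]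
    unfold Btw skip
    split_ifs <;> omega
  · rw [insPartner_skip, insLabel_skip, insLabel_skip, btw_skip]
    exact h.btw_label hx hy

/-- The insertion of an arc of label `s` joining the right nodes of levels `s` and `s + 1` (or
the two nodes of level `s = M + 1`). The other arcs keep their labels and relative positions. -/
def insert (D : OkadaDiagram M) (s : ℕ) (hs : 1 ≤ s ∧ s ≤ M + 1) : OkadaDiagram (M + 1) :=
  ofPos (D.isPosData.insert (fun _ hk => D.p_parity hk) hs.1 hs.2
    (show 2 * M + 1 - s + s = 2 * M + 1 by omega))

theorem insert_p (D : OkadaDiagram M) {s : ℕ} (hs : 1 ≤ s ∧ s ≤ M + 1) {k : ℕ}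
    (hk : k < 2 * (M + 1)) : (D.insert s hs).p k = insPartner D.p (2 * M + 1 - s) k := p_ofPos _ hk

theorem insert_l (D : OkadaDiagram M) {s : ℕ} (hs : 1 ≤ s ∧ s ≤ M + 1) {k : ℕ}
    (hk : k < 2 * (M + 1)) : (D.insert s hs).l k = insLabel D.l (2 * M + 1 - s) s k := l_ofPos _ hk

theorem label_insert_hiNode (D : OkadaDiagram M) {s : ℕ} (hs : 1 ≤ s ∧ s < M + 1) :
    (D.insert (s + 1) ⟨by omega, hs.2⟩).label (hiNode s hs) = s + 1 := by
  rw [← l_pos, insert_l _ _ (Node.pos_lt _), pos_hiNode,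
    show 2 * (M + 1) - 1 - s = 2 * M + 1 - (s + 1) + 1 by omega, insLabel_right]

/-- Let the inserted arc of label `s + 1` join the positions c and c+1. The cap of `G s` joins c+1
and c+2, and c takes over the old arc at c+2. That arc keeps its label, which is at most `s`. So the
inserted arc moves one step outwards and its label drops to `s`. -/
theorem mulElem_insert (D : OkadaDiagram M) {s : ℕ} (hs : 1 ≤ s ∧ s < M + 1) :
    (D.insert (s + 1) ⟨by omega, hs.2⟩).mulElem s hs = D.insert s ⟨hs.1, hs.2.le⟩ := by
  have h := D.isPosData
  have e1 : 2 * (M + 1) - 1 - s = 2 * M + 1 - (s + 1) + 1 := by omega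
  have e2 : 2 * M + 1 - s = 2 * M + 1 - (s + 1) + 1 := by omega
  have hc : 2 * M + 1 - (s + 1) < 2 * M := by omega
  have hc1 : 2 * M - (2 * M + 1 - (s + 1)) = s := by omega
  have hlt : ∀ k < 2 * (M + 1), insPartner D.p (2 * M + 1 - (s + 1)) k < 2 * (M + 1) := fun k hk => by
    rw [← insert_p D (s := s + 1) ⟨by omega, hs.2⟩ hk]
    exact (isPosData _).lt k hk
  -- The node after the inserted arc is the image of the old position c under `skip`.
  have pc : insPartner D.p (2 * M + 1 - (s + 1)) (2 * M + 1 - (s + 1) + 1 + 1) =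
      skip (2 * M + 1 - (s + 1)) (D.p (2 * M + 1 - (s + 1))) := by
    rw [← insPartner_skip]; congr 1; simp [skip]
  have lc : insLabel D.l (2 * M + 1 - (s + 1)) (s + 1) (2 * M + 1 - (s + 1) + 1 + 1) =
      D.l (2 * M + 1 - (s + 1)) := by
    rw [← insLabel_skip D.l (2 * M + 1 - (s + 1)) (s + 1)]; congr 1; simp [skip]
  have hle := (h.le _ hc).2
  rw [hc1] at hle
  have hne := h.ne _ hc
  apply ext_pos
  · intro k hk
    rw [mulElem_p _ _ hk, insert_p _ _ hk, e1, e2]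
    have hj : ∀ {P : ℕ → ℕ} {x y : ℕ}, (x < 2 * (M + 1)) → (y < 2 * (M + 1)) →
        (∀ k < 2 * (M + 1), P k = insPartner D.p (2 * M + 1 - (s + 1)) k) →
        joinPartner P x y k = joinPartner (insPartner D.p (2 * M + 1 - (s + 1))) x y k := by
      intro P x y hx hy hP
      unfold joinPartner
      rw [hP x hx, hP y hy, hP k hk]
    rw [hj (by omega) (by omega) (fun k hk => insert_p D _ hk)]
    generalize 2 * M + 1 - (s + 1) = c at *
    unfold joinPartner
    rw [pc, insPartner_right]
    by_cases k1 : k = c + 1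
    · rw [if_pos k1, k1, insPartner_left]
    rw [if_neg k1]
    by_cases k2 : k = c + 1 + 1
    · rw [if_pos k2, k2, insPartner_right]
    rw [if_neg k2]
    have hsk : ∀ m, m ≠ c → skip c m = skip (c + 1) m := fun m hm => by
      unfold skip; split_ifs <;> omega
    by_cases k3 : k = c
    · rw [if_pos k3, k3, hsk _ hne, ← insPartner_skip]
      congr 1; simp [skip]
    rw [if_neg k3]
    obtain ⟨m, rfl⟩ : ∃ m, k = skip c m := ⟨_, (skip_unskip k3 k1).symm⟩
    have hm : m ≠ c := by
      rintro rfl; apply k2; simp [skip]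
    have hm2 : m < 2 * M := (skip_lt hc.le).1 hk
    simp only [insPartner_skip, skip_inj]
    rw [hsk m hm, insPartner_skip]
    by_cases k4 : m = D.p c
    · rw [if_pos k4, k4, h.invol _ hc]; simp [skip]
    · rw [if_neg k4, hsk]
      exact fun e => k4 (h.eq_of_partner_eq hm2 e)
  · intro k hk
    rw [mulElem_l _ _ hk, insert_l _ _ hk, e1, e2]
    have hj : ∀ {P L : ℕ → ℕ} {x y : ℕ}, (x < 2 * (M + 1)) → (y < 2 * (M + 1)) →
        (∀ k < 2 * (M + 1), P k = insPartner D.p (2 * M + 1 - (s + 1)) k) →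
        (∀ k < 2 * (M + 1), L k = insLabel D.l (2 * M + 1 - (s + 1)) (s + 1) k) →
        joinLabel P L x y s k = joinLabel (insPartner D.p (2 * M + 1 - (s + 1)))
          (insLabel D.l (2 * M + 1 - (s + 1)) (s + 1)) x y s k := by
      intro P L x y hx hy hP hL
      unfold joinLabel
      rw [hP x hx, hP y hy, hL x hx, hL y hy, hL k hk]
    rw [hj (by omega) (by omega) (fun k hk => insert_p D _ hk) (fun k hk => insert_l D _ hk)]
    generalize 2 * M + 1 - (s + 1) = c at *
    unfold joinLabel
    rw [pc, lc, insPartner_right, insLabel_right, min_eq_right (by omega)]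
    by_cases k1 : k = c + 1
    · rw [if_pos (Or.inl k1), k1, insLabel_left]
    by_cases k2 : k = c + 1 + 1
    · rw [if_pos (Or.inr k2), k2, insLabel_right]
    rw [if_neg (not_or.2 ⟨k1, k2⟩)]
    have hsk : ∀ m, m ≠ c → skip c m = skip (c + 1) m := fun m hm => by
      unfold skip; split_ifs <;> omega
    by_cases k3 : k = c
    · rw [if_pos (Or.inl k3), k3, ← insLabel_skip D.l (c + 1) s]
      congr 1; simp [skip]
    obtain ⟨m, rfl⟩ : ∃ m, k = skip c m := ⟨_, (skip_unskip k3 k1).symm⟩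
    have hm : m ≠ c := by
      rintro rfl; apply k2; simp [skip]
    have hm2 : m < 2 * M := (skip_lt hc.le).1 hk
    simp only [skip_inj, insLabel_skip, k3, false_or]
    rw [hsk m hm, insLabel_skip]
    split_ifs with k4
    · rw [k4, h.label_partner _ hc]
    · rfl

end OkadaDiagram

/-! ### Deletion of an arc and reduced words -/

namespace OkadaDiagram

variable {M : ℕ}

/-- The addition of a propagating arc of maximal label. -/
def extend (D : OkadaDiagram M) : OkadaDiagram (M + 1) := D.insert (M + 1) ⟨by omega, le_rfl⟩

theorem extend_p (D : OkadaDiagram M) {k : ℕ} (hk : k < 2 * (M + 1)) :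
    D.extend.p k = insPartner D.p M k := by
  rw [extend, insert_p _ _ hk, show 2 * M + 1 - (M + 1) = M by omega]

theorem extend_l (D : OkadaDiagram M) {k : ℕ} (hk : k < 2 * (M + 1)) :
    D.extend.l k = insLabel D.l M (M + 1) k := by
  rw [extend, insert_l _ _ hk, show 2 * M + 1 - (M + 1) = M by omega]

theorem extend_id : (OkadaDiagram.id M).extend = OkadaDiagram.id (M + 1) := by
  have hp : ∀ (n k : ℕ), k < 2 * n → (OkadaDiagram.id n).p k = 2 * n - 1 - k := fun n k hk => by
    rw [p, dif_pos hk]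
    have := Node.pos_mirror (posNode k hk)
    rw [pos_posNode] at this
    change (posNode k hk).mirror.pos = _
    omega
  have hl : ∀ (n k : ℕ), k < 2 * n → (OkadaDiagram.id n).l k = min (k + 1) (2 * n - k) :=
    fun n k hk => by
      rw [l, dif_pos hk]
      change (posNode k hk).level = _
      rw [Node.level_eq, pos_posNode]
  apply ext_pos
  · intro k hk
    rw [extend_p _ hk, hp _ _ hk]
    revert k
    refine ins_cases (a := M) (by omega) ?_ ?_ fun k hk => ?_
    · rw [insPartner_left]; omega
    · rw [insPartner_right]; omega
    · rw [insPartner_skip, hp _ _ hk]; unfold skip; split_ifs <;> omega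
  · intro k hk
    rw [extend_l _ hk, hl _ _ hk]
    revert k
    refine ins_cases (a := M) (by omega) ?_ ?_ fun k hk => ?_
    · rw [insLabel_left]; omega
    · rw [insLabel_right]; omega
    · rw [insLabel_skip, hl _ _ hk]; unfold skip; split_ifs <;> omega

theorem mulElem_extend (D : OkadaDiagram M) {i : ℕ} (hi : 1 ≤ i ∧ i < M) :
    D.extend.mulElem i ⟨hi.1, by omega⟩ = (D.mulElem i hi).extend := by
  have h := D.isPosData
  obtain ⟨a, ha, ha1, ha2, ha3⟩ : ∃ a, 2 * M - 1 - i = a ∧ a + 1 < 2 * M ∧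
      2 * (M + 1) - 1 - i = skip M a ∧ 2 * (M + 1) - 1 - i + 1 = skip M (a + 1) :=
    ⟨_, rfl, by omega, by unfold skip; split_ifs <;> omega, by unfold skip; split_ifs <;> omega⟩
  have hk' : ∀ {k}, k < 2 * M → skip M k < 2 * (M + 1) := fun hk => (skip_lt (by omega)).2 hk
  have p1 : ∀ k < 2 * M, D.extend.p (skip M k) = skip M (D.p k) := fun k hk => by
    rw [extend_p _ (hk' hk), insPartner_skip]
  have l1 : ∀ k < 2 * M, D.extend.l (skip M k) = D.l k := fun k hk => by
    rw [extend_l _ (hk' hk), insLabel_skip]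
  have hn := skip_ne M
  apply ext_pos
  · intro k hk
    rw [mulElem_p _ _ hk, extend_p _ hk, ha2, ← ha2, ha3, ha2]
    unfold joinPartner
    rw [p1 a (by omega), p1 _ ha1]
    revert k
    refine ins_cases (a := M) (by omega) ?_ ?_ fun k hk => ?_
    · rw [insPartner_left, extend_p _ (by omega), insPartner_left]
      simp only [fun k => (hn k).1.symm, if_false]
    · rw [insPartner_right, extend_p _ (by omega), insPartner_right]
      simp only [fun k => (hn k).2.symm, if_false]
    · rw [insPartner_skip, p1 k hk, mulElem_p _ _ hk, ha]
      unfold joinPartner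
      simp only [skip_inj]
      split_ifs <;> rfl
  · intro k hk
    rw [mulElem_l _ _ hk, extend_l _ hk, ha2, ← ha2, ha3, ha2]
    unfold joinLabel
    rw [p1 a (by omega), p1 _ ha1, l1 a (by omega), l1 _ ha1]
    revert k
    refine ins_cases (a := M) (by omega) ?_ ?_ fun k hk => ?_
    · rw [insLabel_left, extend_l _ (by omega), insLabel_left]
      simp only [fun k => (hn k).1.symm, if_false, false_or]
    · rw [insLabel_right, extend_l _ (by omega), insLabel_right]
      simp only [fun k => (hn k).2.symm, if_false, false_or]
    · rw [insLabel_skip, l1 k hk, mulElem_l _ _ hk, ha]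
      unfold joinLabel
      simp only [skip_inj]

theorem label_extend_hiNode (D : OkadaDiagram M) {i : ℕ} (hi : 1 ≤ i ∧ i < M) :
    D.extend.label (hiNode i ⟨hi.1, by omega⟩) = D.label (hiNode i hi) := by
  rw [← l_pos, extend_l _ (Node.pos_lt _), ← l_pos, pos_hiNode, pos_hiNode,
    ← insLabel_skip D.l M (M + 1)]
  congr 1
  unfold skip; split_ifs <;> omega

/-- The position `a` is joined to `a + 1` by an arc of maximal possible label `s`, and this is the
last such right node. -/
theorem exists_insert_pos (E : OkadaDiagram (M + 1)) : ∃ s, 1 ≤ s ∧ s ≤ M + 1 ∧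
    E.l (2 * (M + 1) - s) = s ∧ ∀ t, s < t → t ≤ M + 1 → E.l (2 * (M + 1) - t) < t := by
  have h := E.isPosData
  have h1 : E.l (2 * (M + 1) - 1) = 1 := by
    have := h.one_le (2 * (M + 1) - 1) (by omega)
    have := h.le (2 * (M + 1) - 1) (by omega)
    omega
  refine ⟨Nat.findGreatest (fun s => E.l (2 * (M + 1) - s) = s) (M + 1),
    Nat.le_findGreatest (by omega) h1, Nat.findGreatest_le _,
    Nat.findGreatest_spec (P := fun s => E.l (2 * (M + 1) - s) = s) (by omega : 1 ≤ M + 1) h1, ?_⟩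
  intro t ht ht2
  have := Nat.findGreatest_is_greatest ht ht2
  have := h.le (2 * (M + 1) - t) (by omega)
  omega

section Delete

variable {E : OkadaDiagram (M + 1)} {s a : ℕ}

/-- The partner of `a + 1` has level at least `s`, so it lies to the left. Were it not `a`, then `a`
would lie under this arc and have label above `s`, contrary to the maximality of `s` (or to the
label bound, if `s = M + 1`). -/
theorem delete_partner (hs : 1 ≤ s) (hsM : s ≤ M + 1) (ha : a + s = 2 * M + 1)
    (hl : E.l (a + 1) = s) (hmax : ∀ k, M + 1 ≤ k → k ≤ a → E.l k + k < 2 * (M + 1)) :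
    E.p (a + 1) = a := by
  have h := E.isPosData
  have hb : a + 1 < 2 * (M + 1) := by omega
  have hla : a < 2 * (M + 1) := by omega
  have h1 := h.le _ (h.lt _ hb)
  rw [h.label_partner _ hb, hl] at h1
  have h2 := h.ne _ hb
  have h3 := h.lt _ hb
  have h4 := h.btw_label hb hla
  have h5 := hmax a
  by_contra hne
  have h6 : ¬ Btw (a + 1) (E.p (a + 1)) a := fun g => by
    have := h4 g
    unfold Btw at g
    omega
  unfold Btw at h6
  omega

theorem delete_label_le (hs : 1 ≤ s) (hsM : s ≤ M + 1) (ha : a + s = 2 * M + 1)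
    (hl : E.l (a + 1) = s) (hmax : ∀ k, M + 1 ≤ k → k ≤ a → E.l k + k < 2 * (M + 1)) {k : ℕ}
    (hk : k < a) : E.l k + k ≤ 2 * M := by
  have h := E.isPosData
  have hpa := delete_partner hs hsM ha hl hmax
  have hkM : k < 2 * (M + 1) := by omega
  have h1 := h.le k hkM
  have h2 := h.lt k hkM
  have h3 := h.le _ h2
  rw [h.label_partner k hkM] at h3
  have h4 := h.ne k hkM
  have h5 := E.p_parity hkM
  rcases lt_trichotomy k M with g | g | g
  · omega
  · have h6 := hmax (k + 1)
    have h7 := h.label_partner k hkM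
    by_contra hcon
    have h8 : E.p k = k + 1 := by omega
    rw [h8] at h7
    omega
  · have h6 := hmax k
    by_contra hcon
    have h9 := h.parity k hkM
    rcases Nat.lt_or_gt_of_ne h4 with g2 | g2
    · rw [min_comm, min_level_mod hkM g2 h5] at h9
      split_ifs at h9 <;> omega
    · have h8 : E.p k = k + 1 := by omega
      have h7 := h.label_partner k hkM
      rw [h8] at h7
      have h10 := hmax (k + 1)
      have h11 : k + 1 ≠ a := by
        intro e
        rw [e] at h8
        have h12 := h.eq_of_partner_eq hkM h8
        have h13 := h.eq_of_partner_eq (by omega) hpa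
        omega
      omega

theorem delete_isPosData (hs : 1 ≤ s) (hsM : s ≤ M + 1) (ha : a + s = 2 * M + 1)
    (hl : E.l (a + 1) = s) (hmax : ∀ k, M + 1 ≤ k → k ≤ a → E.l k + k < 2 * (M + 1)) :
    IsPosData M (fun k => unskip a (E.p (skip a k))) (fun k => E.l (skip a k)) := by
  have h := E.isPosData
  have hpa := delete_partner hs hsM ha hl hmax
  have hM : M ≤ a := by omega
  have ha2 : a ≤ 2 * M := by omega
  have hlt : ∀ {k}, k < 2 * M → skip a k < 2 * (M + 1) := fun hk => (skip_lt ha2).2 hk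
  have hpa' := h.eq_of_partner_eq (by omega) hpa
  have hsp : ∀ k < 2 * M, skip a (unskip a (E.p (skip a k))) = E.p (skip a k) := fun k hk =>
    skip_unskip (fun e => (skip_ne a k).2 (by rw [h.eq_of_partner_eq (hlt hk) e, hpa']))
      (fun e => (skip_ne a k).1 (by rw [h.eq_of_partner_eq (hlt hk) e, hpa]))
  have hpar : ∀ k < 2 * M, k % 2 ≠ (unskip a (E.p (skip a k))) % 2 := fun k hk => by
    have := E.p_parity (hlt hk)
    rw [← hsp k hk, skip_mod, skip_mod] at this
    exact this.symm
  have hlt2 : ∀ k < 2 * M, unskip a (E.p (skip a k)) < 2 * M := fun k hk => by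
    rw [← skip_lt ha2, hsp k hk]; exact h.lt _ (hlt hk)
  refine IsPosData.mk' hlt2 ?_ ?_ ?_ ?_ ?_ ?_ ?_ ?_
  · intro k hk
    rw [ne_eq, ← skip_inj (a := a), hsp k hk]
    exact h.ne _ (hlt hk)
  · intro k hk
    rw [hsp k hk, h.invol _ (hlt hk), unskip_skip]
  · intro x hx y hy n1 n2
    rw [← btw_skip (a := a), ← btw_skip (a := a) (y := unskip _ _), hsp x hx, hsp y hy]
    refine (h.btw (hlt hx) (hlt hy) ?_ ?_).1
    · rwa [ne_eq, skip_inj]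
    · rwa [← hsp x hx, ne_eq, skip_inj]
  · intro k hk
    rw [hsp k hk, h.label_partner _ (hlt hk)]
  · intro k hk
    exact h.one_le _ (hlt hk)
  · intro k hk
    have h1 := h.le _ (hlt hk)
    by_cases hka : k < a
    · have h2 := delete_label_le hs hsM ha hl hmax hka
      simp only [skip, hka, if_true] at h1 ⊢
      omega
    · simp only [skip, hka, if_false] at h1 ⊢
      omega
  · intro k hk
    rw [← min_level_skip hM ha2 hk (hlt2 k hk) (hpar k hk), hsp k hk, h.parity _ (hlt hk)]
  · intro x hx y hy hxy
    rw [← btw_skip (a := a), hsp x hx] at hxy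
    exact h.btw_label (hlt hx) (hlt hy) hxy

end Delete

/-- Every diagram arises by an insertion. -/
theorem exists_eq_insert (E : OkadaDiagram (M + 1)) :
    ∃ (D : OkadaDiagram M) (s : ℕ) (hs : 1 ≤ s ∧ s ≤ M + 1), E = D.insert s hs := by
  obtain ⟨s, hs, hsM, hl, hmax⟩ := E.exists_insert_pos
  obtain ⟨a, ha⟩ : ∃ a, a + s = 2 * M + 1 := ⟨2 * M + 1 - s, by omega⟩
  have h := E.isPosData
  have hl' : E.l (a + 1) = s := by rw [show a + 1 = 2 * (M + 1) - s by omega]; exact hl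
  have hmax' : ∀ k, M + 1 ≤ k → k ≤ a → E.l k + k < 2 * (M + 1) := fun k h1 h2 => by
    have := hmax (2 * (M + 1) - k) (by omega) (by omega)
    rw [show 2 * (M + 1) - (2 * (M + 1) - k) = k by omega] at this
    omega
  have hpa := delete_partner hs hsM ha hl' hmax'
  have hpa' : E.p a = a + 1 := (h.eq_of_partner_eq (by omega) hpa).symm
  have ha2 : a ≤ 2 * M := by omega
  have hlt : ∀ {k}, k < 2 * M → skip a k < 2 * (M + 1) := fun hk => (skip_lt ha2).2 hk
  have hea : 2 * M + 1 - s = a := by omega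
  refine ⟨ofPos (delete_isPosData hs hsM ha hl' hmax'), s, ⟨hs, hsM⟩, ext_pos ?_ ?_⟩
  · intro k hk
    rw [insert_p _ _ hk, hea]
    revert k
    refine ins_cases ha2 ?_ ?_ fun k hk => ?_
    · rw [insPartner_left, hpa']
    · rw [insPartner_right, hpa]
    · rw [insPartner_skip, p_ofPos _ hk, skip_unskip]
      · exact fun e => (skip_ne a k).2 (by rw [h.eq_of_partner_eq (hlt hk) e, hpa'])
      · exact fun e => (skip_ne a k).1 (by rw [h.eq_of_partner_eq (hlt hk) e, hpa])
  · intro k hk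
    rw [insert_l _ _ hk, hea]
    revert k
    refine ins_cases ha2 ?_ ?_ fun k hk => ?_
    · rw [insLabel_left, ← hl', ← hpa', h.label_partner _ (by omega)]
    · rw [insLabel_right, hl']
    · rw [insLabel_skip, l_ofPos _ hk]

/-- `D` is the product of the elementary diagrams with indices in `w`, where no multiplication
produces a loop or a factor `y k`. -/
inductive Reduced (N : ℕ) : List ℕ → OkadaDiagram N → Prop
  | nil : Reduced N [] (OkadaDiagram.id N)
  | snoc (w : List ℕ) (D : OkadaDiagram N) (i : ℕ) (hi : 1 ≤ i ∧ i < N) :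
      Reduced N w D → D.label (hiNode i hi) = i + 1 → Reduced N (w ++ [i]) (D.mulElem i hi)

theorem Reduced.extend {w : List ℕ} {D : OkadaDiagram M} (h : Reduced M w D) :
    Reduced (M + 1) w D.extend := by
  induction h with
  | nil => rw [extend_id]; exact Reduced.nil
  | snoc w D i hi _ hl ih =>
    rw [← mulElem_extend]
    exact Reduced.snoc w _ i _ ih (by rw [label_extend_hiNode _ hi, hl])

/-- Begin with the new propagating arc in the middle; each letter of the descending run moves it one
step outwards. Before each step the inner cap node has maximal label, so the word stays reduced. -/
theorem Reduced.insert {w : List ℕ} {D : OkadaDiagram M} (h : Reduced M w D) (c : ℕ) (hc : c ≤ M) :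
    Reduced (M + 1) (w ++ (List.range c).map (fun k => M - k))
      (D.insert (M + 1 - c) ⟨by omega, by omega⟩) := by
  induction c with
  | zero => rw [List.range_zero, List.map_nil, List.append_nil]; exact h.extend
  | succ c ih =>
    have h1 := ih (by omega)
    have hs : 1 ≤ M - c ∧ M - c < M + 1 := by omega
    have e : M + 1 - c = M - c + 1 := by omega
    have e2 : M + 1 - (c + 1) = M - c := by omega
    simp only [e] at h1
    simp only [e2]
    rw [← mulElem_insert D hs, List.range_succ, List.map_append, ← List.append_assoc]
    exact Reduced.snoc _ _ _ _ h1 (label_insert_hiNode D hs)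

/-- Every diagram is a reduced product of elementary diagrams. -/
theorem exists_reduced {N : ℕ} (D : OkadaDiagram N) : ∃ w, Reduced N w D := by
  induction N with
  | zero =>
    have : D = OkadaDiagram.id 0 := ext_pos (fun k hk => by omega) (fun k hk => by omega)
    exact ⟨[], this ▸ Reduced.nil⟩
  | succ M ih =>
    obtain ⟨D', s, hs, rfl⟩ := D.exists_eq_insert
    obtain ⟨w, hw⟩ := ih D'
    have h := hw.insert (M + 1 - s) (by omega)
    simp only [show M + 1 - (M + 1 - s) = s by omega] at h
    exact ⟨_, h⟩

end OkadaDiagram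

section DiagramAlgebra

open OkadaDiagram

variable {K : Type*} [Field K] {N : ℕ}

/-! ### Composability -/

/-- The label `i + 1` is the largest possible at this node. It excludes a loop and makes the
interval of rows that lose boxes empty. -/
theorem OkadaDiagram.dropRow_of_label {D : OkadaDiagram N} {i : ℕ} (hi : 1 ≤ i ∧ i < N)
    (h : D.label (hiNode i hi) = i + 1) : dropRow hi D = i + 1 := by
  have h1 := dropRow_spec hi D
  unfold dropRow at h1 ⊢
  split_ifs at h1 ⊢ <;> omega

theorem OkadaDiagram.elemExp_of_label {D : OkadaDiagram N} {i : ℕ} (hi : 1 ≤ i ∧ i < N)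
    (h : D.label (hiNode i hi) = i + 1) (k : ℕ) : elemExp hi D k = 0 := by
  rw [elemExp, dropRow_of_label hi h, if_neg (by omega)]

theorem OkadaDiagram.loopAt_of_label {D : OkadaDiagram N} {i : ℕ} (hi : 1 ≤ i ∧ i < N)
    (h : D.label (hiNode i hi) = i + 1) (k : ℕ) : D.loopAt i hi k = 0 := by
  refine if_neg fun h1 => ?_
  have := label_hiNode_of_loop hi h1.1
  omega

/-- Induction on a reduced word of `D`. Reducedness makes `elemExp hi D` vanish, so the exponents
for the longer product are a sum, and no subtraction of naturals arises. -/
theorem exists_isComposition (C D : OkadaDiagram N) :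
    ∃ F M, IsComposition C D F ∧ IsYExp C D F M := by
  obtain ⟨w, hw⟩ := D.exists_reduced
  induction hw with
  | nil => exact ⟨C, _, isComposition_id C, isYExp_id C⟩
  | snoc w D i hi _ hl ih =>
    obtain ⟨F, M, hF, hM⟩ := ih
    refine ⟨F.mulElem i hi, fun k => M k + elemExp hi F k, hF.mulElem hi,
      hM.mulElem hi hF ?_ fun k => ?_⟩
    · rw [hM.1, elemExp_zero]
    · rw [elemExp_of_label hi hl, add_zero]

/-! ### The product of the diagram algebra -/

/-- The monomial with the exponents `l k` of `x k` and `m k` of `y k`. -/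
noncomputable def diagramCoeff (N : ℕ) (x y : ℕ → K) (l m : ℕ → ℕ) : K :=
  (∏ k ∈ Finset.Icc 1 (N - 1), x k ^ l k) * ∏ k ∈ Finset.Icc 1 (N - 2), y k ^ m k

variable (x y : ℕ → K)

theorem diagramCoeff_mul (l m l' m' : ℕ → ℕ) :
    diagramCoeff N x y l m * diagramCoeff N x y l' m' =
      diagramCoeff N x y (fun k => l k + l' k) (fun k => m k + m' k) := by
  simp only [diagramCoeff, pow_add, Finset.prod_mul_distrib]
  ring

theorem diagramCoeff_zero : diagramCoeff N x y (fun _ => 0) (fun _ => 0) = 1 := by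
  simp [diagramCoeff]

theorem diagramMul_eq {C D F : OkadaDiagram N} {M : ℕ → ℕ} (h : IsComposition C D F)
    (hM : IsYExp C D F M) :
    diagramMul x y C D = Finsupp.single F (diagramCoeff N x y (loopCount C D) M) := by
  have hex : ∃ E, IsComposition C D E := ⟨F, h⟩
  rw [diagramMul, dif_pos hex, hex.choose_spec.unique h]
  simp only [hM.yCount_eq, diagramCoeff]

theorem diagramMul_elem (C : OkadaDiagram N) {i : ℕ} (hi : 1 ≤ i ∧ i < N) :
    diagramMul x y C (elem i hi) = Finsupp.single (C.mulElem i hi)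
      (diagramCoeff N x y (C.loopAt i hi) (elemExp hi C)) := by
  rw [diagramMul_eq x y (isComposition_elem C hi) (isYExp_elem hi C)]
  congr 2
  exact funext fun k => loopCount_elem C hi k

/-- The product of the diagram algebra as a bilinear map. -/
noncomputable def OkArc.mulHom : OkArc K N →ₗ[K] OkArc K N →ₗ[K] OkArc K N :=
  Finsupp.linearCombination K fun C => Finsupp.linearCombination K fun D => diagramMul x y C D

theorem OkArc.mulHom_apply (v w : OkArc K N) : OkArc.mulHom x y v w = OkArc.mul x y v w := by
  simp only [OkArc.mulHom, OkArc.mul, Finsupp.linearCombination_apply, Finsupp.sum,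
    LinearMap.sum_apply, LinearMap.smul_apply, Finset.smul_sum, smul_smul]

theorem OkArc.mulHom_single (C D : OkadaDiagram N) (a b : K) :
    OkArc.mulHom x y (Finsupp.single C a) (Finsupp.single D b) = (a * b) • diagramMul x y C D := by
  simp only [OkArc.mulHom, Finsupp.linearCombination_single, LinearMap.smul_apply, smul_smul]

theorem OkArc.mulHom_id (v : OkArc K N) :
    OkArc.mulHom x y v (Finsupp.single (OkadaDiagram.id N) 1) = v := by
  suffices h : (OkArc.mulHom x y).flip (Finsupp.single (OkadaDiagram.id N) 1) = LinearMap.id from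
    LinearMap.congr_fun h v
  refine Finsupp.lhom_ext fun C a => ?_
  rw [LinearMap.flip_apply, OkArc.mulHom_single,
    diagramMul_eq x y (isComposition_id C) (isYExp_id C)]
  have : loopCount C (OkadaDiagram.id N) = fun _ => 0 := funext (loopCount_id C)
  rw [this, diagramCoeff_zero]
  simp

/-- The multiplication by `G i` on the right. -/
noncomputable def OkArc.mulElem (i : ℕ) (hi : 1 ≤ i ∧ i < N) : Module.End K (OkArc K N) :=
  (OkArc.mulHom x y).flip (Finsupp.single (elem i hi) 1)

theorem OkArc.mulElem_single {i : ℕ} (hi : 1 ≤ i ∧ i < N) (D : OkadaDiagram N) (a : K) :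
    OkArc.mulElem x y i hi (Finsupp.single D a) = Finsupp.single (D.mulElem i hi)
      (a * diagramCoeff N x y (D.loopAt i hi) (elemExp hi D)) := by
  rw [OkArc.mulElem, LinearMap.flip_apply, OkArc.mulHom_single, diagramMul_elem, mul_one,
    Finsupp.smul_single, smul_eq_mul]

theorem OkArc.mulElem_single_of_label {i : ℕ} (hi : 1 ≤ i ∧ i < N) {D : OkadaDiagram N}
    (h : D.label (hiNode i hi) = i + 1) (a : K) :
    OkArc.mulElem x y i hi (Finsupp.single D a) = Finsupp.single (D.mulElem i hi) a := by
  have h1 : D.loopAt i hi = fun _ => 0 := funext (loopAt_of_label hi h)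
  have h2 : elemExp hi D = fun _ => 0 := funext (elemExp_of_label hi h)
  rw [OkArc.mulElem_single, h1, h2, diagramCoeff_zero, mul_one]

/-- Associativity for products whose last factor is `G i`. It replaces general associativity in the
construction of Θ. -/
theorem OkArc.mulElem_mulHom {i : ℕ} (hi : 1 ≤ i ∧ i < N) (v w : OkArc K N) :
    OkArc.mulElem x y i hi (OkArc.mulHom x y v w) =
      OkArc.mulHom x y v (OkArc.mulElem x y i hi w) := by
  suffices h : (OkArc.mulHom x y).compr₂ (OkArc.mulElem x y i hi) =
      (OkArc.mulHom x y).compl₂ (OkArc.mulElem x y i hi) from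
    LinearMap.congr_fun (LinearMap.congr_fun h v) w
  refine Finsupp.lhom_ext fun C a => Finsupp.lhom_ext fun D b => ?_
  obtain ⟨F, M, hF, hM⟩ := exists_isComposition C D
  -- The exponents for the longer product come from the general existence result, since subtracting
  -- `elemExp hi D` directly would require knowing that the difference is not negative;
  -- `elemExp_add` then compares them.
  obtain ⟨F', M', hF', hM'⟩ := exists_isComposition C (D.mulElem i hi)
  obtain rfl := hF'.unique (hF.mulElem hi)
  rw [LinearMap.compr₂_apply, LinearMap.compl₂_apply, OkArc.mulHom_single, OkArc.mulElem_single,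
    OkArc.mulHom_single, map_smul, diagramMul_eq x y hF hM, diagramMul_eq x y hF' hM',
    OkArc.mulElem_single, Finsupp.smul_single, Finsupp.smul_single, smul_eq_mul, smul_eq_mul,
    mul_assoc a, mul_assoc a, mul_assoc b, diagramCoeff_mul, diagramCoeff_mul]
  congr 4
  · funext k
    rw [← loopCount_mulElem hi hF k, add_comm]
  · funext k
    rw [← elemExp_add hi hF hM hM' k, add_comm]

theorem OkArc.mulElem_eq_mulHom {i : ℕ} (hi : 1 ≤ i ∧ i < N) (v : OkArc K N) :
    OkArc.mulElem x y i hi v = OkArc.mulHom x y v (Finsupp.single (elem i hi) 1) := rfl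

/-! ### The relations of the elementary diagrams -/

theorem OkadaDiagram.elem_mulElem_self {i : ℕ} (hi : 1 ≤ i ∧ i < N) :
    (elem i hi).mulElem i hi = elem i hi := by
  have hp : (elem i hi).partner (hiNode i hi) = loNode i hi := by
    rw [← mulElem_id]; exact mulElem_partner_hiNode hi
  have hp' : (elem i hi).partner (loNode i hi) = hiNode i hi := (partner_eq_comm _).1 hp
  have hl : (elem i hi).label (hiNode i hi) = i := by
    rw [← mulElem_id]; exact mulElem_label_hiNode hi
  have hl' : (elem i hi).label (loNode i hi) = i := by rw [← hp, label_partner, hl]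
  apply OkadaDiagram.ext <;> funext u
  · rw [mulElem_partner, hp, hp']
    split_ifs with h1 h2
    · rw [h1, hp]
    · rw [h2, hp']
    · rfl
  · rw [mulElem_label, hp, hp', hl, hl']
    split_ifs with h1 h2
    · rcases h1 with rfl | rfl <;> simp only [hl, hl']
    · tauto
    · rfl

theorem OkadaDiagram.elem_partner_of_ne {i : ℕ} (hi : 1 ≤ i ∧ i < N) {k : ℕ} (hk : k < N)
    (h : ¬ (k + 1 = i ∨ k = i)) : (elem i hi).partner (Sum.inr ⟨k, hk⟩) = Sum.inl ⟨k, hk⟩ :=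
  if_neg h

theorem OkadaDiagram.elem_label_of_ne {i : ℕ} (hi : 1 ≤ i ∧ i < N) {k : ℕ} (hk : k < N)
    (h : k ≠ i) : (elem i hi).label (Sum.inr ⟨k, hk⟩) = k + 1 :=
  if_neg h

theorem OkadaDiagram.elem_mulElem_comm {i j : ℕ} (hi : 1 ≤ i ∧ i < N) (hj : 1 ≤ j ∧ j < N)
    (h : i + 2 ≤ j) : (elem i hi).mulElem j hj = (elem j hj).mulElem i hi := by
  have h1 := elem_partner_of_ne hi hj.2 (by omega)
  have h2 := elem_partner_of_ne hi (show j - 1 < N by omega) (by omega)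
  have h3 := elem_partner_of_ne hj hi.2 (by omega)
  have h4 := elem_partner_of_ne hj (show i - 1 < N by omega) (by omega)
  have l1 := elem_label_of_ne hi hj.2 (by omega)
  have l2 := elem_label_of_ne hi (show j - 1 < N by omega) (by omega)
  have l3 := elem_label_of_ne hj hi.2 (by omega)
  have l4 := elem_label_of_ne hj (show i - 1 < N by omega) (by omega)
  apply OkadaDiagram.ext <;> funext u
  · rw [mulElem_partner, mulElem_partner, hiNode, loNode, hiNode, loNode, h1, h2, h3, h4]
    clear h1 h2 h3 h4 l1 l2 l3 l4
    rcases u with ⟨u, hu⟩ | ⟨u, hu⟩ <;>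
      simp only [elem, elemPartner, elemSwap, reduceCtorEq, if_false, Sum.inl.injEq,
        Sum.inr.injEq, Fin.mk.injEq] <;>
      split_ifs <;> first | rfl | (exfalso; omega)
  · rw [mulElem_label, mulElem_label, hiNode, loNode, hiNode, loNode, h1, h2, h3, h4, l1, l2, l3,
      l4]
    clear h1 h2 h3 h4 l1 l2 l3 l4
    rcases u with ⟨u, hu⟩ | ⟨u, hu⟩ <;>
      simp only [elem, elemLabel, reduceCtorEq, or_self, if_false, Sum.inl.injEq,
        Sum.inr.injEq, Fin.mk.injEq] <;>
      split_ifs <;> omega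

end DiagramAlgebra

/-! ### The contraction relation and the map Θ -/

section Theta

open OkadaDiagram

variable {K : Type*} [Field K] {N : ℕ}

section Contract

variable {i : ℕ} (hi : 1 ≤ i ∧ i < N) (hj : 1 ≤ i + 1 ∧ i + 1 < N)

theorem OkadaDiagram.contract_facts :
    ((elem (i + 1) hj).mulElem i hi).partner (hiNode (i + 1) hj) = Sum.inl ⟨i - 1, by omega⟩ ∧
    ((elem (i + 1) hj).mulElem i hi).partner (loNode (i + 1) hj) = loNode i hi ∧
    ((elem (i + 1) hj).mulElem i hi).label (hiNode (i + 1) hj) = i ∧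
    ((elem (i + 1) hj).mulElem i hi).label (loNode (i + 1) hj) = i := by
  have h1 : (elem (i + 1) hj).partner (hiNode (i + 1) hj) = loNode (i + 1) hj := by
    rw [← mulElem_id]; exact mulElem_partner_hiNode hj
  have h2 : (elem (i + 1) hj).partner (loNode (i + 1) hj) = hiNode (i + 1) hj :=
    (partner_eq_comm _).1 h1
  have h3 : loNode (i + 1) hj = hiNode i hi := rfl
  have h4 : (elem (i + 1) hj).partner (loNode i hi) = Sum.inl ⟨i - 1, by omega⟩ :=
    elem_partner_of_ne hj _ (by omega)
  have h5 : (elem (i + 1) hj).label (loNode i hi) = i - 1 + 1 :=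
    elem_label_of_ne hj _ (by omega)
  have h6 : (elem (i + 1) hj).label (hiNode i hi) = i + 1 :=
    elem_label_of_ne hj _ (by omega)
  have h7 := hiNode_ne_loNode hj
  have h8 : hiNode (i + 1) hj ≠ loNode i hi := by
    simp only [hiNode, loNode, ne_eq, Sum.inr.injEq, Fin.mk.injEq]; omega
  rw [h3] at h2 h7 ⊢
  refine ⟨?_, mulElem_partner_hiNode hi, ?_, mulElem_label_hiNode hi⟩
  · rw [mulElem_partner, h2, if_neg h7, if_neg h8, if_pos rfl, h4]
  · rw [mulElem_label, h2, if_neg (by tauto), if_pos (Or.inl rfl), h5, h6]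
    omega

theorem OkadaDiagram.elem_mulElem_mulElem :
    ((elem (i + 1) hj).mulElem i hi).mulElem (i + 1) hj = elem (i + 1) hj := by
  have hlt : i - 1 < N := by omega
  obtain ⟨h1, h2, h3, h4⟩ := contract_facts hi hj
  have h5 : (elem (i + 1) hj).partner (loNode i hi) = Sum.inl ⟨i - 1, hlt⟩ :=
    elem_partner_of_ne hj _ (by omega)
  have h6 : (elem (i + 1) hj).label (loNode i hi) = i - 1 + 1 :=
    elem_label_of_ne hj _ (by omega)
  have h7 : (elem (i + 1) hj).label (hiNode i hi) = i + 1 :=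
    elem_label_of_ne hj _ (by omega)
  have h8 : (elem (i + 1) hj).partner (hiNode (i + 1) hj) = loNode (i + 1) hj := by
    rw [← mulElem_id]; exact mulElem_partner_hiNode hj
  have h9 : (elem (i + 1) hj).partner (loNode (i + 1) hj) = hiNode (i + 1) hj :=
    (partner_eq_comm _).1 h8
  have h10 : loNode (i + 1) hj = hiNode i hi := rfl
  apply OkadaDiagram.ext <;> funext u
  · rw [mulElem_partner, h1, h2, mulElem_partner, h5, ← h10, h9, h10]
    clear h1 h2 h3 h4 h5 h6 h7 h8 h9 h10
    rcases u with ⟨u, hu⟩ | ⟨u, hu⟩ <;>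
      simp only [elem, elemPartner, elemSwap, hiNode, loNode, reduceCtorEq, if_false,
        Sum.inl.injEq, Sum.inr.injEq, Fin.mk.injEq] <;>
      split_ifs <;> first | rfl | (exfalso; omega) | (congr 2; omega)
  · rw [mulElem_label, h1, h2, h3, h4, mulElem_label, h5, ← h10, h9, h10, h6, h7]
    clear h1 h2 h3 h4 h5 h6 h7 h8 h9 h10
    rcases u with ⟨u, hu⟩ | ⟨u, hu⟩ <;>
      simp only [elem, elemLabel, hiNode, loNode, reduceCtorEq, or_self, or_false, false_or,
        if_false, Sum.inl.injEq, Sum.inr.injEq, Fin.mk.injEq] <;>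
      split_ifs <;> omega

end Contract

variable (x y : ℕ → K)

/-- `OkArc.mulElem_mulHom` gathers successive right multiplications in the second factor, so a
relation between the operators follows from the same relation for the diagrams `G i`. -/
theorem OkArc.mulElem_sq {i : ℕ} (hi : 1 ≤ i ∧ i < N) (v : OkArc K N) :
    OkArc.mulElem x y i hi (OkArc.mulElem x y i hi v) = x i • OkArc.mulElem x y i hi v := by
  have hp : (elem i hi).partner (hiNode i hi) = loNode i hi := by
    rw [← mulElem_id]; exact mulElem_partner_hiNode hi
  have hl : (elem i hi).label (hiNode i hi) = i := by
    rw [← mulElem_id]; exact mulElem_label_hiNode hi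
  have h1 : diagramCoeff N x y ((elem i hi).loopAt i hi) (elemExp hi (elem i hi)) = x i := by
    have e1 : (elem i hi).loopAt i hi = fun k => if i = k then 1 else 0 := by
      funext k
      simp only [loopAt, hp, hl, true_and]
    have e2 : elemExp hi (elem i hi) = fun _ => 0 := by
      funext k
      rw [elemExp, dropRow, if_pos hp, hl, if_neg (by omega)]
    rw [e1, e2, diagramCoeff]
    simp only [pow_ite, pow_one, pow_zero, Finset.prod_ite_eq, Finset.prod_const_one, mul_one]
    exact if_pos (Finset.mem_Icc.2 (by omega))
  rw [OkArc.mulElem_eq_mulHom x y hi v, OkArc.mulElem_mulHom, OkArc.mulElem_single, h1,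
    elem_mulElem_self, one_mul, ← map_smul, Finsupp.smul_single, smul_eq_mul, mul_one]

theorem OkArc.mulElem_comm {i j : ℕ} (hi : 1 ≤ i ∧ i < N) (hj : 1 ≤ j ∧ j < N) (h : i + 2 ≤ j)
    (v : OkArc K N) : OkArc.mulElem x y i hi (OkArc.mulElem x y j hj v) =
      OkArc.mulElem x y j hj (OkArc.mulElem x y i hi v) := by
  rw [OkArc.mulElem_eq_mulHom x y hj v, OkArc.mulElem_mulHom, OkArc.mulElem_eq_mulHom x y hi v,
    OkArc.mulElem_mulHom, OkArc.mulElem_single_of_label x y hi, OkArc.mulElem_single_of_label x y hj,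
    elem_mulElem_comm hi hj h]
  · exact elem_label_of_ne hi _ (by omega)
  · exact elem_label_of_ne hj _ (by omega)

theorem OkArc.mulElem_contract {i : ℕ} (hi : 1 ≤ i ∧ i < N) (hj : 1 ≤ i + 1 ∧ i + 1 < N)
    (v : OkArc K N) :
    OkArc.mulElem x y (i + 1) hj (OkArc.mulElem x y i hi (OkArc.mulElem x y (i + 1) hj v)) =
      y i • OkArc.mulElem x y (i + 1) hj v := by
  obtain ⟨h1, h2, h3, h4⟩ := contract_facts hi hj
  have hne : ¬ (Sum.inl ⟨i - 1, by omega⟩ : Node N) = loNode (i + 1) hj := by simp [loNode]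
  have h5 : diagramCoeff N x y (((elem (i + 1) hj).mulElem i hi).loopAt (i + 1) hj)
      (elemExp hj ((elem (i + 1) hj).mulElem i hi)) = y i := by
    have e1 : ((elem (i + 1) hj).mulElem i hi).loopAt (i + 1) hj = fun k => 0 := by
      funext k
      rw [loopAt, h1, if_neg (fun h => hne h.1)]
    -- Both cap nodes have label `i`, so the lost rows are `i` and `i + 1`: a single pair, giving
    -- y_i.
    have e2 : elemExp hj ((elem (i + 1) hj).mulElem i hi) = fun k => if i = k then 1 else 0 := by
      funext k
      rw [elemExp, dropRow, h1, if_neg hne, h3, h4, max_self]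
      split_ifs <;> omega
    rw [e1, e2, diagramCoeff]
    simp only [pow_ite, pow_one, pow_zero, Finset.prod_ite_eq, Finset.prod_const_one, one_mul]
    exact if_pos (Finset.mem_Icc.2 (by omega))
  rw [OkArc.mulElem_eq_mulHom x y hj v, OkArc.mulElem_mulHom, OkArc.mulElem_mulHom,
    OkArc.mulElem_single_of_label x y hi, OkArc.mulElem_single, h5, elem_mulElem_mulElem, one_mul,
    ← map_smul, Finsupp.smul_single, smul_eq_mul, mul_one]
  exact elem_label_of_ne hj _ (by omega)

/-! ### The homomorphism from the Okada algebra -/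

/-- The right action of the Okada algebra on the diagram algebra. -/
noncomputable def OkadaAlgebra.action :
    OkadaAlgebra N x y →ₐ[K] (Module.End K (OkArc K N))ᵐᵒᵖ :=
  -- The generators act by multiplication on the right, hence the opposite of the endomorphism
  -- algebra.
  RingQuot.liftAlgHom K ⟨FreeAlgebra.lift K fun i : GenIdx N =>
    MulOpposite.op (OkArc.mulElem x y i.1 i.2), by
      intro a b h
      induction h with
      | sq i =>
        simp only [map_mul, map_smul, FreeAlgebra.lift_ι_apply]
        refine MulOpposite.unop_injective (LinearMap.ext fun v => ?_)
        exact OkArc.mulElem_sq x y i.2 v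
      | comm i j h =>
        simp only [map_mul, FreeAlgebra.lift_ι_apply]
        refine MulOpposite.unop_injective (LinearMap.ext fun v => ?_)
        rcases h with h | h
        · exact (OkArc.mulElem_comm x y i.2 j.2 h v).symm
        · exact OkArc.mulElem_comm x y j.2 i.2 h v
      | contract i j h =>
        obtain ⟨j, hj⟩ := j
        obtain rfl : j = i.1 + 1 := h
        simp only [map_mul, map_smul, FreeAlgebra.lift_ι_apply]
        refine MulOpposite.unop_injective (LinearMap.ext fun v => ?_)
        exact OkArc.mulElem_contract x y i.2 hj v⟩

theorem OkadaAlgebra.action_gen {i : ℕ} (hi : 1 ≤ i ∧ i < N) :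
    OkadaAlgebra.action x y (OkadaAlgebra.gen N x y i) =
      MulOpposite.op (OkArc.mulElem x y i hi) := by
  rw [OkadaAlgebra.gen, dif_pos hi, OkadaAlgebra.action, RingQuot.liftAlgHom_mkAlgHom_apply,
    FreeAlgebra.lift_ι_apply]

variable {x y} in
theorem OkadaAlgebra.induction {P : OkadaAlgebra N x y → Prop}
    (h0 : ∀ r : K, P (algebraMap K _ r)) (h1 : ∀ i, 1 ≤ i ∧ i < N → P (OkadaAlgebra.gen N x y i))
    (h2 : ∀ a b, P a → P b → P (a * b)) (h3 : ∀ a b, P a → P b → P (a + b))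
    (a : OkadaAlgebra N x y) : P a := by
  obtain ⟨b, rfl⟩ := RingQuot.mkAlgHom_surjective K (OkadaRel N x y) a
  induction b using FreeAlgebra.induction with
  | grade0 r => rw [AlgHom.commutes]; exact h0 r
  | grade1 i =>
    have := h1 i.1 i.2
    rwa [OkadaAlgebra.gen, dif_pos i.2] at this
  | mul a b ha hb => rw [map_mul]; exact h2 _ _ ha hb
  | add a b ha hb => rw [map_add]; exact h3 _ _ ha hb

/-- The right action commutes with left multiplications because the generators do, and the property
passes to sums and products. -/
theorem OkadaAlgebra.action_mulHom (a : OkadaAlgebra N x y) (v w : OkArc K N) :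
    (OkadaAlgebra.action x y a).unop (OkArc.mulHom x y v w) =
      OkArc.mulHom x y v ((OkadaAlgebra.action x y a).unop w) := by
  induction a using OkadaAlgebra.induction generalizing w with
  | h0 r =>
    rw [AlgHom.commutes, MulOpposite.algebraMap_apply, MulOpposite.unop_op,
      Module.algebraMap_end_apply, Module.algebraMap_end_apply, map_smul]
  | h1 i hi => rw [OkadaAlgebra.action_gen x y hi, MulOpposite.unop_op, OkArc.mulElem_mulHom]
  | h2 a b ha hb =>
    rw [map_mul, MulOpposite.unop_mul, Module.End.mul_apply, Module.End.mul_apply, ha, hb]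
  | h3 a b ha hb =>
    rw [map_add, MulOpposite.unop_add, LinearMap.add_apply, LinearMap.add_apply, ha, hb, map_add]

/-- The homomorphism from the Okada algebra to the diagram algebra. -/
noncomputable def OkadaAlgebra.theta : OkadaAlgebra N x y →ₗ[K] OkArc K N :=
  LinearMap.applyₗ (Finsupp.single (OkadaDiagram.id N) (1 : K)) ∘ₗ
    (MulOpposite.opLinearEquiv K).symm.toLinearMap ∘ₗ (OkadaAlgebra.action x y).toLinearMap

theorem OkadaAlgebra.theta_apply (a : OkadaAlgebra N x y) : OkadaAlgebra.theta x y a =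
    (OkadaAlgebra.action x y a).unop (Finsupp.single (OkadaDiagram.id N) 1) := rfl

theorem OkadaAlgebra.isTheta_theta : IsTheta x y (OkadaAlgebra.theta (N := N) x y) := by
  refine ⟨?_, fun a b => ?_, fun i hi => ?_⟩
  · rw [theta_apply, map_one]; rfl
  -- Θ(a)·Θ(b) is the action of b on Θ(a)·id = Θ(a), and Θ(a) is the action of a on the identity
  -- diagram.
  · rw [← OkArc.mulHom_apply, theta_apply x y b, ← action_mulHom, OkArc.mulHom_id, theta_apply,
      theta_apply, map_mul, MulOpposite.unop_mul, Module.End.mul_apply]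
  · rw [theta_apply, action_gen x y hi, MulOpposite.unop_op, OkArc.mulElem_single_of_label x y hi,
      mulElem_id]
    rfl

variable {x y}

theorem IsTheta.unique {Θ Θ' : OkadaAlgebra N x y →ₗ[K] OkArc K N} (h : IsTheta x y Θ)
    (h' : IsTheta x y Θ') : Θ = Θ' := by
  refine LinearMap.ext fun a => ?_
  induction a using OkadaAlgebra.induction with
  | h0 r => rw [Algebra.algebraMap_eq_smul_one, map_smul, map_smul, h.1, h'.1]
  | h1 i hi => rw [h.2.2 i hi, h'.2.2 i hi]
  | h2 a b ha hb => rw [h.2.1, h'.2.1, ha, hb]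
  | h3 a b ha hb => rw [map_add, map_add, ha, hb]

theorem existsUnique_isTheta : ∃! Θ : OkadaAlgebra N x y →ₗ[K] OkArc K N, IsTheta x y Θ :=
  ⟨_, OkadaAlgebra.isTheta_theta x y, fun _ h => h.unique (OkadaAlgebra.isTheta_theta x y)⟩

/-- Each letter of a reduced word multiplies without loops or factors y, so the coefficient stays 1.
-/
theorem IsTheta.map_reduced {Θ : OkadaAlgebra N x y →ₗ[K] OkArc K N} (h : IsTheta x y Θ)
    {w : List ℕ} {D : OkadaDiagram N} (hw : Reduced N w D) :
    Θ (w.map (OkadaAlgebra.gen N x y)).prod = Finsupp.single D 1 := by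
  induction hw with
  | nil => exact h.1
  | snoc w D i hi _ hl ih =>
    rw [List.map_append, List.prod_append, h.2.1, ih, List.map_singleton, List.prod_singleton,
      h.2.2 i hi, ← OkArc.mulHom_apply, ← OkArc.mulElem_eq_mulHom,
      OkArc.mulElem_single_of_label x y hi hl]

end Theta

/-! ### Half diagrams and their chains -/

namespace HalfDiagram

variable {N : ℕ}

theorem restrict_partner_eq_iff (H : HalfDiagram N) {r : ℕ} (hr : r ≤ N) (a : Fin r) :
    (H.restrict r hr).partner a = a ↔
      H.partner (a.castLE hr) = a.castLE hr ∨ r ≤ (H.partner (a.castLE hr)).val := by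
  simp only [restrict]
  split_ifs with h
  · simp only [Fin.ext_iff, Fin.val_castLE]
    omega
  · simp only [true_iff]
    omega

/-- The arc at `a` gives a half arc of the `r`-restriction. -/
def IsOpen (H : HalfDiagram N) (r : ℕ) (a : Fin N) : Prop :=
  a.val < r ∧ (H.partner a = a ∨ r ≤ (H.partner a).val)

theorem mem_propLabels_restrict (H : HalfDiagram N) {r : ℕ} (hr : r ≤ N) {h : ℕ} :
    h ∈ (H.restrict r hr).propLabels ↔ ∃ a, H.IsOpen r a ∧ H.label a = h := by
  simp only [propLabels, Finset.mem_image, Finset.mem_filter, Finset.mem_univ, true_and]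
  constructor
  · rintro ⟨a, ha, rfl⟩
    exact ⟨a.castLE hr, ⟨a.isLt, (H.restrict_partner_eq_iff hr a).1 ha⟩, rfl⟩
  · rintro ⟨a, ⟨ha, ha'⟩, rfl⟩
    exact ⟨⟨a.val, ha⟩, (H.restrict_partner_eq_iff hr ⟨a.val, ha⟩).2 ha', rfl⟩

/-- This is the axiom on half arcs, applied to the restriction. In particular the labels of open
arcs increase from left to right, so a label identifies its open arc. -/
theorem IsOpen.label_lt {H : HalfDiagram N} {r : ℕ} (hr : r ≤ N) {a c : Fin N} (hc : H.IsOpen r c)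
    (har : a.val < r) (hca : c < a) : H.label c < H.label a :=
  (H.restrict r hr).label_half ⟨a.val, har⟩ ⟨c.val, hc.1⟩
    ((H.restrict_partner_eq_iff hr ⟨c.val, hc.1⟩).2 hc.2) hca

theorem IsOpen.eq_of_label_eq {H : HalfDiagram N} {r : ℕ} (hr : r ≤ N) {a c : Fin N}
    (hc : H.IsOpen r c) (ha : H.IsOpen r a) (h : H.label c = H.label a) : c = a := by
  rcases lt_trichotomy c a with g | g | g
  · have := hc.label_lt hr ha.1 g; omega
  · exact g
  · have := ha.label_lt hr hc.1 g; omega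

/-- The `r`-restrictions of `H` and `H'` are equal. -/
def Agree (H H' : HalfDiagram N) (r : ℕ) : Prop := ∀ a : Fin N, a.val < r →
  H.label a = H'.label a ∧
  (H.partner a ≠ a → (H.partner a).val < r → H'.partner a = H.partner a) ∧
  (H'.partner a ≠ a → (H'.partner a).val < r → H.partner a = H'.partner a)

theorem Agree.symm {H H' : HalfDiagram N} {r : ℕ} (h : Agree H H' r) : Agree H' H r :=
  fun a ha => ⟨(h a ha).1.symm, (h a ha).2.2, (h a ha).2.1⟩

theorem Agree.isOpen {H H' : HalfDiagram N} {r : ℕ} (h : Agree H H' r) {a : Fin N}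
    (ha : H.IsOpen r a) : H'.IsOpen r a := by
  refine ⟨ha.1, ?_⟩
  by_contra hcon
  rw [not_or, not_le] at hcon
  have h1 := (h a ha.1).2.2 hcon.1 hcon.2
  rcases ha.2 with h2 | h2
  · exact hcon.1 (by rw [← h1, h2])
  · rw [h1] at h2; omega

section Step

variable {H H' : HalfDiagram N} {r : ℕ} (hr : r < N)

theorem isOpen_partner_of_close (h : (H.partner ⟨r, hr⟩).val < r) :
    H.IsOpen r (H.partner ⟨r, hr⟩) :=
  ⟨h, Or.inr (by rw [H.partner_partner])⟩

theorem isOpen_of_close (h : (H.partner ⟨r, hr⟩).val < r) {b : Fin N} (hb : H.IsOpen (r + 1) b) :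
    H.IsOpen r b ∧ b ≠ H.partner ⟨r, hr⟩ := by
  have h1 : b ≠ H.partner ⟨r, hr⟩ := by
    rintro rfl
    rcases hb.2 with h2 | h2
    · rw [H.partner_partner] at h2
      rw [← h2] at h
      exact lt_irrefl _ h
    · rw [H.partner_partner] at h2
      exact absurd h2 (by simp)
  have h2 : b ≠ ⟨r, hr⟩ := by
    rintro rfl
    rcases hb.2 with h2 | h2
    · exact h1 h2.symm
    · omega
  have h3 : b.val ≠ r := fun e => h2 (Fin.ext e)
  exact ⟨⟨by have := hb.1; omega, hb.2.imp_right (by omega)⟩, h1⟩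

theorem isOpen_of_close_of_ne {b : Fin N} (hb : H.IsOpen r b)
    (hne : b ≠ H.partner ⟨r, hr⟩) : H.IsOpen (r + 1) b := by
  refine ⟨hb.1.trans (Nat.lt_succ_self r), hb.2.imp_right fun h1 => ?_⟩
  have : (H.partner b).val ≠ r := fun e => hne (by
    rw [← H.partner_partner b]; congr 1; exact Fin.ext e)
  omega

theorem isOpen_of_open (h : r ≤ (H.partner ⟨r, hr⟩).val) :
    H.IsOpen (r + 1) ⟨r, hr⟩ := by
  refine ⟨Nat.lt_succ_self r, ?_⟩
  by_cases e : (H.partner ⟨r, hr⟩).val = r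
  · exact Or.inl (Fin.ext e)
  · right; omega

theorem isOpen_succ_of_open (h : r ≤ (H.partner ⟨r, hr⟩).val) {b : Fin N} (hb : H.IsOpen r b) :
    H.IsOpen (r + 1) b := by
  refine ⟨hb.1.trans (Nat.lt_succ_self r), hb.2.imp_right fun h1 => ?_⟩
  have : (H.partner b).val ≠ r := fun e => by
    have h2 : H.partner ⟨r, hr⟩ = b := by
      rw [← H.partner_partner b]; congr 1; exact Fin.ext e.symm
    rw [h2] at h
    exact absurd hb.1 (not_lt.2 h)
  omega

/-- A node that opens an arc has a larger label than all arcs open before it. -/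
theorem label_notMem_of_open (h : r ≤ (H.partner ⟨r, hr⟩).val) :
    H.label ⟨r, hr⟩ ∉ (H.restrict r hr.le).propLabels := by
  rw [mem_propLabels_restrict]
  rintro ⟨b, hb, he⟩
  have := (isOpen_succ_of_open hr h hb).label_lt hr (a := ⟨r, hr⟩) (Nat.lt_succ_self r) hb.1
  omega

/-- The propagating labels tell whether the last node closes an arc. -/
theorem not_close_open
    (h0 : (H.restrict r hr.le).propLabels = (H'.restrict r hr.le).propLabels)
    (h1 : (H.restrict (r + 1) hr).propLabels = (H'.restrict (r + 1) hr).propLabels)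
    (h : (H.partner ⟨r, hr⟩).val < r) (h' : r ≤ (H'.partner ⟨r, hr⟩).val) : False := by
  refine label_notMem_of_open hr h' ?_
  have h2 : H'.label ⟨r, hr⟩ ∈ (H'.restrict (r + 1) hr).propLabels :=
    (mem_propLabels_restrict _ _).2 ⟨_, isOpen_of_open hr h', rfl⟩
  rw [← h1, mem_propLabels_restrict] at h2
  obtain ⟨b, hb, he⟩ := h2
  rw [← h0, mem_propLabels_restrict]
  exact ⟨b, (isOpen_of_close hr h hb).1, he⟩

/-- If the new node closes an arc, one label disappears from the set and identifies the partner,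
since open labels are distinct. If it opens an arc, the label that appears is its own. The two cases
are distinguished by `not_close_open`. -/
theorem Agree.succ (hA : Agree H H' r)
    (h0 : (H.restrict r hr.le).propLabels = (H'.restrict r hr.le).propLabels)
    (h1 : (H.restrict (r + 1) hr).propLabels = (H'.restrict (r + 1) hr).propLabels) :
    Agree H H' (r + 1) := by
  have hlast : ∀ a : Fin N, a.val < r + 1 → a.val < r ∨ a = ⟨r, hr⟩ := fun a ha => by
    rcases Nat.lt_succ_iff_lt_or_eq.1 ha with h | h
    · exact Or.inl h
    · exact Or.inr (Fin.ext h)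
  rcases lt_or_ge (H.partner ⟨r, hr⟩).val r with hc | hc <;>
    rcases lt_or_ge (H'.partner ⟨r, hr⟩).val r with hc' | hc'
  · have e : H.partner ⟨r, hr⟩ = H'.partner ⟨r, hr⟩ := by
      have o := isOpen_partner_of_close hr hc
      have m1 : H.label (H.partner ⟨r, hr⟩) ∉ (H.restrict (r + 1) hr).propLabels := by
        rw [mem_propLabels_restrict]
        rintro ⟨b, hb, he⟩
        obtain ⟨b1, b2⟩ := isOpen_of_close hr hc hb
        exact b2 (b1.eq_of_label_eq hr.le o he)
      by_contra hne
      rw [h1, (hA _ hc).1] at m1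
      exact m1 ((mem_propLabels_restrict _ _).2
        ⟨_, isOpen_of_close_of_ne hr (hA.isOpen o) hne, rfl⟩)
    have el : H.label ⟨r, hr⟩ = H'.label ⟨r, hr⟩ := by
      rw [← H.label_partner, ← H'.label_partner, ← e]
      exact (hA _ hc).1
    have key : ∀ {H H' : HalfDiagram N}, Agree H H' r → H.partner ⟨r, hr⟩ = H'.partner ⟨r, hr⟩ →
        ∀ a : Fin N, a.val < r → H.partner a ≠ a → (H.partner a).val < r + 1 →
        H'.partner a = H.partner a := by
      intro H H' hA e a ha ha1 ha2
      rcases hlast _ ha2 with h | h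
      · exact (hA a ha).2.1 ha1 h
      · rw [h]
        have h3 : a = H'.partner ⟨r, hr⟩ := by rw [← e, ← h, H.partner_partner]
        rw [h3, H'.partner_partner]
    intro a ha
    rcases hlast a ha with h | rfl
    · exact ⟨(hA a h).1, key hA e a h, key hA.symm e.symm a h⟩
    · exact ⟨el, fun _ _ => e.symm, fun _ _ => e⟩
  · exact (not_close_open hr h0 h1 hc hc').elim
  · exact (not_close_open hr h0.symm h1.symm hc' hc).elim
  · have el : H.label ⟨r, hr⟩ = H'.label ⟨r, hr⟩ := by
      have m1 : H.label ⟨r, hr⟩ ∈ (H.restrict (r + 1) hr).propLabels :=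
        (mem_propLabels_restrict _ _).2 ⟨_, isOpen_of_open hr hc, rfl⟩
      have m2 := label_notMem_of_open hr hc
      rw [h1, mem_propLabels_restrict] at m1
      obtain ⟨b, hb, he⟩ := m1
      rcases hlast b hb.1 with h | rfl
      · rw [h0, mem_propLabels_restrict] at m2
        exact absurd ⟨b, ⟨h, hb.2.imp_right (by omega)⟩, he⟩ m2
      · exact he.symm
    have key : ∀ {H H' : HalfDiagram N}, Agree H H' r → r ≤ (H.partner ⟨r, hr⟩).val →
        ∀ a : Fin N, a.val < r + 1 → H.partner a ≠ a → (H.partner a).val < r + 1 →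
        H'.partner a = H.partner a := by
      intro H H' hA hc a ha ha1 ha2
      rcases hlast a ha with h | rfl
      · rcases hlast _ ha2 with g | g
        · exact (hA a h).2.1 ha1 g
        · rw [← g, H.partner_partner] at hc
          omega
      · exact absurd (Fin.ext (show (H.partner ⟨r, hr⟩).val = r by omega)) ha1
    intro a ha
    refine ⟨?_, key hA hc a ha, key hA.symm hc' a ha⟩
    rcases hlast a ha with h | rfl
    · exact (hA a h).1
    · exact el

end Step

/-- A half diagram is determined by its chain. -/
theorem HasChain.unique {H H' : HalfDiagram N} {C : ℕ → FibSet} (h : H.HasChain C)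
    (h' : H'.HasChain C) : H = H' := by
  have hl : ∀ (r : ℕ) (hr : r ≤ N), (H.restrict r hr).propLabels = (H'.restrict r hr).propLabels :=
    fun r hr => by rw [← (h r hr).2, (h' r hr).2]
  have key : ∀ r ≤ N, Agree H H' r := by
    intro r
    induction r with
    | zero => exact fun _ a ha => absurd ha (Nat.not_lt_zero _)
    | succ r ih => exact fun hr => (ih (by omega)).succ hr (hl _ _) (hl _ _)
  have hN := key N le_rfl
  apply HalfDiagram.ext <;> funext a
  · by_cases e : H.partner a = a
    · by_cases e' : H'.partner a = a
      · rw [e, e']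
      · exact (hN a a.isLt).2.2 e' (Fin.isLt _)
    · exact ((hN a a.isLt).2.1 e (Fin.isLt _)).symm
  · exact (hN a a.isLt).1

end HalfDiagram

/-! ### Gluing -/

section Gluing

variable {N : ℕ} {D E : OkadaDiagram N}

theorem OkadaDiagram.mirror_mirror (D : OkadaDiagram N) : D.mirror.mirror = D := by
  apply OkadaDiagram.ext <;> funext u <;> simp [OkadaDiagram.mirror, Node.mirror_mirror]

theorem leftPartner_eq_of_inl {a b : Fin N} (h : D.partner (Sum.inl a) = Sum.inl b) :
    leftPartner D a = b := by simp [leftPartner, h]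

theorem leftPartner_eq_of_inr {a b : Fin N} (h : D.partner (Sum.inl a) = Sum.inr b) :
    leftPartner D a = a := by simp [leftPartner, h]

theorem partner_inl_of_bra_eq (h : D.bra = E.bra) {a b : Fin N}
    (hab : D.partner (Sum.inl a) = Sum.inl b) : E.partner (Sum.inl a) = Sum.inl b := by
  have h1 : leftPartner D a = leftPartner E a := congrFun (congrArg HalfDiagram.partner h) a
  rw [leftPartner_eq_of_inl hab] at h1
  rcases leftPartner_cases E a with ⟨h2, -⟩ | ⟨c, -, h2, -⟩
  · rw [h2, ← h1]
  · rw [h2] at h1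
    rw [h1] at hab
    exact absurd hab (D.partner_ne _)

/-- Full arcs are visible in the halves. For a propagating arc, the two candidates for its right end
carry the same label, and labels of half arcs are strictly increasing. -/
theorem partner_eq_of_bra_eq_of_ket_eq (h : D.bra = E.bra) (h' : D.ket = E.ket) (a : Fin N) :
    D.partner (Sum.inl a) = E.partner (Sum.inl a) := by
  have hl : ∀ a, D.label (Sum.inl a) = E.label (Sum.inl a) :=
    congrFun (congrArg HalfDiagram.label h)
  have hr : ∀ a, D.label (Sum.inr a) = E.label (Sum.inr a) :=
    congrFun (congrArg HalfDiagram.label h')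
  rcases hD : D.partner (Sum.inl a) with b | b
  · exact (partner_inl_of_bra_eq h hD).symm
  rcases hE : E.partner (Sum.inl a) with c | c
  · rw [partner_inl_of_bra_eq h.symm hE] at hD
    cases hD
  have e1 : E.label (Sum.inr b) = E.label (Sum.inr c) := by
    rw [← hE, E.label_partner, ← hl, ← hr, ← hD, D.label_partner]
  have hb : E.ket.partner b = b := by
    rw [← h']
    refine leftPartner_eq_of_inr (b := a) ?_
    change (D.partner (Sum.inr b)).mirror = _
    rw [← hD, D.partner_partner]
    rfl
  have hc : E.ket.partner c = c := by
    refine leftPartner_eq_of_inr (b := a) ?_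
    change (E.partner (Sum.inr c)).mirror = _
    rw [← hE, E.partner_partner]
    rfl
  have l1 : E.ket.label b = E.ket.label c := e1
  rcases lt_trichotomy b c with g | g | g
  · have := E.ket.label_half c b hb g; omega
  · rw [g]
  · have := E.ket.label_half b c hc g; omega

theorem OkadaDiagram.ket_mirror (D : OkadaDiagram N) : D.mirror.ket = D.bra := by
  rw [OkadaDiagram.ket, D.mirror_mirror]

/-- A diagram is determined by its halves. -/
theorem IsGluing.unique {L R : HalfDiagram N} (h : IsGluing L R D) (h' : IsGluing L R E) :
    D = E := by
  have hb : D.bra = E.bra := by rw [h.1, h'.1]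
  have hk : D.ket = E.ket := by rw [h.2, h'.2]
  apply OkadaDiagram.ext <;> funext u <;> rcases u with a | a
  · exact partner_eq_of_bra_eq_of_ket_eq hb hk a
  · have := partner_eq_of_bra_eq_of_ket_eq (D := D.mirror) (E := E.mirror) hk
      (by rw [D.ket_mirror, E.ket_mirror, hb]) a
    change (D.partner (Sum.inr a)).mirror = (E.partner (Sum.inr a)).mirror at this
    rw [← Node.mirror_mirror (D.partner _), this, Node.mirror_mirror]
  · exact congrFun (congrArg HalfDiagram.label hb) a
  · exact congrFun (congrArg HalfDiagram.label hk) a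

theorem IsGluing.mirror {L R : HalfDiagram N} (h : IsGluing L R D) : IsGluing R L D.mirror :=
  ⟨h.2, by rw [D.ket_mirror, h.1]⟩

end Gluing

/-! ### The chains of an insertion -/

namespace OkadaDiagram

section Cut

variable {N : ℕ}

/-- `h` is the label of an arc which joins a position below `c` with one from `c` on. -/
def IsCutLabel (D : OkadaDiagram N) (c h : ℕ) : Prop := ∃ k < c, c ≤ D.p k ∧ D.l k = h

/-- An arc open at rank `r` is one that leads from a position below `r` to a position at or beyond
`r`; propagating arcs qualify because their second end lies in the right half. -/
theorem mem_propLabels_bra (D : OkadaDiagram N) {r : ℕ} (hr : r ≤ N) {h : ℕ} :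
    h ∈ (D.bra.restrict r hr).propLabels ↔ D.IsCutLabel r h := by
  have hl : ∀ a : Fin N, D.bra.label a = D.l a.val := fun a => (l_pos D (Sum.inl a)).symm
  have ho : ∀ a : Fin N, D.bra.IsOpen r a ↔ a.val < r ∧ r ≤ D.p a.val := by
    intro a
    have hp : D.p a.val = (D.partner (Sum.inl a)).pos := p_pos D (Sum.inl a)
    rw [HalfDiagram.IsOpen, and_congr_right_iff, hp]
    intro ha
    change leftPartner D a = a ∨ r ≤ (leftPartner D a).val ↔ _
    rcases leftPartner_cases D a with ⟨h1, h2⟩ | ⟨b, h1, h2, -⟩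
    · rw [h1, or_iff_right h2]
      rfl
    · have := b.isLt
      simp only [h1, h2, true_or, true_iff, Node.pos]
      omega
  rw [HalfDiagram.mem_propLabels_restrict]
  constructor
  · rintro ⟨a, ha, rfl⟩
    exact ⟨a.val, ((ho a).1 ha).1, ((ho a).1 ha).2, (hl a).symm⟩
  · rintro ⟨k, hk, hk', rfl⟩
    exact ⟨⟨k, by omega⟩, (ho _).2 ⟨hk, hk'⟩, hl _⟩

theorem mirror_p (D : OkadaDiagram N) {k : ℕ} (hk : k < 2 * N) :
    D.mirror.p k + D.p (2 * N - 1 - k) = 2 * N - 1 := by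
  have h1 := Node.pos_mirror (posNode k hk)
  have h2 := Node.pos_mirror (D.partner (posNode k hk).mirror)
  rw [pos_posNode] at h1
  have h3 := p_pos D.mirror (posNode k hk)
  have h4 := p_pos D (posNode k hk).mirror
  rw [pos_posNode] at h3
  rw [show (posNode k hk).mirror.pos = 2 * N - 1 - k by omega] at h4
  rw [h3, h4]
  exact h2

theorem mirror_l (D : OkadaDiagram N) {k : ℕ} (hk : k < 2 * N) :
    D.mirror.l k = D.l (2 * N - 1 - k) := by
  have h1 := Node.pos_mirror (posNode k hk)
  rw [pos_posNode] at h1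
  have h3 := l_pos D.mirror (posNode k hk)
  have h4 := l_pos D (posNode k hk).mirror
  rw [pos_posNode] at h3
  rw [show (posNode k hk).mirror.pos = 2 * N - 1 - k by omega] at h4
  rw [h3, h4]
  rfl

theorem IsCutLabel.mirror {D : OkadaDiagram N} {c h : ℕ} (hc : c ≤ 2 * N)
    (hD : D.mirror.IsCutLabel c h) : D.IsCutLabel (2 * N - c) h := by
  obtain ⟨k, hk, hk', rfl⟩ := hD
  have h1 := D.mirror_p (show k < 2 * N by omega)
  have h2 : 2 * N - 1 - k < 2 * N := by omega
  rw [mirror_l _ (by omega)]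
  refine ⟨D.p (2 * N - 1 - k), by omega, ?_, D.isPosData.label_partner _ h2⟩
  rw [D.isPosData.invol _ h2]
  omega

theorem mem_propLabels_ket (D : OkadaDiagram N) {r : ℕ} (hr : r ≤ N) {h : ℕ} :
    h ∈ (D.ket.restrict r hr).propLabels ↔ D.IsCutLabel (2 * N - r) h := by
  rw [OkadaDiagram.ket, mem_propLabels_bra]
  refine ⟨IsCutLabel.mirror (by omega), fun hD => ?_⟩
  have := IsCutLabel.mirror (D := D.mirror) (c := 2 * N - r) (h := h) (by omega)
    (by rwa [D.mirror_mirror])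
  rwa [show 2 * N - (2 * N - r) = r by omega] at this

end Cut

section Insert

variable {M : ℕ} (D : OkadaDiagram M) {s a : ℕ} (hs : 1 ≤ s ∧ s ≤ M + 1)

theorem isCutLabel_insert_iff {c h : ℕ} (ha : a + s = 2 * M + 1) (hc : c ≤ 2 * (M + 1)) :
    (D.insert s hs).IsCutLabel c h ↔
      (c = a + 1 ∧ s = h) ∨ ∃ k < 2 * M, skip a k < c ∧ c ≤ skip a (D.p k) ∧ D.l k = h := by
  have ha2 : a ≤ 2 * M := by omega
  have hea : 2 * M + 1 - s = a := by omega
  constructor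
  · rintro ⟨k, hk, hk', rfl⟩
    have hkM : k < 2 * (M + 1) := by omega
    rw [insert_l _ _ hkM, hea]
    rw [insert_p _ _ hkM, hea] at hk'
    revert k
    suffices h : ∀ k < 2 * (M + 1), k < c → c ≤ insPartner D.p a k →
        (c = a + 1 ∧ s = insLabel D.l a s k) ∨
        ∃ k' < 2 * M, skip a k' < c ∧ c ≤ skip a (D.p k') ∧ D.l k' = insLabel D.l a s k from
      fun k h1 h2 h3 => h k h3 h1 h2
    refine ins_cases ha2 ?_ ?_ fun k hk => ?_
    · rw [insPartner_left, insLabel_left]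
      exact fun h1 h2 => Or.inl ⟨by omega, rfl⟩
    · rw [insPartner_right]
      exact fun h1 h2 => by omega
    · rw [insPartner_skip, insLabel_skip]
      exact fun h1 h2 => Or.inr ⟨k, hk, h1, h2, rfl⟩
  · rintro (⟨rfl, rfl⟩ | ⟨k, hk, h1, h2, rfl⟩)
    · refine ⟨a, by omega, ?_, ?_⟩
      · rw [insert_p _ _ (by omega), hea, insPartner_left]
      · rw [insert_l _ _ (by omega), hea, insLabel_left]
    · have hkM := (skip_lt ha2).2 hk
      refine ⟨skip a k, h1, ?_, ?_⟩
      · rwa [insert_p _ _ hkM, hea, insPartner_skip]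
      · rw [insert_l _ _ hkM, hea, insLabel_skip]

theorem isCutLabel_insert_of_le {c h : ℕ} (ha : a + s = 2 * M + 1) (hc : c ≤ a) :
    (D.insert s hs).IsCutLabel c h ↔ D.IsCutLabel c h := by
  have h1 : ∀ {k}, skip a k < c ↔ k < c := fun {k} => by unfold skip; split_ifs <;> omega
  rw [isCutLabel_insert_iff D hs ha (by omega)]
  simp only [IsCutLabel, ← not_lt (b := c), h1]
  constructor
  · rintro (⟨h2, -⟩ | ⟨k, -, h2⟩)
    · omega
    · exact ⟨k, h2⟩
  · rintro ⟨k, h2⟩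
    exact Or.inr ⟨k, by omega, h2⟩

theorem isCutLabel_insert_of_ge {c h : ℕ} (ha : a + s = 2 * M + 1) (hc : a ≤ c)
    (hcM : c ≤ 2 * M) :
    (D.insert s hs).IsCutLabel (c + 2) h ↔ D.IsCutLabel c h := by
  have h1 : ∀ {k}, skip a k < c + 2 ↔ k < c := fun {k} => by unfold skip; split_ifs <;> omega
  rw [isCutLabel_insert_iff D hs ha (by omega)]
  simp only [IsCutLabel, ← not_lt (b := c), ← not_lt (b := c + 2), h1]
  constructor
  · rintro (⟨h2, -⟩ | ⟨k, -, h2⟩)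
    · omega
    · exact ⟨k, h2⟩
  · rintro ⟨k, h2⟩
    exact Or.inr ⟨k, by omega, h2⟩

/-- The cut at `a + 1` is the only one that crosses the inserted arc. The other cuts see the old
labels, with position shifted by two if they lie to the right of the arc. -/
theorem isCutLabel_insert_self {h : ℕ} (ha : a + s = 2 * M + 1) :
    (D.insert s hs).IsCutLabel (a + 1) h ↔ h = s ∨ D.IsCutLabel a h := by
  have h1 : ∀ {k}, skip a k < a + 1 ↔ k < a := fun {k} => by unfold skip; split_ifs <;> omega
  rw [isCutLabel_insert_iff D hs ha (by omega)]
  simp only [IsCutLabel, ← not_lt (b := a), ← not_lt (b := a + 1), h1, true_and, eq_comm (a := h)]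
  refine or_congr_right ⟨?_, ?_⟩
  · rintro ⟨k, -, h2⟩
    exact ⟨k, h2⟩
  · rintro ⟨k, h2⟩
    exact ⟨k, by omega, h2⟩

end Insert

end OkadaDiagram

/-! ### Permutations and growth diagrams -/

section Fomin

theorem fominRule_comm (m : Prop) (t p q : FibSet) : fominRule m t p q = fominRule m t q p := by
  unfold fominRule
  split_ifs <;> simp_all

theorem fominGrowth_zero_left {N : ℕ} (σ : Equiv.Perm (Fin N)) (j : ℕ) :
    fominGrowth σ 0 j = FibSet.empty := by rw [fominGrowth]

theorem fominGrowth_zero_right {N : ℕ} (σ : Equiv.Perm (Fin N)) (i : ℕ) :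
    fominGrowth σ i 0 = FibSet.empty := by cases i <;> rw [fominGrowth]

theorem fominGrowth_succ {N : ℕ} (σ : Equiv.Perm (Fin N)) (i j : ℕ) :
    fominGrowth σ (i + 1) (j + 1) = fominRule (∃ h : i < N, (σ ⟨i, h⟩).val = j)
      (fominGrowth σ i j) (fominGrowth σ i (j + 1)) (fominGrowth σ (i + 1) j) := by
  rw [fominGrowth]

/-- The local rule is symmetric in its two middle corners, and passing to σ⁻¹ transposes the marks.
-/
theorem fominGrowth_inv {N : ℕ} (σ : Equiv.Perm (Fin N)) (i j : ℕ) :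
    fominGrowth σ⁻¹ i j = fominGrowth σ j i := by
  induction i generalizing j with
  | zero => rw [fominGrowth_zero_left, fominGrowth_zero_right]
  | succ i ihi =>
    induction j with
    | zero => rw [fominGrowth_zero_left, fominGrowth_zero_right]
    | succ j ihj =>
      rw [fominGrowth_succ, fominGrowth_succ, ihi, ihi, ihj, fominRule_comm]
      congr 1
      refine propext ⟨?_, ?_⟩
      · rintro ⟨h, rfl⟩
        exact ⟨Fin.isLt _, by simp⟩
      · rintro ⟨h, rfl⟩
        exact ⟨Fin.isLt _, by simp⟩

/-- The code of `σ` as a list of indices of generators. -/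
def permWord {N : ℕ} (σ : Equiv.Perm (Fin N)) : List ℕ :=
  ((List.finRange N).map fun i => (List.range (permCode σ i)).map fun k => i.val - k).flatten

theorem permElem_eq {K : Type*} [Field K] {N : ℕ} (x y : ℕ → K) (σ : Equiv.Perm (Fin N)) :
    OkadaAlgebra.permElem x y σ = ((permWord σ).map (OkadaAlgebra.gen N x y)).prod := by
  rw [OkadaAlgebra.permElem, permWord, List.map_flatten, List.prod_flatten, List.map_map,
    List.map_map]
  simp only [Function.comp_def, List.map_map]

variable {M : ℕ} {σ : Equiv.Perm (Fin (M + 1))} {a : Fin (M + 1)} {τ : Equiv.Perm (Fin M)}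

/-- The deletion of the largest value of a permutation. -/
theorem exists_delete (σ : Equiv.Perm (Fin (M + 1))) :
    ∃ (a : Fin (M + 1)) (τ : Equiv.Perm (Fin M)), σ a = Fin.last M ∧
      ∀ k, σ (a.succAbove k) = (τ k).castSucc := by
  obtain ⟨a, ha⟩ := σ.surjective (Fin.last M)
  have hne : ∀ k, σ (a.succAbove k) ≠ Fin.last M := fun k h =>
    a.succAbove_ne k (σ.injective (h.trans ha.symm))
  have hinj : Function.Injective fun k => (σ (a.succAbove k)).castPred (hne k) := fun k m h =>
    Fin.succAbove_right_injective (σ.injective (Fin.castPred_inj.1 h))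
  exact ⟨a, Equiv.ofBijective _ (Finite.injective_iff_bijective.1 hinj), ha, fun k => by simp⟩

theorem inv_castSucc (hτ : ∀ k, σ (a.succAbove k) = (τ k).castSucc) (i : Fin M) : σ⁻¹ i.castSucc = a.succAbove (τ⁻¹ i) := by
  rw [Equiv.Perm.inv_eq_iff_eq, hτ]
  simp

/-- All other values are smaller than the largest one, so the code counts the positions to its
right. -/
theorem permCode_last (ha : σ a = Fin.last M) : permCode σ (Fin.last M) = M - a.val := by
  have ha' : σ⁻¹ (Fin.last M) = a := by rw [← ha]; simp
  have hc : (Finset.Ioi a).card = M - a.val := by rw [Fin.card_Ioi]; omega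
  rw [permCode, ha', ← hc, ← Finset.card_map (s := Finset.Ioi a) σ.toEmbedding]
  refine congrArg Finset.card (Finset.ext fun j => ?_)
  simp only [Finset.mem_filter, Finset.mem_univ, true_and, Finset.mem_map_equiv, Finset.mem_Ioi]
  refine ⟨fun h => h.2, fun h => ⟨?_, h⟩⟩
  refine lt_of_le_of_ne (Fin.le_last j) ?_
  rintro rfl
  change a < σ⁻¹ (Fin.last M) at h
  rw [ha'] at h
  exact lt_irrefl _ h

theorem permCode_castSucc (hτ : ∀ k, σ (a.succAbove k) = (τ k).castSucc) (i : Fin M) :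
    permCode σ i.castSucc = permCode τ i := by
  refine (congrArg Finset.card (Finset.ext fun j => ?_)).trans (Finset.card_map Fin.castSuccEmb)
  simp only [Finset.mem_filter, Finset.mem_univ, true_and, Finset.mem_map]
  constructor
  · rintro ⟨h1, h2⟩
    obtain ⟨j, rfl⟩ := Fin.exists_castSucc_eq.2 (ne_of_lt (h1.trans (Fin.castSucc_lt_last i)))
    rw [inv_castSucc hτ, inv_castSucc hτ, Fin.succAbove_lt_succAbove_iff] at h2
    exact ⟨j, ⟨h1, h2⟩, rfl⟩
  · rintro ⟨j, ⟨h1, h2⟩, rfl⟩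
    refine ⟨h1, ?_⟩
    change σ⁻¹ i.castSucc < σ⁻¹ j.castSucc
    rwa [inv_castSucc hτ, inv_castSucc hτ, Fin.succAbove_lt_succAbove_iff]

/-- Deleting the largest value does not affect the code of the smaller ones, so the words differ by
the descending run of the last entry. This is the run in `Reduced.insert`. -/
theorem permWord_eq_append (ha : σ a = Fin.last M)
    (hτ : ∀ k, σ (a.succAbove k) = (τ k).castSucc) :
    permWord σ = permWord τ ++ (List.range (M - a.val)).map fun k => M - k := by
  rw [permWord, List.finRange_succ_last, List.map_append, List.flatten_append, List.map_map]
  simp only [Function.comp_def, permCode_castSucc hτ, List.map_singleton,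
    permCode_last ha, List.flatten_singleton, Fin.val_last, Fin.val_castSucc]
  rfl

theorem mark_of_lt (hτ : ∀ k, σ (a.succAbove k) = (τ k).castSucc) {i j : ℕ} (hi : i < a.val) :
    (∃ h : i < M + 1, (σ ⟨i, h⟩).val = j) ↔ ∃ h : i < M, (τ ⟨i, h⟩).val = j := by
  have hM : i < M := by have := a.isLt; omega
  have h := hτ ⟨i, hM⟩
  rw [Fin.succAbove_of_castSucc_lt _ _ hi] at h
  have h' : (σ ⟨i, by omega⟩).val = (τ ⟨i, hM⟩).val := congrArg Fin.val h
  simp only [hM, exists_true_left, show i < M + 1 by omega, h']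

theorem mark_of_gt (hτ : ∀ k, σ (a.succAbove k) = (τ k).castSucc) {i j : ℕ} (hi : a.val ≤ i) :
    (∃ h : i + 1 < M + 1, (σ ⟨i + 1, h⟩).val = j) ↔ ∃ h : i < M, (τ ⟨i, h⟩).val = j := by
  by_cases hM : i < M
  · have h := hτ ⟨i, hM⟩
    rw [Fin.succAbove_of_le_castSucc _ _ hi] at h
    have h' : (σ ⟨i + 1, by omega⟩).val = (τ ⟨i, hM⟩).val := congrArg Fin.val h
    simp only [hM, exists_true_left, show i + 1 < M + 1 by omega, h']
  · simp only [hM, show ¬ i + 1 < M + 1 by omega, IsEmpty.exists_iff]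

theorem mark_self (ha : σ a = Fin.last M) {j : ℕ} : (∃ h : a.val < M + 1, (σ ⟨a.val, h⟩).val = j) ↔ M = j := by
  simp only [Fin.eta, ha, Fin.val_last, a.isLt, exists_true_left]

/-- The column of the largest value has no mark in the rows below the top one. Its two sides
therefore agree there, and the growth diagram of σ is that of τ with one line duplicated. -/
theorem fominGrowth_delete (ha : σ a = Fin.last M)
    (hτ : ∀ k, σ (a.succAbove k) = (τ k).castSucc) {j : ℕ} (hj : j ≤ M) (i : ℕ) :
    fominGrowth σ i j = fominGrowth τ (if i ≤ a.val then i else i - 1) j := by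
  induction j generalizing i with
  | zero => rw [fominGrowth_zero_right, fominGrowth_zero_right]
  | succ j ihj =>
    have ihj := fun i => ihj (by omega) i
    induction i with
    | zero => rw [if_pos (Nat.zero_le _), fominGrowth_zero_left, fominGrowth_zero_left]
    | succ i ihi =>
      rw [fominGrowth_succ, ihj, ihj, ihi]
      rcases lt_trichotomy i a.val with h | h | h
      · rw [if_pos h.le, if_pos (Nat.succ_le_of_lt h), fominGrowth_succ,
          propext (mark_of_lt hτ h)]
      -- In the unmarked column the left corners `t` and `p` are the sets of τ at index `a`, and `q`
      -- equals `t` by induction; the rule then returns `p`.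
      · have hm : ¬ ∃ h : i < M + 1, (σ ⟨i, h⟩).val = j := by
          subst h
          rw [mark_self ha]
          omega
        rw [if_pos h.le, if_neg (by omega), Nat.add_sub_cancel]
        unfold fominRule
        split_ifs <;> simp_all
      · obtain ⟨i, rfl⟩ : ∃ k, i = k + 1 := ⟨i - 1, by omega⟩
        rw [if_neg (by omega), if_neg (by omega), Nat.add_sub_cancel, Nat.add_sub_cancel,
          fominGrowth_succ, propext (mark_of_gt hτ (by omega))]

theorem fominP_delete (ha : σ a = Fin.last M)
    (hτ : ∀ k, σ (a.succAbove k) = (τ k).castSucc) {j : ℕ} (hj : j ≤ M) : fominP σ j = fominP τ j := by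
  rw [fominP, fominGrowth_delete ha hτ hj, fominP]
  have := a.isLt
  split_ifs
  · omega
  · rfl

/-- Before the mark is reached, the top row of cells copies the chain below it. -/
theorem fominQ_of_lt (ha : σ a = Fin.last M)
    (hτ : ∀ k, σ (a.succAbove k) = (τ k).castSucc) {i : ℕ} (hi : i ≤ a.val) : fominQ σ i = fominQ τ i := by
  have h1 : ∀ i ≤ a.val, fominGrowth σ i M = fominGrowth τ i M := fun i hi => by
    rw [fominGrowth_delete ha hτ le_rfl, if_pos hi]
  rw [fominQ, fominQ, ← h1 i hi]
  induction i with
  | zero => rw [fominGrowth_zero_left, fominGrowth_zero_left]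
  | succ i ih =>
    have hm : ¬ ∃ h : i < M + 1, (σ ⟨i, h⟩).val = M := by
      rw [mark_of_lt hτ hi]
      rintro ⟨h, h2⟩
      exact absurd h2 (Fin.isLt _).ne
    rw [fominGrowth_succ, ih (by omega)]
    unfold fominRule
    split_ifs <;> simp_all

theorem fominQ_self (ha : σ a = Fin.last M)
    (hτ : ∀ k, σ (a.succAbove k) = (τ k).castSucc) : fominQ σ (a.val + 1) = (fominQ τ a.val).addOne := by
  have h1 : fominGrowth σ a.val (M + 1) = fominQ τ a.val := fominQ_of_lt ha hτ le_rfl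
  have h2 : fominGrowth σ a.val M = fominQ τ a.val := by
    rw [fominGrowth_delete ha hτ le_rfl, if_pos le_rfl]; rfl
  have h3 : fominGrowth σ (a.val + 1) M = fominQ τ a.val := by
    rw [fominGrowth_delete ha hτ le_rfl, if_neg (by omega)]; rfl
  rw [fominQ, fominGrowth_succ, h1, h2, h3, fominRule, if_pos ⟨rfl, rfl⟩,
    if_pos ((mark_self ha).2 rfl)]

/-- Beyond the mark the three known corners have ranks `i`, `i + 1` and `i + 1`. Both middle corners
differ from the lower left one, so the last clause of the local rule applies. -/
theorem fominQ_of_gt (ha : σ a = Fin.last M)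
    (hτ : ∀ k, σ (a.succAbove k) = (τ k).castSucc) (hr : ∀ i ≤ M, (fominQ τ i).rank = i) {i : ℕ} (hi : a.val ≤ i) (hiM : i < M) :
    fominQ σ (i + 2) = (fominQ τ i).addTwo := by
  have h1 : ∀ i, a.val ≤ i → fominGrowth σ (i + 1) M = fominQ τ i := fun i hi => by
    rw [fominGrowth_delete ha hτ le_rfl, if_neg (by omega)]; rfl
  have key : ∀ i, a.val ≤ i → i < M → (fominQ σ (i + 1)).rank = i + 1 →
      fominQ σ (i + 2) = (fominQ τ i).addTwo := by
    intro i hi hiM h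
    have n1 : fominGrowth σ (i + 1) (M + 1) ≠ fominQ τ i := fun e => by
      rw [fominQ, e, hr i hiM.le] at h; omega
    have n2 : fominQ τ (i + 1) ≠ fominQ τ i := fun e => by
      have := congrArg FibSet.rank e
      rw [hr _ hiM.le, hr _ hiM] at this; omega
    rw [fominQ, fominGrowth_succ, h1 i hi, h1 (i + 1) (by omega), fominRule,
      if_neg fun h => n1 h.1, if_neg n1, if_neg n2]
  refine key i hi hiM ?_
  induction i, hi using Nat.le_induction with
  | base => rw [fominQ_self ha hτ]; exact congrArg (· + 1) (hr _ hiM.le)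
  | succ i hi ih =>
    rw [key i hi (by omega) (ih (by omega))]
    exact congrArg (· + 2) (hr i (by omega))

end Fomin

/-! ### Agreement of insertions with growth diagrams -/

section Correspondence

open OkadaDiagram

/-- The chains of a diagram in terms of its cut labels. -/
theorem hasChain_bra_iff {N : ℕ} {D : OkadaDiagram N} {C : ℕ → FibSet} : D.bra.HasChain C ↔
    ∀ r ≤ N, (C r).rank = r ∧ ∀ h, h ∈ (C r).carrier ↔ D.IsCutLabel r h := by
  refine forall₂_congr fun r hr => and_congr_right fun _ => ?_
  rw [Finset.ext_iff]
  exact forall_congr' fun h => by rw [mem_propLabels_bra]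

theorem hasChain_ket_iff {N : ℕ} {D : OkadaDiagram N} {C : ℕ → FibSet} : D.ket.HasChain C ↔
    ∀ r ≤ N, (C r).rank = r ∧ ∀ h, h ∈ (C r).carrier ↔ D.IsCutLabel (2 * N - r) h := by
  refine forall₂_congr fun r hr => and_congr_right fun _ => ?_
  rw [Finset.ext_iff]
  exact forall_congr' fun h => by rw [mem_propLabels_ket]

/-- Induction on the rank: removing the largest value of σ corresponds to removing one inserted arc,
and cuts before, through and beyond this arc match the three cases of the top row of the growth
diagram. This also provides the existence of half diagrams with the given chains. -/
theorem exists_reduced_permWord {N : ℕ} (σ : Equiv.Perm (Fin N)) :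
    ∃ D : OkadaDiagram N, Reduced N (permWord σ) D ∧ D.bra.HasChain (fominP σ) ∧
      D.ket.HasChain (fominQ σ) := by
  induction N with
  | zero =>
    have h0 : ∀ h, ¬ (OkadaDiagram.id 0).IsCutLabel 0 h := fun h ⟨k, hk, _⟩ => by omega
    refine ⟨_, Reduced.nil, hasChain_bra_iff.2 fun r hr => ?_, hasChain_ket_iff.2 fun r hr => ?_⟩ <;>
      obtain rfl := Nat.le_zero.1 hr
    · rw [fominP, fominGrowth_zero_left]
      exact ⟨rfl, fun h => iff_of_false (Finset.notMem_empty h) (h0 h)⟩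
    · rw [fominQ, fominGrowth_zero_left]
      exact ⟨rfl, fun h => iff_of_false (Finset.notMem_empty h) (h0 h)⟩
  | succ M ih =>
    obtain ⟨a, τ, ha, hτ⟩ := exists_delete σ
    obtain ⟨D, hw, hP, hQ⟩ := ih τ
    rw [hasChain_bra_iff] at hP
    rw [hasChain_ket_iff] at hQ
    have haM : a.val ≤ M := Nat.le_of_lt_succ a.isLt
    have hs : 1 ≤ a.val + 1 ∧ a.val + 1 ≤ M + 1 := by omega
    have hins := hw.insert (M - a.val) (by omega)
    simp only [show M + 1 - (M - a.val) = a.val + 1 by omega] at hins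
    rw [← permWord_eq_append ha hτ] at hins
    -- The inserted arc joins the positions `c` and `c + 1`; its label `a + 1` is the position,
    -- counted from 1, of the largest value of σ.
    obtain ⟨c, hc⟩ : ∃ c, c + (a.val + 1) = 2 * M + 1 := ⟨2 * M - a.val, by omega⟩
    have hket : (D.insert (a.val + 1) hs).ket.HasChain (fominQ σ) := by
      refine hasChain_ket_iff.2 fun r hr => ?_
      -- The right chain is read from the outside inwards, so small `r` means a cut to the right of
      -- the inserted arc.
      rcases lt_trichotomy r (a.val + 1) with h | rfl | h
      · rw [fominQ_of_lt ha hτ (by omega), show 2 * (M + 1) - r = 2 * M - r + 2 by omega]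
        refine ⟨(hQ r (by omega)).1, fun l => ?_⟩
        rw [isCutLabel_insert_of_ge D hs hc (by omega) (by omega), (hQ r (by omega)).2]
      · have hq := hQ a.val haM
        rw [fominQ_self ha hτ, show 2 * (M + 1) - (a.val + 1) = c + 1 by omega]
        refine ⟨congrArg (· + 1) hq.1, fun l => ?_⟩
        rw [isCutLabel_insert_self D hs hc, FibSet.addOne, Finset.mem_insert, hq.1, hq.2,
          show 2 * M - a.val = c by omega]
      · obtain ⟨i, rfl⟩ : ∃ i, r = i + 2 := ⟨r - 2, by omega⟩
        have hq := hQ i (by omega)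
        rw [fominQ_of_gt ha hτ (fun i hi => (hQ i hi).1) (by omega) (by omega)]
        refine ⟨congrArg (· + 2) hq.1, fun l => ?_⟩
        rw [isCutLabel_insert_of_le D hs hc (by omega), FibSet.addTwo, hq.2,
          show 2 * (M + 1) - (i + 2) = 2 * M - i by omega]
    refine ⟨_, hins, hasChain_bra_iff.2 fun r hr => ?_, hket⟩
    rcases Nat.le_succ_iff.1 hr with h | rfl
    · rw [fominP_delete ha hτ h]
      refine ⟨(hP r h).1, fun l => ?_⟩
      rw [isCutLabel_insert_of_le D hs hc (by omega), (hP r h).2]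
    -- At full rank the left and right chains refer to the same cut in the middle, and both are the
    -- corner of the growth diagram.
    · have := hasChain_ket_iff.1 hket (M + 1) le_rfl
      rwa [show 2 * (M + 1) - (M + 1) = M + 1 by omega] at this

theorem OkArc.mirror_single {K : Type*} [Field K] {N : ℕ} (D : OkadaDiagram N) (a : K) :
    OkArc.mirror (Finsupp.single D a) = Finsupp.single D.mirror a :=
  Finsupp.mapDomain_single

end Correspondence

theorem mainTheorem3 {K : Type*} [Field K] (N : ℕ) (x y : ℕ → K) :
    (∃! Θ : OkadaAlgebra N x y →ₗ[K] OkArc K N, IsTheta x y Θ) ∧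
    ∀ Θ : OkadaAlgebra N x y →ₗ[K] OkArc K N, IsTheta x y Θ →
      ∀ σ : Equiv.Perm (Fin N),
        (∃! L : HalfDiagram N, L.HasChain (fominP σ)) ∧
        (∃! R : HalfDiagram N, R.HasChain (fominQ σ)) ∧
        ∀ L R : HalfDiagram N, L.HasChain (fominP σ) → R.HasChain (fominQ σ) →
          (∃! D : OkadaDiagram N, IsGluing L R D) ∧
          (∃! D' : OkadaDiagram N, IsGluing R L D') ∧
          ∀ D D' : OkadaDiagram N, IsGluing L R D → IsGluing R L D' →
            Θ (OkadaAlgebra.permElem x y σ) = Finsupp.single D 1 ∧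
            OkArc.mirror (Θ (OkadaAlgebra.permElem x y σ)) =
              Θ (OkadaAlgebra.permElem x y σ⁻¹) ∧
            Θ (OkadaAlgebra.permElem x y σ⁻¹) = Finsupp.single D' 1 := by
  refine ⟨existsUnique_isTheta, fun Θ hΘ σ => ?_⟩
  obtain ⟨E, hw, hP, hQ⟩ := exists_reduced_permWord σ
  obtain ⟨E', hw', hP', hQ'⟩ := exists_reduced_permWord σ⁻¹
  -- Transposing the growth diagram exchanges the two chains, so the diagram of σ⁻¹ has the halves
  -- of the diagram of σ in exchanged roles.
  rw [show fominP σ⁻¹ = fominQ σ from funext fun j => fominGrowth_inv σ N j] at hP'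
  rw [show fominQ σ⁻¹ = fominP σ from funext fun i => fominGrowth_inv σ i N] at hQ'
  refine ⟨⟨_, hP, fun _ h => h.unique hP⟩, ⟨_, hQ, fun _ h => h.unique hQ⟩,
    fun L R hL hR => ?_⟩
  -- Any half diagrams with the prescribed chains are the halves of `E`, so the existence of the
  -- gluing needs no separate construction.
  have hg : IsGluing L R E := ⟨hP.unique hL, hQ.unique hR⟩
  have hg' : IsGluing R L E' := ⟨hP'.unique hR, hQ'.unique hL⟩
  refine ⟨⟨E, hg, fun _ h => h.unique hg⟩, ⟨E', hg', fun _ h => h.unique hg'⟩,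
    fun D D' hD hD' => ?_⟩
  obtain rfl := hD.unique hg
  obtain rfl := hD'.unique hg'
  rw [permElem_eq, permElem_eq, hΘ.map_reduced hw, hΘ.map_reduced hw', OkArc.mirror_single,
    hg.mirror.unique hg']
  exact ⟨rfl, rfl, rfl⟩
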